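/- **Setting.** There are $n$ players. Player $i$ has finite nonempty sets $S_i$ of states and $A_i$ of actions, transition probabilities $P_i(s'\mid s,a)$, and a reward $r_i(s,a)\in[0,1]$ depending on the joint state $s\in\prod_jS_j$ and joint action $a\in\prod_jA_j$; given the current joint state and action, the players' next states are independent with laws $P_i(\cdot\mid s_i,a_i)$. For some $\tau>0$ and every stationary policy $\pi_i$ of every player, the induced chain $P^{\pi_i}(s'\mid s)=\sum_aP_i(s'\mid s,a)\pi_i(a\mid s)$ satisfies $\|(v-v')P^{\pi_i}\|_1\le e^{-1/\tau}\|v-v'\|_1$ for all probability vectors $v,v'$ on $S_i$. The occupation polytope $\mathcal P_i$ is the set of probability vectors $\rho_i$ on $S_i\times A_i$ with $\sum_{s,a}P_i(s'\mid s,a)\rho_i(s,a)=\sum_a\rho_i(s',a)$ for all $s'$; put $\mathcal P=\prod_i\mathcal P_i$ and $\mathcal P_i^{\delta_i}=\{\rho_i\in\mathcal P_i:\rho_i\ge\delta_i\}$. The virtual game has action sets $\mathcal P_i$ and payoffs $V_i(\rho)=\sum_{s,a}\prod_j\rho_j(s_j,a_j)\,r_i(s,a)$. A profile $\rho\in\mathcal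 P$ is an $\varepsilon$-NE if $V_i(\rho)\ge V_i(\theta_i,\rho_{-i})-\varepsilon$ for all $i$ and $\theta_i\in\mathcal P_i$. The virtual game is *socially concave* with weights $\lambda_i>0$ if $\sum_i\lambda_iV_i$ is concave on $\mathcal P$ and, for each $i$ and each fixed $\rho_i\in\mathcal P_i$, $V_i(\rho_i,\cdot)$ is convex in $\rho_{-i}$. **Algorithm.** Fix a waiting time $d\in\mathbb N$, step sizes $\eta^\ell$, initial states $s^0$, initial occupation measures $\rho_i^1$ and dual scores $Y_i^1=0$; put $\tau^1=0$. In batch $k=1,2,\dots$, which begins when the preceding batch ends at time $\tau^k$, every player $i$ plays the policy $\pi_i^k(a\mid s)=\rho_i^k(s,a)/\sum_{a'}\rho_i^k(s,a')$. From time $\tau^k+d$ on, whenever player $i$ is in a state not yet sampled in this batch, it adds $r_i(s^t,a^t)/\pi_i^k(a_i^t\mid s_i^t)$ to the coordinate $(s_i^t,a_i^t)$ of a vector $R_i^k$ that starts at $0$. The batch ends at the first time $\tau^{k+1}$ (played with $\pi^k$) at which all players have sampled all their states; then $Y_i^{k+1}=Y_i^k+\eta^kR_i^k$, and $\rho_i^{k+1}$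 is computed by one of the following rules, where $h_i$ is a regularizer on $\mathcal P_i^{\delta_i}$ and $D_{KL}(x,y)=\sum_px_p\log(x_p/y_p)$. * *Dual averaging:* $\rho_i^{k+1}=\operatorname{argmax}_{\rho_i\in\mathcal P_i^{\delta_i}}\{\langle\rho_i,Y_i^{k+1}\rangle-h_i(\rho_i)\}$, where the maximum with any vector in place of $Y_i^{k+1}$ is assumed to be attained. * *KL mirror descent*, with the rewards normalized to $[-1,0]$ (the algorithm uses $r_i-1$ in place of $r_i$): $\rho_i^{k+1/2}=\operatorname{argmax}_{\rho_i\in\Delta(S_i\times A_i)}\{\langle\eta^kR_i^k,\rho_i\rangle-D_{KL}(\rho_i,\rho_i^k)\}$ and $\rho_i^{k+1}=\operatorname{argmin}_{\rho_i\in\mathcal P_i}D_{KL}(\rho_i,\rho_i^{k+1/2})$. Put $\bar\rho^k=\sum_{\ell=1}^k\frac{\eta^\ell}{w^k}\rho^\ell$ with $w^k=\sum_{\ell=1}^k\eta^\ell$. **Theorem.** Let $\eta^\ell=\ell^{-1/2-\beta}$ with $0<\beta\le\frac12$, let $\varepsilon>0$, let the virtual game be socially concave with weights $\lambda_i$ such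 that $\lambda_i\le\Lambda\lambda_j$ for all $i,j$, and let $$d\ge\tau\ln\Big(\frac{6n}{\varepsilon}\sum_i|A_i||S_i|\Big),\qquad d\ge\tau\ln\Big(\frac{6n\Lambda}{\varepsilon}\sum_i\min\{2,|A_i||S_i|\}\Big)$$ (for $\Lambda=1$ the second condition follows from the first). Let $\delta_i>0$ and $\rho_i^1\in\mathcal P_i^{\delta_i}$. (a) Suppose that every point of $\mathcal P_i$ is within Euclidean distance $\varepsilon/(2\sqrt{|A_i||S_i|})$ of $\mathcal P_i^{\delta_i}$, and that the players use dual averaging with regularizers $h_i$ that are $K$-strongly convex, $K>0$, in the Euclidean norm. Then, almost surely, $\bar\rho^k$ is an $\varepsilon$-NE for all sufficiently large $k$. If moreover $\beta<\frac12$ and $h_i(x)-h_i(y)\le B|S_i||A_i|$ for all $i$ and $x,y\in\mathcal P_i^{\delta_i}$, then for every $\alpha\in(0,1)$, with probability at least $1-\alpha$, $\bar\rho^k$ is an $\varepsilon$-NE simultaneously for all $k\ge1$ with $$k\ge C\Big(\sum_i\frac{n|S_i||A_i|}{\alpha\varepsilon\delta_i}\Big)^{\frac2{1-2\beta}},$$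 where $C$ depends only on $\beta,K,\Lambda,B$. (b) Suppose that $\beta<\frac12$, that the players use KL mirror descent, and that $D_{KL}(\theta_i,\rho_i^1)\le B\log(|S_i||A_i|)$ for all $i$ and $\theta_i\in\mathcal P_i$. Then $\mathbb E[\bar\rho^k]$ is an $\varepsilon$-NE for every $k\ge1$ with $$k\ge C\Big(\sum_i\frac{\log(|S_i||A_i|)+|A_i|}{\varepsilon}\Big)^{\frac2{1-2\beta}},$$ where $C$ depends only on $\beta,\Lambda,B$. -/

import Mathlib

/-- A payoff-coupled stochastic game with independent chains: player `i` has the finite state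
space `S i`, the finite action space `A i`, the transition probabilities
`P i s a s' = Pᵢ(s' | s, a)`, and the reward `r i s a ∈ [0, 1]`, a function of the joint
state and the joint action. -/
structure ChainGame (n : ℕ) (S A : Fin n → Type*) [∀ i, Fintype (S i)] [∀ i, Fintype (A i)] where
  P : ∀ i, S i → A i → S i → ℝ
  r : Fin n → (∀ i, S i) → (∀ i, A i) → ℝ
  P_nonneg : ∀ i s a s', 0 ≤ P i s a s'
  P_sum : ∀ i s a, ∑ s', P i s a s' = 1
  r_nonneg : ∀ i s a, 0 ≤ r i s a
  r_le_one : ∀ i s a, r i s a ≤ 1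

/-- Vectors indexed by the state-action pairs of one player, with the Euclidean norm. -/
abbrev OccVec (S A : Type*) := EuclideanSpace ℝ (S × A)

/-- The stationary policy `π(a | s) = ρ(s, a) / ∑ a', ρ(s, a')` of an occupation measure. -/
noncomputable def policyOf {S A : Type*} [Fintype A] (ρ : OccVec S A) (s : S) (a : A) : ℝ :=
  ρ (s, a) / ∑ a', ρ (s, a')

/-- The probability simplex over the state-action pairs of one player. -/
def occSimplex (S A : Type*) [Fintype S] [Fintype A] : Set (OccVec S A) :=
  {x | (∀ p, 0 ≤ x p) ∧ ∑ p, x p = 1}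

/-- The Kullback-Leibler divergence `∑ x log (x / y)`; it is only used for vectors `y` all of
whose coordinates are positive. -/
noncomputable def klDivergence {S A : Type*} [Fintype S] [Fintype A] (x y : OccVec S A) : ℝ :=
  ∑ p, x p * Real.log (x p / y p)

/-- A maximizer of `f` over `s` (an arbitrary vector if there is none). -/
noncomputable def argmaxOn {E : Type*} [Nonempty E] (s : Set E) (f : E → ℝ) : E :=
  Classical.epsilon fun x => x ∈ s ∧ IsMaxOn f s x

namespace ChainGame

variable {n : ℕ} {S A : Fin n → Type*} [∀ i, Fintype (S i)] [∀ i, Fintype (A i)]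

/-! ### Mixing, occupation polytopes, and the virtual game -/

/-- Transition probability from `s` to `s'` of the chain that a stationary policy `π` of
player `i` induces. -/
noncomputable def inducedChain (G : ChainGame n S A) (i : Fin n) (π : S i → A i → ℝ)
    (s s' : S i) : ℝ :=
  ∑ a, G.P i s a s' * π s a

/-- Under every stationary policy of every player, the induced chain contracts the `ℓ¹` distance
of two state distributions by the factor `exp (-1 / τ)`; in particular it has exactly one
stationary distribution, and it converges to it from every initial state. -/
def MixesWithin (G : ChainGame n S A) (τ : ℝ) : Prop :=
  ∀ (i : Fin n) (π : S i → A i → ℝ), (∀ s, π s ∈ stdSimplex ℝ (A i)) →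
    ∀ v ∈ stdSimplex ℝ (S i), ∀ v' ∈ stdSimplex ℝ (S i),
      ∑ s', |∑ s, (v s - v' s) * G.inducedChain i π s s'| ≤
        Real.exp (-1 / τ) * ∑ s, |v s - v' s|

/-- The polytope `𝒫ᵢ` of feasible occupation measures of player `i`. -/
def polytope (G : ChainGame n S A) (i : Fin n) : Set (OccVec (S i) (A i)) :=
  {ρ | (∀ p, 0 ≤ ρ p) ∧
    (∀ s', ∑ s, ∑ a, G.P i s a s' * ρ (s, a) = ∑ a, ρ (s', a)) ∧ ∑ p, ρ p = 1}

/-- The shrunk polytope: occupation measures with all coordinates at least `δ`. -/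
def shrunkPolytope (G : ChainGame n S A) (i : Fin n) (δ : ℝ) : Set (OccVec (S i) (A i)) :=
  {ρ ∈ G.polytope i | ∀ p, δ ≤ ρ p}

/-- Payoff of player `i` in the virtual game. -/
noncomputable def payoff (G : ChainGame n S A) (i : Fin n) (ρ : ∀ j, OccVec (S j) (A j)) : ℝ :=
  ∑ s : ∀ j, S j, ∑ a : ∀ j, A j, (∏ j, ρ j (s j, a j)) * G.r i s a

/-- `ρ` is an `ε`-Nash equilibrium of the virtual game, in which player `i` chooses a point of
`𝒫ᵢ`. -/
def IsEpsNash (G : ChainGame n S A) (ε : ℝ) (ρ : ∀ j, OccVec (S j) (A j)) : Prop :=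
  (∀ i, ρ i ∈ G.polytope i) ∧
    ∀ i, ∀ x ∈ G.polytope i, G.payoff i (Function.update ρ i x) - ε ≤ G.payoff i ρ

/-- The virtual game is socially concave with weights `lam`: the weighted sum of the payoffs is
concave, and each payoff, for a fixed action `x` of its own player, is convex in the actions of
the others. -/
def SociallyConcave (G : ChainGame n S A) (lam : Fin n → ℝ) : Prop :=
  (∀ i, 0 < lam i) ∧
    ConcaveOn ℝ (Set.univ.pi G.polytope) (fun ρ => ∑ i, lam i * G.payoff i ρ) ∧
    ∀ i, ∀ x ∈ G.polytope i,
      ConvexOn ℝ (Set.univ.pi G.polytope) (fun ρ => G.payoff i (Function.update ρ i x))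

/-! ### The learning algorithm -/

/-- The parameters of the learning algorithm: waiting time `d`, step sizes `η 1, η 2, …`, the
number `shift` that is subtracted from every reward, the initial occupation measures, and the
rule that produces the next occupation measure of player `i` from the new dual score, the last
increment `η R` of that score, and the current occupation measure. -/
structure Scheme (G : ChainGame n S A) where
  d : ℕ
  η : ℕ → ℝ
  shift : ℝ
  init : ∀ i, OccVec (S i) (A i)
  next : ∀ i, OccVec (S i) (A i) → OccVec (S i) (A i) → OccVec (S i) (A i) → OccVec (S i) (A i)

/-- What the algorithm stores: number `k` of the current batch, end `τᵏ` of the preceding batch,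
for each player the set of states not yet sampled in this batch, the reward vector `Rᵢᵏ`
collected so far, the dual score `Yᵢᵏ`, and the occupation measure `ρᵢᵏ` in use. -/
structure Memory (G : ChainGame n S A) where
  batch : ℕ
  start : ℕ
  todo : ∀ i, Set (S i)
  R : ∀ i, OccVec (S i) (A i)
  Y : ∀ i, OccVec (S i) (A i)
  ρ : ∀ i, OccVec (S i) (A i)

variable {G : ChainGame n S A}

open Classical in
/-- Samples at time `t`, in joint state `s` with joint action `a`: nothing happens during the
waiting period; afterwards each player who sees one of its states for the first time in this
batch adds `rᵢ(s, a) / πᵢ(aᵢ | sᵢ)` to the coordinate `(sᵢ, aᵢ)` of its reward vector. -/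
noncomputable def Scheme.sample (L : G.Scheme) (t : ℕ) (s : ∀ i, S i) (a : ∀ i, A i)
    (m : G.Memory) : G.Memory :=
  if m.start + L.d ≤ t then
    { m with
      todo := fun i => m.todo i \ {s i}
      R := fun i =>
        if s i ∈ m.todo i then
          m.R i + EuclideanSpace.single (s i, a i)
            ((G.r i s a - L.shift) / policyOf (m.ρ i) (s i) (a i))
        else m.R i }
  else m

open Classical in
/-- One time step of the algorithm. The batch ends as soon as every player has sampled all of its
states; then dual scores and occupation measures are updated, and a new batch begins. -/
noncomputable def Scheme.step (L : G.Scheme) (t : ℕ) (s : ∀ i, S i) (a : ∀ i, A i)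
    (m : G.Memory) : G.Memory :=
  let m' := L.sample t s a m
  if ∀ i, m'.todo i = ∅ then
    { batch := m'.batch + 1
      start := t
      todo := fun _ => Set.univ
      R := fun _ => 0
      Y := fun i => m'.Y i + L.η m'.batch • m'.R i
      ρ := fun i => L.next i (m'.Y i + L.η m'.batch • m'.R i) (L.η m'.batch • m'.R i) (m'.ρ i) }
  else m'

/-- The memory before time `t`, along the sequence `x` of joint states and actions; it depends
only on `x 0, …, x (t - 1)`. The first batch is batch `1`. -/
noncomputable def Scheme.memory (L : G.Scheme) (x : ℕ → (∀ i, S i) × (∀ i, A i)) : ℕ → G.Memory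
  | 0 =>
    { batch := 1
      start := 0
      todo := fun _ => Set.univ
      R := fun _ => 0
      Y := fun _ => 0
      ρ := L.init }
  | t + 1 => L.step t (x t).1 (x t).2 (L.memory x t)

open Classical in
/-- The occupation measures `ρᵏ` used in batch `k` (the initial ones if that batch is never
reached). -/
noncomputable def Scheme.occ (L : G.Scheme) (x : ℕ → (∀ i, S i) × (∀ i, A i)) (k : ℕ) :
    ∀ i, OccVec (S i) (A i) :=
  if h : ∃ t, (L.memory x t).batch = k then (L.memory x (Nat.find h)).ρ else L.init

/-- The weighted average `∑ ℓ ∈ {1, …, k}, (ηˡ / wᵏ) ρˡ` with `wᵏ = η¹ + ⋯ + ηᵏ`. -/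
noncomputable def Scheme.avgOcc (L : G.Scheme) (x : ℕ → (∀ i, S i) × (∀ i, A i)) (k : ℕ) :
    ∀ i, OccVec (S i) (A i) :=
  ∑ l ∈ Finset.Icc 1 k, (L.η l / ∑ j ∈ Finset.Icc 1 k, L.η j) • L.occ x l

/-- `X` is the random sequence of joint states and joint actions when all players start in `s₀`
and follow the algorithm: given the past, the next states are drawn independently from the
transition probabilities of the players, and then the actions are drawn independently from the
policies in use. -/
structure Scheme.IsRun (L : G.Scheme) (s₀ : ∀ i, S i) {Ω : Type*} [MeasurableSpace Ω]
    (μ : MeasureTheory.Measure Ω) (X : ℕ → Ω → (∀ i, S i) × (∀ i, A i)) : Prop where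
  measurable : ∀ t z, MeasurableSet {ω | X t ω = z}
  initial : ∀ a : ∀ i, A i,
    μ.real {ω | X 0 ω = (s₀, a)} = ∏ i, policyOf (L.init i) (s₀ i) (a i)
  transition : ∀ (t : ℕ) (x : ℕ → (∀ i, S i) × (∀ i, A i)),
    μ.real {ω | ∀ u ≤ t + 1, X u ω = x u} =
      μ.real {ω | ∀ u ≤ t, X u ω = x u} *
        ((∏ i, G.P i ((x t).1 i) ((x t).2 i) ((x (t + 1)).1 i)) *
          ∏ i, policyOf ((L.memory x (t + 1)).ρ i) ((x (t + 1)).1 i) ((x (t + 1)).2 i))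

/-- Dual averaging with regularizers `h i` on the shrunk polytopes. -/
noncomputable def dualAveraging (G : ChainGame n S A) (d : ℕ) (η : ℕ → ℝ) (δ : Fin n → ℝ)
    (h : ∀ i, OccVec (S i) (A i) → ℝ) (ρ₁ : ∀ i, OccVec (S i) (A i)) : G.Scheme where
  d := d
  η := η
  shift := 0
  init := ρ₁
  next := fun i Y _ _ => argmaxOn (G.shrunkPolytope i (δ i)) (fun x => inner ℝ x Y - h i x)

/-- The two-step mirror-descent update with the Kullback-Leibler divergence, run with the rewards
normalized to `[-1, 0]`, that is, with `rᵢ - 1` in place of `rᵢ`. -/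
noncomputable def klMirrorDescent (G : ChainGame n S A) (d : ℕ) (η : ℕ → ℝ)
    (ρ₁ : ∀ i, OccVec (S i) (A i)) : G.Scheme where
  d := d
  η := η
  shift := 1
  init := ρ₁
  next := fun i _ y ρ =>
    let half := argmaxOn (occSimplex (S i) (A i)) (fun x => inner ℝ y x - klDivergence x ρ)
    argmaxOn (G.polytope i) (fun x => - klDivergence x half)

end ChainGame

/-! The weighted sum `gapSum` of all unilateral deviation profits is convex in the profile, by
social concavity, and at a fixed profile it is a linear form in the deviations, with the gradients
`gain` as coefficients. Jensen's inequality therefore bounds it at the averaged profile by the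
weighted regrets of the players against these gradients, divided by the sum of the step sizes
(`sum_mul_gapSum_avgOcc_le`). Letting the comparator differ from the average in one player only
turns this bound into the equilibrium property.

The players see sampled rewards instead of gradients. Within a batch the policies are frozen and the
chains of the players are independent given the past. Conditioning on "player `i` has not yet
sampled `s`" kills the chain of player `i` alone, so the joint law remains a product
(`IsRun.setIntegral_aliveSet`). At the sampling time the other players are within `4 * exp (-1 / τ)
^ d` of their stationary laws, which are the state marginals of the occupation measures in use, and
the importance weight cancels the probability of the player's own action. Hence the reward vector
estimates the gradient up to the error `bias` in each coordinate (`IsRun.abs_rewardMean_sub_le`),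
and the condition on `d` holds the total effect of the bias below `ε / 3`. Batches end almost
surely, because a contracting chain with a positive stationary law visits every state
(`tendsto_sum_killedLaw`).

Rewards minus their conditional means are martingale differences along the batches. In (a) the
comparator depends on the random average, so the noise has to be controlled uniformly in it. This is
done through the `energy`: squared partial sums of the noise plus squared norms of the weighted
rewards. Its mean stays bounded because the step sizes are square summable, and Doob's maximal
inequality bounds all its values at once (`measure_exists_le_energy`). Together with the dual
averaging bound `StrongConvexOn.sum_inner_le`, dividing by the diverging sum of the step sizes gives
both claims of (a). In (b) the comparator is deterministic, so the noise disappears in expectation.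
The second-order term of mirror descent (`mirrorStep_spec`) is weighted by the occupation measure
itself, which bounds its mean in terms of the number of actions, without lower bounds on the
occupation measures. -/

section ProductLaws

/-! ### Product laws on finite sets. -/

variable {ι : Type*} [Fintype ι] [DecidableEq ι] {S A : ι → Type*} [∀ i, Fintype (S i)]
  [∀ i, Fintype (A i)]

lemma sum_pi_prod (f : ∀ j, S j → ℝ) : ∑ y : ∀ j, S j, ∏ j, f j (y j) = ∏ j, ∑ s, f j s := by
  rw [Finset.prod_univ_sum, Fintype.piFinset_univ]

lemma sum_prod_pi_prod (f : ∀ j, S j → A j → ℝ) :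
    ∑ z : (∀ j, S j) × (∀ j, A j), ∏ j, f j (z.1 j) (z.2 j) = ∏ j, ∑ s, ∑ a, f j s a := by
  rw [Fintype.sum_prod_type]
  have : ∀ y : ∀ j, S j, ∑ a : ∀ j, A j, ∏ j, f j (y j) (a j) = ∏ j, ∑ a, f j (y j) a :=
    fun y => sum_pi_prod fun j => f j (y j)
  simp_rw [this]
  exact sum_pi_prod fun j s => ∑ a, f j s a

omit [∀ i, Fintype (S i)] in
lemma prod_update_apply (h : ∀ j, S j → ℝ) (a : ι) (f : S a → ℝ) (y : ∀ j, S j) :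
    ∏ j, Function.update h a f j (y j) = f (y a) * ∏ j ∈ Finset.univ.erase a, h j (y j) := by
  rw [← Finset.mul_prod_erase _ _ (Finset.mem_univ a), Function.update_self]
  congr 1
  exact Finset.prod_congr rfl fun j hj => by
    rw [Function.update_of_ne (Finset.ne_of_mem_erase hj)]

/-- Hybrid argument: the factors are exchanged one at a time, and since all the other factors are
probability vectors, each exchange costs exactly the distance of the exchanged pair. -/
lemma sum_abs_prod_sub_prod_le (p q : ∀ j, S j → ℝ) (hp : ∀ j, p j ∈ stdSimplex ℝ (S j))
    (hq : ∀ j, q j ∈ stdSimplex ℝ (S j)) :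
    ∑ y : ∀ j, S j, |∏ j, p j (y j) - ∏ j, q j (y j)| ≤ ∑ j, ∑ s, |p j s - q j s| := by
  have key : ∀ T : Finset ι, ∑ y : ∀ j, S j,
      |∏ j, T.piecewise p q j (y j) - ∏ j, q j (y j)| ≤ ∑ j ∈ T, ∑ s, |p j s - q j s| := by
    intro T
    induction T using Finset.induction_on with
    | empty => simp
    | insert a T ha ih =>
      rw [Finset.sum_insert ha]
      have hmem : ∀ j, T.piecewise p q j ∈ stdSimplex ℝ (S j) := fun j => by
        by_cases h : j ∈ T <;> simp [h, hp, hq]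
      -- Written as an update at `a`, the old hybrid visibly shares all its factors except the one
      -- at `a` with the new one.
      have h1 : T.piecewise p q = Function.update (T.piecewise p q) a (q a) := by
        rw [eq_comm, Function.update_eq_self_iff, Finset.piecewise_eq_of_notMem _ _ _ ha]
      have h2 : ∀ y : ∀ j, S j, |∏ j, (insert a T).piecewise p q j (y j) -
          ∏ j, T.piecewise p q j (y j)| =
          ∏ j, Function.update (T.piecewise p q) a (fun s => |p a s - q a s|) j (y j) := by
        intro y
        rw [prod_update_apply, Finset.piecewise_insert, prod_update_apply]
        nth_rewrite 2 [h1]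
        rw [prod_update_apply, ← sub_mul, abs_mul, abs_of_nonneg
          (Finset.prod_nonneg fun j _ => (hmem j).1 (y j))]
      calc _ ≤ ∑ y : ∀ j, S j, (|∏ j, (insert a T).piecewise p q j (y j) -
                ∏ j, T.piecewise p q j (y j)| +
              |∏ j, T.piecewise p q j (y j) - ∏ j, q j (y j)|) :=
            Finset.sum_le_sum fun y _ => abs_sub_le _ _ _
        _ ≤ _ := by
            rw [Finset.sum_add_distrib]
            refine add_le_add (le_of_eq ?_) ih
            simp_rw [h2]
            rw [sum_pi_prod, ← Finset.mul_prod_erase _ _ (Finset.mem_univ a),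
              Function.update_self, Finset.prod_eq_one, mul_one]
            intro j hj
            rw [Function.update_of_ne (Finset.ne_of_mem_erase hj)]
            exact (hmem j).2
  simpa using key Finset.univ

/-- Expectations of a function with values in an interval of length one under two product laws
differ by at most half the sum of the `ℓ¹` distances of the factors. -/
lemma abs_sum_prod_mul_sub_le (p q : ∀ j, S j → ℝ) (hp : ∀ j, p j ∈ stdSimplex ℝ (S j))
    (hq : ∀ j, q j ∈ stdSimplex ℝ (S j)) (ψ : (∀ j, S j) → ℝ) (c : ℝ)
    (hψ : ∀ y, c ≤ ψ y ∧ ψ y ≤ c + 1) :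
    |∑ y : ∀ j, S j, (∏ j, p j (y j)) * ψ y - ∑ y : ∀ j, S j, (∏ j, q j (y j)) * ψ y| ≤
      (∑ j, ∑ s, |p j s - q j s|) / 2 := by
  have hp1 : ∑ y : ∀ j, S j, ∏ j, p j (y j) = 1 := by
    rw [sum_pi_prod]; exact Finset.prod_eq_one fun j _ => (hp j).2
  have hq1 : ∑ y : ∀ j, S j, ∏ j, q j (y j) = 1 := by
    rw [sum_pi_prod]; exact Finset.prod_eq_one fun j _ => (hq j).2
  -- Both laws have mass one, so the midpoint of the range may be subtracted from `ψ`; what remains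
  -- is at most `1 / 2` in absolute value.
  have h : ∑ y : ∀ j, S j, (∏ j, p j (y j)) * ψ y - ∑ y : ∀ j, S j, (∏ j, q j (y j)) * ψ y =
      ∑ y : ∀ j, S j, (∏ j, p j (y j) - ∏ j, q j (y j)) * (ψ y - (c + 1 / 2)) := by
    simp_rw [mul_sub, sub_mul, Finset.sum_sub_distrib, ← Finset.sum_mul, hp1, hq1]
    ring
  rw [h]
  calc _ ≤ ∑ y : ∀ j, S j, |∏ j, p j (y j) - ∏ j, q j (y j)| * (1 / 2) := by
        refine (Finset.abs_sum_le_sum_abs _ _).trans (Finset.sum_le_sum fun y _ => ?_)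
        rw [abs_mul]
        refine mul_le_mul_of_nonneg_left ?_ (abs_nonneg _)
        rw [abs_le]
        constructor <;> linarith [(hψ y).1, (hψ y).2]
    _ ≤ _ := by
        rw [← Finset.sum_mul]
        linarith [sum_abs_prod_sub_prod_le p q hp hq]

end ProductLaws

/-! ### Contracting chains and chains killed at a state. -/

section Chains

open Filter Topology

variable {S : Type*} [Fintype S]

/-- The matrix `K` contracts the `ℓ¹` distance of probability vectors by the factor `c`. -/
def ContractsSimplex (K : S → S → ℝ) (c : ℝ) : Prop :=
  ∀ v ∈ stdSimplex ℝ S, ∀ v' ∈ stdSimplex ℝ S,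
    ∑ s', |∑ s, (v s - v' s) * K s s'| ≤ c * ∑ s, |v s - v' s|

/-- The law after `m` steps of a chain with initial law `v`. -/
def pushLaw (K : S → S → ℝ) (v : S → ℝ) : ℕ → S → ℝ
  | 0 => v
  | m + 1 => fun s' => ∑ s, pushLaw K v m s * K s s'

lemma sum_mul_mem_stdSimplex {K : S → S → ℝ} (hK : ∀ s, K s ∈ stdSimplex ℝ S) {v : S → ℝ}
    (hv : v ∈ stdSimplex ℝ S) : (fun s' => ∑ s, v s * K s s') ∈ stdSimplex ℝ S := by
  refine ⟨fun s' => Finset.sum_nonneg fun s _ => mul_nonneg (hv.1 s) ((hK s).1 s'), ?_⟩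
  rw [Finset.sum_comm]
  simp_rw [← Finset.mul_sum, (hK _).2, mul_one]
  exact hv.2

lemma pushLaw_mem_stdSimplex {K : S → S → ℝ} (hK : ∀ s, K s ∈ stdSimplex ℝ S) {v : S → ℝ}
    (hv : v ∈ stdSimplex ℝ S) (m : ℕ) : pushLaw K v m ∈ stdSimplex ℝ S := by
  induction m with
  | zero => exact hv
  | succ m ih => exact sum_mul_mem_stdSimplex hK ih

lemma sum_abs_pushLaw_sub_le {K : S → S → ℝ} (hK : ∀ s, K s ∈ stdSimplex ℝ S) {c : ℝ}
    (hc : 0 ≤ c) (hcK : ContractsSimplex K c) {v ν : S → ℝ} (hv : v ∈ stdSimplex ℝ S)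
    (hν : ν ∈ stdSimplex ℝ S) (hstat : ∀ s', ∑ s, ν s * K s s' = ν s') (m : ℕ) :
    ∑ s, |pushLaw K v m s - ν s| ≤ c ^ m * ∑ s, |v s - ν s| := by
  induction m with
  | zero => simp [pushLaw]
  | succ m ih =>
    have h := hcK _ (pushLaw_mem_stdSimplex hK hv m) _ hν
    simp_rw [sub_mul, Finset.sum_sub_distrib, hstat] at h
    calc _ ≤ c * ∑ s, |pushLaw K v m s - ν s| := h
      _ ≤ c * (c ^ m * ∑ s, |v s - ν s|) := mul_le_mul_of_nonneg_left ih hc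
      _ = _ := by ring

lemma sum_abs_sub_le_two {v ν : S → ℝ} (hv : v ∈ stdSimplex ℝ S) (hν : ν ∈ stdSimplex ℝ S) :
    ∑ s, |v s - ν s| ≤ 2 := by
  calc _ ≤ ∑ s, (v s + ν s) := Finset.sum_le_sum fun s _ => by
        rw [abs_le]; constructor <;> linarith [hv.1 s, hν.1 s]
    _ = 2 := by rw [Finset.sum_add_distrib, hv.2, hν.2]; norm_num

/-- Contraction is only assumed for probability vectors; linearity in the initial law carries its
consequences over to sublaws, through point masses. -/
lemma pushLaw_linear [DecidableEq S] (K : S → S → ℝ) (v : S → ℝ) (m : ℕ) (s' : S) :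
    pushLaw K v m s' = ∑ s, v s * pushLaw K (Pi.single s 1) m s' := by
  induction m generalizing s' with
  | zero => simp [pushLaw, Pi.single_apply]
  | succ m ih =>
    simp only [pushLaw]
    simp_rw [ih, Finset.mul_sum, Finset.sum_mul]
    rw [Finset.sum_comm]
    exact Finset.sum_congr rfl fun _ _ => Finset.sum_congr rfl fun _ _ => by ring

/-- The sublaw after `m` steps of a chain that is killed when it leaves the state `s` at a
time at which `active` holds. -/
noncomputable def killedLaw [DecidableEq S] (K : S → S → ℝ) (s : S) (active : ℕ → Prop)
    [DecidablePred active] (v : S → ℝ) : ℕ → S → ℝ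
  | 0 => v
  | m + 1 => fun s' =>
      ∑ y, killedLaw K s active v m y * (if active m ∧ y = s then 0 else 1) * K y s'

variable [DecidableEq S] {K : S → S → ℝ} {s : S} {active : ℕ → Prop} [DecidablePred active]
  {v : S → ℝ}

lemma killedLaw_nonneg (hK : ∀ s, K s ∈ stdSimplex ℝ S) (hv : ∀ s, 0 ≤ v s) (m : ℕ) (y : S) :
    0 ≤ killedLaw K s active v m y := by
  induction m generalizing y with
  | zero => exact hv y
  | succ m ih =>
    refine Finset.sum_nonneg fun z _ => mul_nonneg (mul_nonneg (ih z) ?_) ((hK z).1 y)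
    split_ifs <;> simp

lemma sum_killedLaw_succ (hK : ∀ s, K s ∈ stdSimplex ℝ S) (m : ℕ) :
    ∑ y, killedLaw K s active v (m + 1) y =
      ∑ y, killedLaw K s active v m y -
        if active m then killedLaw K s active v m s else 0 := by
  simp only [killedLaw]
  rw [Finset.sum_comm]
  simp_rw [← Finset.mul_sum, (hK _).2, mul_one]
  by_cases h : active m
  · rw [if_pos h, ← Finset.sum_erase_add _ _ (Finset.mem_univ s),
      ← Finset.sum_erase_add (a := s) _ (killedLaw K s active v m) (Finset.mem_univ s)]
    rw [add_sub_cancel_right, if_pos ⟨h, rfl⟩, mul_zero, add_zero]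
    refine Finset.sum_congr rfl fun y hy => ?_
    rw [if_neg fun h' => Finset.ne_of_mem_erase hy h'.2, mul_one]
  · simp [h]

/-- The summands are the probabilities that the first visit to `s` at an active time happens at step
`m`. The mass lost in each step is exactly such a probability, and the sum telescopes. -/
lemma sum_range_killedLaw (hK : ∀ s, K s ∈ stdSimplex ℝ S) (hv : v ∈ stdSimplex ℝ S) (M : ℕ) :
    ∑ m ∈ Finset.range M, (if active m then killedLaw K s active v m s else 0) =
      1 - ∑ y, killedLaw K s active v M y := by
  induction M with
  | zero => simp [killedLaw, hv.2]
  | succ M ih => rw [Finset.sum_range_succ, ih, sum_killedLaw_succ hK]; ring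

/-- A contracting chain whose stationary law charges `s` visits `s` almost surely. -/
lemma tendsto_sum_killedLaw (hK : ∀ s, K s ∈ stdSimplex ℝ S) {c : ℝ} (hc : 0 ≤ c) (hc1 : c < 1)
    (hcK : ContractsSimplex K c) {ν : S → ℝ} (hν : ν ∈ stdSimplex ℝ S)
    (hstat : ∀ s', ∑ s, ν s * K s s' = ν s') (hνs : 0 < ν s) (hv : v ∈ stdSimplex ℝ S)
    {m₁ : ℕ} (hact : ∀ m, m₁ ≤ m → active m) :
    Tendsto (fun m => ∑ y, killedLaw K s active v m y) atTop (𝓝 0) := by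
  set U : ℕ → ℝ := fun m => ∑ y, killedLaw K s active v m y with hU
  have hnn : ∀ m y, 0 ≤ killedLaw K s active v m y := killedLaw_nonneg hK hv.1
  have hU0 : ∀ m, 0 ≤ U m := fun m => Finset.sum_nonneg fun y _ => hnn m y
  have hanti : Antitone U := antitone_nat_of_succ_le fun m => by
    simp only [hU]
    rw [sum_killedLaw_succ hK]
    have : (0 : ℝ) ≤ if active m then killedLaw K s active v m s else 0 := by
      split_ifs
      exacts [hnn m s, le_rfl]
    linarith
  obtain ⟨l, hl⟩ : ∃ l, Tendsto U atTop (𝓝 l) :=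
    ⟨_, tendsto_atTop_ciInf hanti ⟨0, by rintro _ ⟨m, rfl⟩; exact hU0 m⟩⟩
  have hl0 : 0 ≤ l := ge_of_tendsto' hl hU0
  -- Killing only removes mass, so after time `m` the killed chain is dominated by the free chain
  -- started from the sublaw at `m`.
  have hle : ∀ m k y, killedLaw K s active v (m + k) y ≤
      pushLaw K (killedLaw K s active v m) k y := by
    intro m k
    induction k with
    | zero => intro y; exact le_rfl
    | succ k ih =>
      intro y
      refine Finset.sum_le_sum fun z _ => mul_le_mul_of_nonneg_right ?_ ((hK z).1 y)
      refine le_trans ?_ (ih z)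
      split_ifs
      · simpa using hnn (m + k) z
      · rw [mul_one]; exact le_rfl
  have hsumpush : ∀ w : S → ℝ, ∀ k, ∑ y, pushLaw K w k y = ∑ y, w y := by
    intro w k
    induction k with
    | zero => rfl
    | succ k ih =>
      simp only [pushLaw]
      rw [Finset.sum_comm]
      simp_rw [← Finset.mul_sum, (hK _).2, mul_one]
      exact ih
  -- Restart at time `m`: after `k` more steps a fraction of almost `ν s` of the free mass sits at
  -- `s`, and the mass of the killed chain at `s` is removed in the next step.
  have hstep : ∀ m, m₁ ≤ m → ∀ k, U (m + k + 1) ≤ U m * (1 - ν s + c ^ k * 2) := by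
    intro m hm k
    have h1 : U (m + k + 1) = ∑ y ∈ Finset.univ.erase s, killedLaw K s active v (m + k) y := by
      simp only [hU]
      rw [sum_killedLaw_succ hK, if_pos (hact _ (by omega)),
        ← Finset.sum_erase_add _ _ (Finset.mem_univ s)]
      ring
    have h2 : ∑ y ∈ Finset.univ.erase s, killedLaw K s active v (m + k) y ≤
        U m - pushLaw K (killedLaw K s active v m) k s := by
      refine (Finset.sum_le_sum fun y _ => hle m k y).trans (le_of_eq ?_)
      simp only [hU]
      rw [← hsumpush _ k, ← Finset.sum_erase_add _ _ (Finset.mem_univ s)]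
      ring
    have h3 : U m * (ν s - c ^ k * 2) ≤ pushLaw K (killedLaw K s active v m) k s := by
      rw [pushLaw_linear, Finset.sum_mul]
      refine Finset.sum_le_sum fun y _ => mul_le_mul_of_nonneg_left ?_ (hnn m y)
      have h4 := sum_abs_pushLaw_sub_le hK hc hcK (single_mem_stdSimplex ℝ y) hν hstat k
      have h5 := Finset.single_le_sum (f := fun t => |pushLaw K (Pi.single y 1) k t - ν t|)
        (fun t _ => abs_nonneg _) (Finset.mem_univ s)
      have h6 := mul_le_mul_of_nonneg_left
        (sum_abs_sub_le_two (single_mem_stdSimplex ℝ y) hν) (pow_nonneg hc k)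
      have h7 := neg_le_of_abs_le ((h5.trans h4).trans h6)
      linarith
    rw [h1]
    nlinarith
  -- With `k → ∞` here and `m → ∞` in `hfin`, the limit satisfies `l ≤ l * (1 - ν s)`, which forces
  -- `l = 0`.
  have hstep' : ∀ m, m₁ ≤ m → l ≤ U m * (1 - ν s) := by
    intro m hm
    have h1 : Tendsto (fun k => U (m + k + 1)) atTop (𝓝 l) := by
      refine hl.comp (tendsto_atTop_mono (fun k => ?_) tendsto_id)
      simp only [id]; omega
    have h2 : Tendsto (fun k : ℕ => U m * (1 - ν s + c ^ k * 2)) atTop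
        (𝓝 (U m * (1 - ν s + 0 * 2))) :=
      (((tendsto_pow_atTop_nhds_zero_of_lt_one hc hc1).mul_const 2).const_add _).const_mul _
    have := le_of_tendsto_of_tendsto' h1 h2 (hstep m hm)
    simpa using this
  have hfin : l ≤ l * (1 - ν s) :=
    ge_of_tendsto (hl.mul_const _) (eventually_atTop.2 ⟨m₁, hstep'⟩)
  have : l = 0 := le_antisymm (by nlinarith) hl0
  rwa [this] at hl

end Chains

namespace ChainGame

variable {n : ℕ} {S A : Fin n → Type*} [∀ i, Fintype (S i)] [∀ i, Fintype (A i)]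
variable {G : ChainGame n S A}

namespace Scheme

variable (L : G.Scheme)

/-! ### Batches along a fixed sequence of states and actions -/

/-- Batch `k` begins at time `t`. -/
def IsFresh (x : ℕ → (∀ i, S i) × (∀ i, A i)) (k t : ℕ) : Prop :=
  (L.memory x t).batch = k ∧ ∀ u < t, (L.memory x u).batch ≠ k

/-- At time `u`, which belongs to batch `k`, player `i` samples the state `s`. -/
def Hits (x : ℕ → (∀ i, S i) × (∀ i, A i)) (k : ℕ) (i : Fin n) (s : S i) (u : ℕ) : Prop :=
  (L.memory x u).batch = k ∧ s ∈ (L.memory x u).todo i ∧ (L.memory x u).start + L.d ≤ u ∧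
    (x u).1 i = s

/-- The time at which batch `k` begins (`0` if it never does). -/
noncomputable def freshTime (x : ℕ → (∀ i, S i) × (∀ i, A i)) (k : ℕ) : ℕ :=
  sInf {t | (L.memory x t).batch = k}

open Classical in
/-- The value of `φ` at the step at which player `i` samples `s` in batch `k`, if that happens
before time `T`. -/
noncomputable def sampledUpTo (φ : (∀ i, S i) × (∀ i, A i) → ℝ)
    (x : ℕ → (∀ i, S i) × (∀ i, A i)) (k : ℕ) (i : Fin n) (s : S i) (T : ℕ) : ℝ :=
  ∑ u ∈ Finset.range T, if L.Hits x k i s u then φ (x u) else 0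

/-- The value of `φ` at the step at which player `i` samples `s` in batch `k`. -/
noncomputable def sampled (φ : (∀ i, S i) × (∀ i, A i) → ℝ)
    (x : ℕ → (∀ i, S i) × (∀ i, A i)) (k : ℕ) (i : Fin n) (s : S i) : ℝ :=
  L.sampledUpTo φ x k i s (L.freshTime x (k + 1))

open Classical in
/-- The importance-weighted reward for the state-action pair `p` of player `i`, when the
occupation measure `ρ` is in use. -/
noncomputable def weightedReward (i : Fin n) (ρ : OccVec (S i) (A i)) (p : S i × A i)
    (z : (∀ i, S i) × (∀ i, A i)) : ℝ :=
  if z.2 i = p.2 then (G.r i z.1 z.2 - L.shift) / policyOf ρ p.1 p.2 else 0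

/-- The reward vector `Rᵢᵏ` at the end of batch `k`. -/
noncomputable def reward (x : ℕ → (∀ i, S i) × (∀ i, A i)) (k : ℕ) (i : Fin n) :
    OccVec (S i) (A i) :=
  WithLp.toLp 2 fun p => L.sampled (L.weightedReward i (L.occ x k i) p) x k i p.1

/-- The dual score at the beginning of batch `k + 1`. -/
noncomputable def score (x : ℕ → (∀ i, S i) × (∀ i, A i)) (k : ℕ) (i : Fin n) :
    OccVec (S i) (A i) :=
  ∑ l ∈ Finset.range k, L.η (l + 1) • L.reward x (l + 1) i

section Memory

variable {L} {x x' : ℕ → (∀ i, S i) × (∀ i, A i)} {k t u : ℕ} {i : Fin n} {s : S i}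

lemma memory_congr (h : ∀ u < t, x u = x' u) : L.memory x t = L.memory x' t := by
  induction t with
  | zero => rfl
  | succ t ih => simp only [memory, h t (Nat.lt_succ_self t), ih fun u hu => h u (by omega)]

lemma IsFresh.congr (hf : L.IsFresh x k t) (h : ∀ u < t, x u = x' u) : L.IsFresh x' k t :=
  ⟨by rw [← memory_congr h]; exact hf.1, fun u hu => by
    rw [← memory_congr fun v hv => h v (hv.trans hu)]; exact hf.2 u hu⟩

lemma sample_batch (a : ∀ i, A i) (s : ∀ i, S i) (m : G.Memory) :
    (L.sample t s a m).batch = m.batch := by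
  unfold sample; split_ifs <;> rfl

lemma sample_start (a : ∀ i, A i) (s : ∀ i, S i) (m : G.Memory) :
    (L.sample t s a m).start = m.start := by
  unfold sample; split_ifs <;> rfl

lemma sample_Y (a : ∀ i, A i) (s : ∀ i, S i) (m : G.Memory) :
    (L.sample t s a m).Y = m.Y := by
  unfold sample; split_ifs <;> rfl

lemma sample_ρ (a : ∀ i, A i) (s : ∀ i, S i) (m : G.Memory) :
    (L.sample t s a m).ρ = m.ρ := by
  unfold sample; split_ifs <;> rfl

/-- The memory after the sampling at time `t`. -/
noncomputable def sampledMemory (L : G.Scheme) (x : ℕ → (∀ i, S i) × (∀ i, A i)) (t : ℕ) :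
    G.Memory :=
  L.sample t (x t).1 (x t).2 (L.memory x t)

lemma memory_succ_of_end (h : ∀ i, (L.sampledMemory x t).todo i = ∅) :
    L.memory x (t + 1) =
      { batch := (L.memory x t).batch + 1
        start := t
        todo := fun _ => Set.univ
        R := fun _ => 0
        Y := fun i => (L.memory x t).Y i +
          L.η (L.memory x t).batch • (L.sampledMemory x t).R i
        ρ := fun i => L.next i ((L.memory x t).Y i +
            L.η (L.memory x t).batch • (L.sampledMemory x t).R i)
          (L.η (L.memory x t).batch • (L.sampledMemory x t).R i) ((L.memory x t).ρ i) } := by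
  rw [memory, step]
  unfold sampledMemory at h
  rw [if_pos h]
  simp only [sample_batch, sample_Y, sample_ρ]
  rfl

lemma memory_succ_of_not_end (h : ¬ ∀ i, (L.sampledMemory x t).todo i = ∅) :
    L.memory x (t + 1) = L.sampledMemory x t := by
  rw [memory, step]
  unfold sampledMemory at h
  rw [if_neg h]
  rfl

lemma mem_sampledMemory_todo :
    s ∈ (L.sampledMemory x t).todo i ↔
      s ∈ (L.memory x t).todo i ∧ ¬ ((L.memory x t).start + L.d ≤ t ∧ (x t).1 i = s) := by
  unfold sampledMemory sample
  split_ifs with h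
  · simp [h, eq_comm]
  · simp [h]

lemma batch_succ : (L.memory x (t + 1)).batch = (L.memory x t).batch ∨
    (L.memory x (t + 1)).batch = (L.memory x t).batch + 1 := by
  by_cases h : ∀ i, (L.sampledMemory x t).todo i = ∅
  · right; rw [memory_succ_of_end h]
  · left; rw [memory_succ_of_not_end h]; exact sample_batch _ _ _

lemma batch_eq_succ_iff : (L.memory x (t + 1)).batch = (L.memory x t).batch ↔
    ¬ ∀ i, (L.sampledMemory x t).todo i = ∅ := by
  by_cases h : ∀ i, (L.sampledMemory x t).todo i = ∅
  · simp [memory_succ_of_end h, h]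
  · simp only [memory_succ_of_not_end h, h, not_false_eq_true, iff_true]
    exact sample_batch _ _ _

lemma batch_mono (x : ℕ → (∀ i, S i) × (∀ i, A i)) : Monotone fun t => (L.memory x t).batch :=
  monotone_nat_of_le_succ fun t => by
    rcases batch_succ (L := L) (x := x) (t := t) with h | h <;> omega

lemma one_le_batch : 1 ≤ (L.memory x t).batch := batch_mono x (Nat.zero_le t)

lemma isFresh_one : L.IsFresh x 1 0 := ⟨rfl, fun u hu => absurd hu (Nat.not_lt_zero u)⟩

lemma exists_isFresh (h : (L.memory x t).batch = k) : ∃ u ≤ t, L.IsFresh x k u := by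
  classical
  have hex : ∃ t, (L.memory x t).batch = k := ⟨t, h⟩
  exact ⟨Nat.find hex, Nat.find_min' hex h, Nat.find_spec hex, fun u hu => Nat.find_min hex hu⟩

lemma exists_isFresh_of_le (hk : 1 ≤ k) (h : k ≤ (L.memory x t).batch) :
    ∃ u ≤ t, L.IsFresh x k u := by
  induction t with
  | zero =>
    have : (L.memory x 0).batch = 1 := rfl
    exact exists_isFresh (by omega)
  | succ t ih =>
    by_cases h' : k ≤ (L.memory x t).batch
    · obtain ⟨u, hu, hf⟩ := ih h'
      exact ⟨u, hu.trans t.le_succ, hf⟩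
    · refine exists_isFresh ?_
      rcases batch_succ (L := L) (x := x) (t := t) with h1 | h1 <;> omega

lemma IsFresh.unique (h : L.IsFresh x k t) (h' : L.IsFresh x k u) : t = u := by
  rcases lt_trichotomy t u with hlt | heq | hlt
  · exact absurd h.1 (h'.2 t hlt)
  · exact heq
  · exact absurd h'.1 (h.2 u hlt)

lemma IsFresh.le (h : L.IsFresh x k t) (hu : (L.memory x u).batch = k) : t ≤ u := by
  by_contra hlt
  exact h.2 u (not_le.1 hlt) hu

lemma IsFresh.freshTime_eq (h : L.IsFresh x k t) : L.freshTime x k = t :=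
  le_antisymm (Nat.sInf_le h.1) (le_csInf ⟨t, h.1⟩ fun _ hu => h.le hu)

lemma IsFresh.occ_eq (h : L.IsFresh x k t) : L.occ x k = (L.memory x t).ρ := by
  classical
  have hex : ∃ t, (L.memory x t).batch = k := ⟨t, h.1⟩
  have : L.IsFresh x k (Nat.find hex) := ⟨Nat.find_spec hex, fun u hu => Nat.find_min hex hu⟩
  rw [occ, dif_pos hex, this.unique h]

lemma occ_of_not_reached (h : ∀ t, (L.memory x t).batch ≠ k) : L.occ x k = L.init := by
  rw [occ, dif_neg (by simpa using h)]

lemma freshTime_of_not_reached (h : ∀ t, (L.memory x t).batch ≠ k) : L.freshTime x k = 0 := by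
  have : {t | (L.memory x t).batch = k} = ∅ := Set.eq_empty_iff_forall_notMem.2 h
  rw [freshTime, this, Nat.sInf_empty]

/-- A batch either is the first one or begins right after the end of the preceding batch. -/
lemma IsFresh.prev (h : L.IsFresh x k (t + 1)) :
    (L.memory x t).batch + 1 = k ∧ ∀ i, (L.sampledMemory x t).todo i = ∅ := by
  have h1 := h.2 t (Nat.lt_succ_self t)
  have h2 := h.1
  have h3 : ∀ i, (L.sampledMemory x t).todo i = ∅ := by
    by_contra hc
    exact h1 (by rw [← h2, batch_eq_succ_iff.2 hc])
  exact ⟨by rw [← h2, memory_succ_of_end h3], h3⟩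

/-- A batch that ends at time `u` stores `start = u`, but the new batch is first in memory at `u +
1`; hence `t - 1`. For the first batch, truncated subtraction gives the correct value `0`. -/
lemma IsFresh.memory_fields (h : L.IsFresh x k t) :
    (L.memory x t).start = t - 1 ∧ (∀ i, (L.memory x t).todo i = Set.univ) ∧
      ∀ i, (L.memory x t).R i = 0 := by
  cases t with
  | zero => exact ⟨rfl, fun _ => rfl, fun _ => rfl⟩
  | succ t =>
    rw [memory_succ_of_end h.prev.2]
    exact ⟨rfl, fun _ => rfl, fun _ => rfl⟩

/-- During a batch only the set of unsampled states and the reward vector change. -/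
lemma IsFresh.memory_eq (h : L.IsFresh x k t) (htu : t ≤ u) (hu : (L.memory x u).batch = k) :
    (L.memory x u).start = t - 1 ∧ (L.memory x u).Y = (L.memory x t).Y ∧
      (L.memory x u).ρ = (L.memory x t).ρ := by
  induction u, htu using Nat.le_induction with
  | base => exact ⟨h.memory_fields.1, rfl, rfl⟩
  | succ u htu ih =>
    have h1 : (L.memory x u).batch = k := by
      have h2 := batch_mono (L := L) x htu
      have h3 := batch_mono (L := L) x (Nat.le_succ u)
      have h4 := h.1
      simp only [Nat.succ_eq_add_one] at h2 h3
      omega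
    have h5 := memory_succ_of_not_end (batch_eq_succ_iff.1 (hu.trans h1.symm))
    rw [h5]
    obtain ⟨i1, i2, i3⟩ := ih h1
    exact ⟨(sample_start _ _ _).trans i1, (sample_Y _ _ _).trans i2, (sample_ρ _ _ _).trans i3⟩

lemma batch_eq_of_le (h : L.IsFresh x k t) (htu : t ≤ u)
    (hu : (L.memory x (u + 1)).batch = k) : (L.memory x u).batch = k := by
  have h2 := batch_mono (L := L) x htu
  have h3 := batch_mono (L := L) x (Nat.le_succ u)
  have h4 := h.1
  simp only [Nat.succ_eq_add_one] at h2 h3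
  omega

/-- An unsampled state keeps the batch open, so survival over one more step depends only on whether
`s` is visited at an active time. This is the transition rule of a killed chain. -/
lemma alive_succ_iff (h : L.IsFresh x k t) (htu : t ≤ u) :
    ((L.memory x (u + 1)).batch = k ∧ s ∈ (L.memory x (u + 1)).todo i) ↔
      ((L.memory x u).batch = k ∧ s ∈ (L.memory x u).todo i) ∧
        ¬ (t - 1 + L.d ≤ u ∧ (x u).1 i = s) := by
  constructor
  · rintro ⟨h1, h2⟩
    have h3 := batch_eq_of_le h htu h1
    have h4 := memory_succ_of_not_end (batch_eq_succ_iff.1 (h1.trans h3.symm))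
    rw [h4, mem_sampledMemory_todo, (h.memory_eq htu h3).1] at h2
    exact ⟨⟨h3, h2.1⟩, h2.2⟩
  · rintro ⟨⟨h1, h2⟩, h3⟩
    have h4 : s ∈ (L.sampledMemory x u).todo i := by
      rw [mem_sampledMemory_todo, (h.memory_eq htu h1).1]
      exact ⟨h2, h3⟩
    have h5 : ¬ ∀ i, (L.sampledMemory x u).todo i = ∅ := fun hc => by
      rw [hc i] at h4; exact h4
    exact ⟨(batch_eq_succ_iff.2 h5).trans h1, by rwa [memory_succ_of_not_end h5]⟩

lemma hits_iff (h : L.IsFresh x k t) (htu : t ≤ u) :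
    L.Hits x k i s u ↔ ((L.memory x u).batch = k ∧ s ∈ (L.memory x u).todo i) ∧
      (t - 1 + L.d ≤ u ∧ (x u).1 i = s) := by
  constructor
  · rintro ⟨h1, h2, h3, h4⟩
    rw [(h.memory_eq htu h1).1] at h3
    exact ⟨⟨h1, h2⟩, h3, h4⟩
  · rintro ⟨⟨h1, h2⟩, h3, h4⟩
    exact ⟨h1, h2, by rwa [(h.memory_eq htu h1).1], h4⟩

lemma Hits.congr (hx : ∀ v < u + 1, x v = x' v) (h : L.Hits x k i s u) : L.Hits x' k i s u := by
  unfold Hits at *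
  rwa [← memory_congr fun v hv => hx v (by omega), ← hx u (by omega)]

lemma Hits.not_alive (h : L.Hits x k i s u) {v : ℕ} (huv : u < v) :
    ¬ ((L.memory x v).batch = k ∧ s ∈ (L.memory x v).todo i) := by
  obtain ⟨t, htu, hf⟩ := exists_isFresh h.1
  induction v, Nat.succ_le_of_lt huv using Nat.le_induction with
  | base =>
    rw [Nat.succ_eq_add_one, alive_succ_iff hf htu]
    exact fun hc => hc.2 ((hits_iff hf htu).1 h).2
  | succ v hv ih =>
    rw [alive_succ_iff hf (by omega)]
    exact fun hc => ih (by omega) hc.1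

/-- A state is sampled at most once per batch, so the sums defining `sampledUpTo` have at most one
nonzero term. -/
lemma Hits.unique (h : L.Hits x k i s u) {v : ℕ} (h' : L.Hits x k i s v) : u = v := by
  rcases lt_trichotomy u v with hlt | heq | hlt
  · exact absurd ⟨h'.1, h'.2.1⟩ (h.not_alive hlt)
  · exact heq
  · exact absurd ⟨h.1, h.2.1⟩ (h'.not_alive hlt)

/-- Until the end of a batch, some state of some player is unsampled. -/
lemma exists_mem_todo [∀ i, Nonempty (S i)] (hn : 0 < n) (x : ℕ → (∀ i, S i) × (∀ i, A i))
    (t : ℕ) : ∃ i s, s ∈ (L.memory x t).todo i := by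
  have huniv : ∀ m : G.Memory, (∀ i, m.todo i = Set.univ) → ∃ i s, s ∈ m.todo i :=
    fun m hm => ⟨⟨0, hn⟩, Classical.arbitrary _, by rw [hm]; trivial⟩
  cases t with
  | zero => exact huniv _ fun _ => rfl
  | succ t =>
    by_cases h : ∀ i, (L.sampledMemory x t).todo i = ∅
    · rw [memory_succ_of_end h]; exact huniv _ fun _ => rfl
    · rw [memory_succ_of_not_end h]
      push Not at h
      exact h

variable {φ : (∀ i, S i) × (∀ i, A i) → ℝ}

open Classical in
lemma sampledUpTo_eq (φ : (∀ i, S i) × (∀ i, A i) → ℝ)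
    (x : ℕ → (∀ i, S i) × (∀ i, A i)) (k : ℕ) (i : Fin n) (s : S i) (T : ℕ) :
    (∃ u < T, L.Hits x k i s u ∧ L.sampledUpTo φ x k i s T = φ (x u)) ∨
      (∀ u < T, ¬ L.Hits x k i s u) ∧ L.sampledUpTo φ x k i s T = 0 := by
  by_cases h : ∃ u < T, L.Hits x k i s u
  · obtain ⟨u, hu, hit⟩ := h
    refine Or.inl ⟨u, hu, hit, ?_⟩
    rw [sampledUpTo, Finset.sum_eq_single u, if_pos hit]
    · exact fun v _ hv => if_neg fun hc => hv (hc.unique hit)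
    · exact fun hc => absurd (Finset.mem_range.2 hu) hc
  · push Not at h
    refine Or.inr ⟨h, Finset.sum_eq_zero fun u hu => if_neg (h u (Finset.mem_range.1 hu))⟩

lemma abs_sampledUpTo_le {M : ℝ} (hM : 0 ≤ M) (hφ : ∀ z, |φ z| ≤ M) (T : ℕ) :
    |L.sampledUpTo φ x k i s T| ≤ M := by
  rcases sampledUpTo_eq (L := L) φ x k i s T with ⟨u, -, -, h⟩ | ⟨-, h⟩ <;> rw [h]
  · exact hφ _
  · simpa using hM

/-- A sum with at most one nonzero term commutes with squaring; second moments of samples thereby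
become first moments of another sampled function. -/
lemma sampledUpTo_sq (T : ℕ) :
    L.sampledUpTo φ x k i s T ^ 2 = L.sampledUpTo (fun z => φ z ^ 2) x k i s T := by
  rcases sampledUpTo_eq (L := L) φ x k i s T with ⟨u, hu, hit, h⟩ | ⟨h0, h⟩
  · rcases sampledUpTo_eq (L := L) (fun z => φ z ^ 2) x k i s T with ⟨v, hv, hit', h'⟩ | ⟨h0, -⟩
    · rw [h, h', hit.unique hit']
    · exact absurd hit (h0 u hu)
  · rcases sampledUpTo_eq (L := L) (fun z => φ z ^ 2) x k i s T with ⟨v, hv, hit', -⟩ | ⟨-, h'⟩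
    · exact absurd hit' (h0 v hv)
    · rw [h, h']; simp

lemma sampledUpTo_congr {T : ℕ} (h : ∀ u < T, x u = x' u) :
    L.sampledUpTo φ x k i s T = L.sampledUpTo φ x' k i s T := by
  refine Finset.sum_congr rfl fun u hu => ?_
  have hu := Finset.mem_range.1 hu
  have h1 : L.Hits x k i s u ↔ L.Hits x' k i s u :=
    ⟨Hits.congr fun v hv => h v (by omega), Hits.congr fun v hv => (h v (by omega)).symm⟩
  rw [h u hu]
  by_cases hc : L.Hits x k i s u
  · rw [if_pos hc, if_pos (h1.1 hc)]
  · rw [if_neg hc, if_neg fun hc' => hc (h1.2 hc')]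

/-- Nothing is sampled for batch `k` after it has ended. -/
lemma sampledUpTo_eq_sampled (h : L.IsFresh x (k + 1) t) (htu : t ≤ u) :
    L.sampledUpTo φ x k i s u = L.sampled φ x k i s := by
  rw [sampled, h.freshTime_eq, sampledUpTo, sampledUpTo]
  refine (Finset.sum_subset (Finset.range_mono htu) fun v _ hv => if_neg fun hc => ?_).symm
  have h1 := batch_mono (L := L) x (not_lt.1 fun h => hv (Finset.mem_range.2 h))
  have h2 := h.1
  have h3 := hc.1
  simp only at h1
  omega

open Classical in
-- The last sample of a batch is taken in the very step that resets the memory. The complete reward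
-- vector is therefore visible in `sampledMemory` only, never in `memory`.
lemma IsFresh.sampledMemory_R (h : L.IsFresh x k t) (htu : t ≤ u)
    (hu : (L.memory x u).batch = k) (p : S i × A i) :
    (L.sampledMemory x u).R i p = (L.memory x u).R i p +
      if L.Hits x k i p.1 u then L.weightedReward i ((L.memory x t).ρ i) p (x u) else 0 := by
  unfold sampledMemory sample
  by_cases hact : (L.memory x u).start + L.d ≤ u
  · rw [if_pos hact]
    simp only
    by_cases hs : (x u).1 i ∈ (L.memory x u).todo i
    · rw [if_pos hs, PiLp.add_apply, PiLp.single_apply]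
      congr 1
      by_cases hp : p = ((x u).1 i, (x u).2 i)
      · have hit : L.Hits x k i p.1 u := ⟨hu, by rw [hp]; exact hs, hact, by rw [hp]⟩
        rw [if_pos hp, if_pos hit, weightedReward, if_pos (by rw [hp]),
          ← (h.memory_eq htu hu).2.2, hp]
      · rw [if_neg hp]
        split_ifs with hit
        · rw [weightedReward, if_neg]
          exact fun hc => hp (Prod.ext hit.2.2.2.symm hc.symm)
        · rfl
    · rw [if_neg hs, if_neg, add_zero]
      exact fun hit => hs (hit.2.2.2 ▸ hit.2.1)
  · rw [if_neg hact, if_neg, add_zero]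
    exact fun hit => hact hit.2.2.1

open Classical in
/-- The reward vector in memory collects the samples of the current batch. -/
lemma IsFresh.memory_R (h : L.IsFresh x k t) (htu : t ≤ u) (hu : (L.memory x u).batch = k)
    (p : S i × A i) : (L.memory x u).R i p =
      L.sampledUpTo (L.weightedReward i ((L.memory x t).ρ i) p) x k i p.1 u := by
  induction u, htu using Nat.le_induction with
  | base =>
    rw [h.memory_fields.2.2, sampledUpTo, Finset.sum_eq_zero]
    · rfl
    · exact fun v hv => if_neg fun hc => h.2 v (Finset.mem_range.1 hv) hc.1
  | succ u htu ih =>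
    have h1 := batch_eq_of_le h htu hu
    have h5 := memory_succ_of_not_end (batch_eq_succ_iff.1 (hu.trans h1.symm))
    rw [h5, sampledUpTo, Finset.sum_range_succ, ← sampledUpTo, ← ih h1]
    exact h.sampledMemory_R htu h1 p

/-- The update at the end of batch `k`. -/
lemma IsFresh.memory_next (h : L.IsFresh x k t) (h' : L.IsFresh x (k + 1) u) :
    (∀ i, (L.memory x u).Y i = (L.memory x t).Y i + L.η k • L.reward x k i) ∧
    ∀ i, (L.memory x u).ρ i = L.next i ((L.memory x t).Y i + L.η k • L.reward x k i)
      (L.η k • L.reward x k i) ((L.memory x t).ρ i) := by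
  cases u with
  | zero =>
    have h1 := h'.1
    have h2 := h.1
    have h3 := one_le_batch (L := L) (x := x) (t := t)
    have : (L.memory x 0).batch = 1 := rfl
    omega
  | succ u =>
    obtain ⟨h1, h2⟩ := h'.prev
    have hk : (L.memory x u).batch = k := by omega
    have htu := h.le hk
    have hR : ∀ i, (L.sampledMemory x u).R i = L.reward x k i := by
      intro i
      ext p
      rw [h.sampledMemory_R htu hk, h.memory_R htu hk]
      change _ = L.sampled _ x k i p.1
      rw [sampled, h'.freshTime_eq, h.occ_eq, sampledUpTo, sampledUpTo, Finset.sum_range_succ]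
    obtain ⟨-, h4, h5⟩ := h.memory_eq htu hk
    rw [memory_succ_of_end h2]
    simp only [hk, hR, h4, h5, implies_true, and_self]

lemma IsFresh.memory_Y (h : L.IsFresh x (k + 1) t) (i : Fin n) :
    (L.memory x t).Y i = L.score x k i := by
  induction k generalizing t with
  | zero =>
    rw [← isFresh_one.unique h]
    simp [score, memory]
  | succ k ih =>
    obtain ⟨u, -, hu⟩ := exists_isFresh_of_le (k := k + 1) (by omega) (by rw [h.1]; omega)
    rw [(hu.memory_next h).1, ih hu, score, score, Finset.sum_range_succ]

/-- The occupation measures follow the update rule. -/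
lemma occ_succ (h : L.IsFresh x (k + 2) t) (i : Fin n) :
    L.occ x (k + 2) i = L.next i (L.score x (k + 1) i)
      (L.η (k + 1) • L.reward x (k + 1) i) (L.occ x (k + 1) i) := by
  obtain ⟨u, -, hu⟩ := exists_isFresh_of_le (k := k + 1) (by omega) (by rw [h.1]; omega)
  rw [h.occ_eq, hu.occ_eq, (hu.memory_next h).2, hu.memory_Y, score, score,
    Finset.sum_range_succ]

lemma occ_one : L.occ x 1 = L.init := isFresh_one.occ_eq

end Memory

end Scheme

end ChainGame

open MeasureTheory

namespace ChainGame

variable {n : ℕ} {S A : Fin n → Type*} [∀ i, Fintype (S i)] [∀ i, Fintype (A i)]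
variable {G : ChainGame n S A}

/-! ### Policies and stationary laws of occupation measures -/

/-- The state marginal of an occupation measure. -/
noncomputable def stateLaw {S A : Type*} [Fintype A] (ρ : OccVec S A) (s : S) : ℝ :=
  ∑ a, ρ (s, a)

section Policy

variable {i : Fin n} {ρ : OccVec (S i) (A i)}

lemma stateLaw_pos {S A : Type*} [Fintype A] [Nonempty A] {ρ : OccVec S A} (hρ : ∀ p, 0 < ρ p)
    (s : S) : 0 < stateLaw ρ s :=
  Finset.sum_pos (fun a _ => hρ (s, a)) Finset.univ_nonempty

lemma policyOf_pos {S A : Type*} [Fintype A] [Nonempty A] {ρ : OccVec S A} (hρ : ∀ p, 0 < ρ p)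
    (s : S) (a : A) : 0 < policyOf ρ s a :=
  div_pos (hρ _) (stateLaw_pos hρ s)

lemma policyOf_mem_stdSimplex {S A : Type*} [Fintype A] [Nonempty A] {ρ : OccVec S A}
    (hρ : ∀ p, 0 < ρ p) (s : S) : policyOf ρ s ∈ stdSimplex ℝ A := by
  refine ⟨fun a => (policyOf_pos hρ s a).le, ?_⟩
  unfold policyOf
  rw [← Finset.sum_div]
  exact div_self (stateLaw_pos hρ s).ne'

lemma stateLaw_mul_policyOf {S A : Type*} [Fintype A] [Nonempty A] {ρ : OccVec S A}
    (hρ : ∀ p, 0 < ρ p) (s : S) (a : A) : stateLaw ρ s * policyOf ρ s a = ρ (s, a) :=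
  mul_div_cancel₀ _ (stateLaw_pos hρ s).ne'

lemma stateLaw_mem_stdSimplex (h : ρ ∈ G.polytope i) : stateLaw ρ ∈ stdSimplex ℝ (S i) :=
  ⟨fun s => Finset.sum_nonneg fun a _ => h.1 _, by
    rw [← h.2.2, Fintype.sum_prod_type]; rfl⟩

lemma inducedChain_mem_stdSimplex (G : ChainGame n S A) {π : S i → A i → ℝ}
    (hπ : ∀ s, π s ∈ stdSimplex ℝ (A i)) (s : S i) :
    G.inducedChain i π s ∈ stdSimplex ℝ (S i) := by
  refine ⟨fun s' => Finset.sum_nonneg fun a _ => mul_nonneg (G.P_nonneg i s a s') ((hπ s).1 a), ?_⟩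
  unfold inducedChain
  rw [Finset.sum_comm]
  simp_rw [← Finset.sum_mul, G.P_sum, one_mul]
  exact (hπ s).2

/-- The flow equations of the polytope say precisely that the state marginal is stationary under the
policy read off from the occupation measure. -/
lemma stateLaw_stationary [Nonempty (A i)] (h : ρ ∈ G.polytope i) (hρ : ∀ p, 0 < ρ p) (s' : S i) :
    ∑ s, stateLaw ρ s * G.inducedChain i (policyOf ρ) s s' = stateLaw ρ s' := by
  rw [stateLaw, ← h.2.1 s']
  refine Finset.sum_congr rfl fun s _ => ?_
  rw [inducedChain, Finset.mul_sum]
  refine Finset.sum_congr rfl fun a _ => ?_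
  rw [← stateLaw_mul_policyOf hρ]
  ring

lemma P_mem_stdSimplex (G : ChainGame n S A) (i : Fin n) (s : S i) (a : A i) :
    G.P i s a ∈ stdSimplex ℝ (S i) := ⟨G.P_nonneg i s a, G.P_sum i s a⟩

/-- Transition probabilities from two state-action pairs are close when the chain mixes fast. -/
lemma sum_abs_P_sub_le {τ : ℝ} (hτ : G.MixesWithin τ) (s s' : S i) (a a' : A i) :
    ∑ y, |G.P i s a y - G.P i s' a' y| ≤ 4 * Real.exp (-1 / τ) := by
  classical
  have hne : ∀ (s s' : S i) (a a' : A i), s ≠ s' →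
      ∑ y, |G.P i s a y - G.P i s' a' y| ≤ 2 * Real.exp (-1 / τ) := by
    intro s s' a a' hss
    -- A policy that plays `a` at `s` and `a'` everywhere else turns the two transition rows into
    -- images of two point masses under a single chain, to which the contraction applies.
    set π : S i → A i → ℝ := fun y => if y = s then Pi.single a 1 else Pi.single a' 1 with hπ
    have hind : ∀ y, G.inducedChain i π y = G.P i y (if y = s then a else a') := by
      intro y
      ext y'
      by_cases h : y = s <;> simp [inducedChain, hπ, h, Pi.single_apply]
    have h := hτ i π (fun y => by
      simp only [hπ]; split_ifs <;> exact single_mem_stdSimplex ℝ _)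
      _ (single_mem_stdSimplex ℝ s) _ (single_mem_stdSimplex ℝ s')
    simp_rw [sub_mul, Finset.sum_sub_distrib, Pi.single_apply, ite_mul, one_mul, zero_mul,
      Finset.sum_ite_eq', Finset.mem_univ, if_true, hind, if_true, if_neg hss.symm] at h
    have h2 := sum_abs_sub_le_two (single_mem_stdSimplex ℝ s) (single_mem_stdSimplex ℝ s')
    simp_rw [Pi.single_apply] at h2
    nlinarith [Real.exp_pos (-1 / τ)]
  -- For two actions in the same state, a detour through another state doubles the bound; if there
  -- is no other state, all transition rows coincide.
  by_cases hss : s = s'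
  · by_cases hex : ∃ s'', s'' ≠ s
    · obtain ⟨s'', hs''⟩ := hex
      calc _ ≤ ∑ y, (|G.P i s a y - G.P i s'' a y| + |G.P i s'' a y - G.P i s' a' y|) :=
            Finset.sum_le_sum fun y _ => abs_sub_le _ _ _
        _ ≤ 2 * Real.exp (-1 / τ) + 2 * Real.exp (-1 / τ) := by
            rw [Finset.sum_add_distrib]
            exact add_le_add (hne _ _ _ _ hs''.symm) (hne _ _ _ _ (hss ▸ hs''))
        _ = _ := by ring
    · push Not at hex
      have hP : ∀ y b, G.P i s b y = 1 := fun y b => by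
        have := G.P_sum i s b
        rwa [Finset.sum_eq_single y (fun z _ hz => absurd ((hex z).trans (hex y).symm) hz)
          (fun h => absurd (Finset.mem_univ _) h)] at this
      subst hss
      simp [hP, Real.exp_nonneg]
  · exact (hne s s' a a' hss).trans (by nlinarith [Real.exp_pos (-1 / τ)])

/-- The stationary law is an average of transition rows. The bound is for the step into a new batch,
which counts towards the waiting time although its action still came from the preceding policy. -/
lemma sum_abs_P_sub_stateLaw_le {τ : ℝ} (hτ : G.MixesWithin τ) (h : ρ ∈ G.polytope i) (s : S i)
    (a : A i) : ∑ y, |G.P i s a y - stateLaw ρ y| ≤ 4 * Real.exp (-1 / τ) := by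
  have h1 : ∀ y, G.P i s a y - stateLaw ρ y =
      ∑ p : S i × A i, ρ p * (G.P i s a y - G.P i p.1 p.2 y) := by
    intro y
    simp_rw [mul_sub, Finset.sum_sub_distrib, ← Finset.sum_mul, h.2.2, one_mul]
    rw [stateLaw, ← h.2.1 y, ← Fintype.sum_prod_type']
    exact congrArg _ (Finset.sum_congr rfl fun p _ => mul_comm _ _)
  calc _ ≤ ∑ y, ∑ p : S i × A i, ρ p * |G.P i s a y - G.P i p.1 p.2 y| := by
        refine Finset.sum_le_sum fun y _ => ?_
        rw [h1]
        refine (Finset.abs_sum_le_sum_abs _ _).trans (le_of_eq ?_)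
        exact Finset.sum_congr rfl fun p _ => by rw [abs_mul, abs_of_nonneg (h.1 p)]
    _ = ∑ p : S i × A i, ρ p * ∑ y, |G.P i s a y - G.P i p.1 p.2 y| := by
        rw [Finset.sum_comm]; simp_rw [Finset.mul_sum]
    _ ≤ ∑ p : S i × A i, ρ p * (4 * Real.exp (-1 / τ)) :=
        Finset.sum_le_sum fun p _ =>
          mul_le_mul_of_nonneg_left (sum_abs_P_sub_le hτ _ _ _ _) (h.1 p)
    _ = _ := by rw [← Finset.sum_mul, h.2.2, one_mul]

end Policy

namespace Scheme

variable (L : G.Scheme)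

/-- All occupation measures that the algorithm can use are feasible and positive. -/
def Positive : Prop :=
  ∀ x t i, (L.memory x t).ρ i ∈ G.polytope i ∧ ∀ p, 0 < (L.memory x t).ρ i p

/-- The law of the state of player `j` at time `t`, given the past. -/
noncomputable def stateKernel (s₀ : ∀ i, S i) (x : ℕ → (∀ i, S i) × (∀ i, A i)) :
    ℕ → ∀ j, S j → ℝ
  | 0 => fun j => open Classical in Pi.single (s₀ j) 1
  | t + 1 => fun j => G.P j ((x t).1 j) ((x t).2 j)

/-- The joint law of states and actions at time `t`, given the past. -/
noncomputable def stepKernel (s₀ : ∀ i, S i) (x : ℕ → (∀ i, S i) × (∀ i, A i)) (t : ℕ)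
    (z : (∀ i, S i) × (∀ i, A i)) : ℝ :=
  (∏ j, stateKernel (G := G) s₀ x t j (z.1 j)) *
    ∏ j, policyOf ((L.memory x t).ρ j) (z.1 j) (z.2 j)

end Scheme

/-- Outcomes whose path agrees with `x` before time `t`. -/
def cylinder {Ω Z : Type*} (X : ℕ → Ω → Z) (x : ℕ → Z) (t : ℕ) : Set Ω :=
  {ω | ∀ u < t, X u ω = x u}

/-! ### Integrals over cylinders of the path space. -/

section Cylinders

variable {Ω Z : Type*} [MeasurableSpace Ω] {μ : Measure Ω} {X : ℕ → Ω → Z} [Finite Z]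

omit [Finite Z] in
lemma measurableSet_cylinder (hX : ∀ t z, MeasurableSet {ω | X t ω = z}) (x : ℕ → Z) (t : ℕ) :
    MeasurableSet (cylinder X x t) := by
  have : cylinder X x t = ⋂ u ∈ Finset.range t, {ω | X u ω = x u} := by
    ext ω; simp [cylinder]
  rw [this]
  exact Finset.measurableSet_biInter _ fun u _ => hX u _

omit [MeasurableSpace Ω] [Finite Z] in
lemma cylinder_congr {x x' : ℕ → Z} {t : ℕ} (h : ∀ u < t, x u = x' u) :
    cylinder X x t = cylinder X x' t := by
  ext ω
  exact forall₂_congr fun u hu => by rw [h u hu]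

/-- An inequality between integrals holds over a set that a stopping rule splits into cylinders
if it holds over each of these cylinders. -/
lemma setIntegral_le_of_cylinder (hX : ∀ t z, MeasurableSet {ω | X t ω = z})
    (Stop : (ℕ → Z) → ℕ → Prop)
    (hcongr : ∀ x x' t, Stop x t → (∀ u < t, x u = x' u) → Stop x' t)
    (huniq : ∀ x t u, Stop x t → Stop x u → t = u) {B : Set Ω}
    (hB : ∀ ω ω' t, ω ∈ B → Stop (fun u => X u ω) t → (∀ u < t, X u ω = X u ω') → ω' ∈ B)
    (hreach : ∀ᵐ ω ∂μ, ω ∈ B → ∃ t, Stop (fun u => X u ω) t) {f g : Ω → ℝ}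
    (hf : Integrable f μ) (hg : Integrable g μ)
    (h : ∀ x t, Stop x t → cylinder X x t ⊆ B →
      ∫ ω in cylinder X x t, f ω ∂μ ≤ ∫ ω in cylinder X x t, g ω ∂μ) :
    ∫ ω in B, f ω ∂μ ≤ ∫ ω in B, g ω ∂μ := by
  -- The event is cut according to the stopping time and the path before it. There are countably
  -- many pieces, and each nonempty one is a whole cylinder.
  set V : (Σ t : ℕ, Fin t → Z) → Set Ω := fun q =>
    {ω | ω ∈ B ∧ Stop (fun u => X u ω) q.1 ∧ ∀ u : Fin q.1, X u ω = q.2 u} with hV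
  have hVcyl : ∀ q ω, ω ∈ V q → V q = cylinder X (fun u => X u ω) q.1 := by
    rintro q ω ⟨h1, h2, h3⟩
    ext ω'
    constructor
    · rintro ⟨-, -, h3'⟩ u hu
      exact (h3' ⟨u, hu⟩).trans (h3 ⟨u, hu⟩).symm
    · intro h'
      exact ⟨hB ω ω' q.1 h1 h2 fun u hu => (h' u hu).symm,
        hcongr _ _ _ h2 fun u hu => (h' u hu).symm, fun u => (h' u u.2).trans (h3 u)⟩
  have hmeas : ∀ q, MeasurableSet (V q) := by
    intro q
    rcases (V q).eq_empty_or_nonempty with h0 | ⟨ω, hω⟩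
    · rw [h0]; exact MeasurableSet.empty
    · rw [hVcyl q ω hω]; exact measurableSet_cylinder hX _ _
  have hdisj : Pairwise (Function.onFun Disjoint V) := by
    rintro ⟨t, p⟩ ⟨u, r⟩ hne
    refine Set.disjoint_left.2 ?_
    rintro ω ⟨-, h2, h3⟩ ⟨-, h2', h3'⟩
    obtain rfl : t = u := huniq _ _ _ h2 h2'
    refine hne ?_
    congr 1
    funext v
    exact (h3 v).symm.trans (h3' v)
  have hae : B =ᵐ[μ] ⋃ q, V q := by
    filter_upwards [hreach] with ω hω
    refine propext ⟨fun hωB => ?_, fun hω' => ?_⟩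
    · obtain ⟨t, ht⟩ := hω hωB
      exact Set.mem_iUnion.2 ⟨⟨t, fun u => X u ω⟩, hωB, ht, fun _ => rfl⟩
    · obtain ⟨q, hq⟩ := Set.mem_iUnion.1 hω'
      exact hq.1
  rw [setIntegral_congr_set hae, setIntegral_congr_set hae]
  refine hasSum_le (fun q => ?_) (hasSum_integral_iUnion hmeas hdisj hf.integrableOn)
    (hasSum_integral_iUnion hmeas hdisj hg.integrableOn)
  rcases (V q).eq_empty_or_nonempty with h0 | ⟨ω, hω⟩
  · simp [h0]
  · have h1 := hVcyl q ω hω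
    rw [h1]
    exact h _ _ hω.2.1 (h1 ▸ fun ω' hω' => hω'.1)

/-- The case of a deterministic stopping time, applied in both directions. -/
lemma setIntegral_eq_of_cylinder (hX : ∀ t z, MeasurableSet {ω | X t ω = z}) {t : ℕ} {B : Set Ω}
    (hB : ∀ ω ω', ω ∈ B → (∀ u < t, X u ω = X u ω') → ω' ∈ B) {f g : Ω → ℝ}
    (hf : Integrable f μ) (hg : Integrable g μ)
    (h : ∀ x, ∫ ω in cylinder X x t, f ω ∂μ = ∫ ω in cylinder X x t, g ω ∂μ) :
    ∫ ω in B, f ω ∂μ = ∫ ω in B, g ω ∂μ := by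
  have key : ∀ f g : Ω → ℝ, Integrable f μ → Integrable g μ →
      (∀ x, ∫ ω in cylinder X x t, f ω ∂μ = ∫ ω in cylinder X x t, g ω ∂μ) →
      ∫ ω in B, f ω ∂μ ≤ ∫ ω in B, g ω ∂μ := fun f g hf hg h =>
    setIntegral_le_of_cylinder hX (fun _ u => u = t) (fun _ _ _ h _ => h)
      (fun _ _ _ h h' => h.trans h'.symm) (fun ω ω' u hω hu hag => hB ω ω' hω (hu ▸ hag))
      (Filter.Eventually.of_forall fun ω _ => ⟨t, rfl⟩) hf hg
      (fun x u hu _ => by rw [hu]; exact (h x).le)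
  exact le_antisymm (key f g hf hg h) (key g f hg hf fun x => (h x).symm)

lemma measurable_comp_step (hX : ∀ t z, MeasurableSet {ω | X t ω = z}) {α : Type*}
    [MeasurableSpace α] (φ : Z → α) (t : ℕ) : Measurable fun ω => φ (X t ω) := by
  let _ : MeasurableSpace Z := ⊤
  have h1 : Measurable (X t) := measurable_to_countable' fun z => hX t z
  exact (measurable_from_top (f := φ)).comp h1

lemma integrable_comp_step [IsFiniteMeasure μ] (hX : ∀ t z, MeasurableSet {ω | X t ω = z})
    (φ : Z → ℝ) (t : ℕ) : Integrable (fun ω => φ (X t ω)) μ := by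
  obtain ⟨M, hM⟩ := (Set.finite_range fun z => |φ z|).bddAbove
  refine Integrable.of_bound (measurable_comp_step hX φ t).aestronglyMeasurable M
    (Filter.Eventually.of_forall fun ω => hM ⟨X t ω, rfl⟩)

end Cylinders

namespace Scheme

variable {L : G.Scheme} {s₀ : ∀ i, S i} {Ω : Type*} [MeasurableSpace Ω] {μ : Measure Ω}
  [IsProbabilityMeasure μ] {X : ℕ → Ω → (∀ i, S i) × (∀ i, A i)}

lemma sum_stepKernel [∀ i, Nonempty (A i)] (hL : L.Positive)
    (x : ℕ → (∀ i, S i) × (∀ i, A i)) (t : ℕ) : ∑ z, L.stepKernel s₀ x t z = 1 := by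
  unfold stepKernel
  simp_rw [← Finset.prod_mul_distrib]
  rw [sum_prod_pi_prod fun j s a =>
    stateKernel (G := G) s₀ x t j s * policyOf ((L.memory x t).ρ j) s a]
  refine Finset.prod_eq_one fun j _ => ?_
  simp_rw [← Finset.mul_sum, (policyOf_mem_stdSimplex (hL x t j).2 _).2, mul_one]
  cases t with
  | zero => simp [stateKernel]
  | succ t => exact G.P_sum j _ _

lemma stateKernel_mem_stdSimplex (G : ChainGame n S A) (x : ℕ → (∀ i, S i) × (∀ i, A i)) (t : ℕ)
    (j : Fin n) : stateKernel (G := G) s₀ x t j ∈ stdSimplex ℝ (S j) := by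
  cases t with
  | zero => classical exact single_mem_stdSimplex ℝ (s₀ j)
  | succ t => exact P_mem_stdSimplex G j _ _

/-- The chain rule for the probabilities of cylinders. -/
lemma IsRun.measureReal_cylinder_succ [∀ i, Nonempty (A i)] (hX : L.IsRun s₀ μ X)
    (hL : L.Positive) (x : ℕ → (∀ i, S i) × (∀ i, A i)) (t : ℕ) :
    μ.real (cylinder X x (t + 1)) = μ.real (cylinder X x t) * L.stepKernel s₀ x t (x t) := by
  classical
  cases t with
  | succ t =>
    have h := hX.transition t x
    simp only [← Nat.lt_succ_iff] at h
    exact h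
  | zero =>
    have h0 : cylinder X x 0 = Set.univ := Set.eq_univ_of_forall fun ω u hu => by omega
    have h1 : cylinder X x 1 = {ω | X 0 ω = x 0} := by
      ext ω
      exact ⟨fun h => h 0 one_pos, fun h u hu => by
        obtain rfl : u = 0 := by omega
        exact h⟩
    rw [h0, zero_add, h1, probReal_univ, one_mul]
    -- Only the probabilities of pairs with first component `s₀` are prescribed at time `0`. They
    -- add up to one, so all other pairs have probability zero.
    set w : (∀ i, S i) × (∀ i, A i) → ℝ := fun z => μ.real {ω | X 0 ω = z} with hw
    have hw0 : ∀ z, 0 ≤ w z := fun z => measureReal_nonneg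
    have hk : ∀ a, w (s₀, a) = L.stepKernel s₀ x 0 (s₀, a) := by
      intro a
      simp only [hw]
      rw [hX.initial a]
      simp [stepKernel, stateKernel, memory]
    have hk0 : ∀ y, y ≠ s₀ → ∀ a, L.stepKernel s₀ x 0 (y, a) = 0 := by
      intro y hy a
      obtain ⟨j, hj⟩ := Function.ne_iff.1 hy
      rw [stepKernel, Finset.prod_eq_zero (Finset.mem_univ j), zero_mul]
      simp [stateKernel, hj]
    have hsum : ∑ z, w z = 1 := by
      simp only [hw]
      rw [← measureReal_biUnion_finset (f := fun z => {ω | X 0 ω = z}) (fun z _ z' _ hzz => Set.disjoint_left.2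
        fun ω h h' => hzz (Eq.trans (Eq.symm h) h')) fun z _ => hX.measurable 0 z]
      rw [show (⋃ b ∈ Finset.univ, {ω | X 0 ω = b}) = Set.univ by ext; simp]
      exact probReal_univ
    have hs : ∑ a, w (s₀, a) = 1 := by
      have h2 := sum_stepKernel (s₀ := s₀) hL x 0
      rw [Fintype.sum_prod_type, Finset.sum_eq_single s₀
        (fun y _ hy => Finset.sum_eq_zero fun a _ => hk0 y hy a)
        (fun h => absurd (Finset.mem_univ _) h)] at h2
      rw [← h2]
      exact Finset.sum_congr rfl fun a _ => hk a
    change w (x 0) = _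
    obtain ⟨y, a⟩ := x 0
    by_cases hy : y = s₀
    · rw [hy, hk]
    · have h3 : ∑ y, ∑ a, w (y, a) = 1 := by rw [← Fintype.sum_prod_type']; exact hsum
      rw [← Finset.add_sum_erase _ _ (Finset.mem_univ s₀), hs] at h3
      have h4 := Finset.single_le_sum (f := fun y => ∑ a, w (y, a))
        (fun y _ => Finset.sum_nonneg fun a _ => hw0 _) (Finset.mem_erase.2 ⟨hy, Finset.mem_univ y⟩)
      have h5 := Finset.single_le_sum (f := fun a => w (y, a)) (fun a _ => hw0 _)
        (Finset.mem_univ a)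
      have h6 := hw0 (y, a)
      rw [show L.stepKernel s₀ x 0 (y, a) = 0 from hk0 y hy a]
      linarith

omit [IsProbabilityMeasure μ] in
lemma stepKernel_congr {x x' : ℕ → (∀ i, S i) × (∀ i, A i)} {t : ℕ} (h : ∀ u < t, x u = x' u) :
    L.stepKernel s₀ x t = L.stepKernel s₀ x' t := by
  have h1 : stateKernel (G := G) s₀ x t = stateKernel (G := G) s₀ x' t := by
    cases t with
    | zero => rfl
    | succ t => simp only [stateKernel, h t t.lt_succ_self]
  unfold stepKernel
  rw [h1, memory_congr h]

lemma IsRun.setIntegral_cylinder [∀ i, Nonempty (A i)] (hX : L.IsRun s₀ μ X)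
    (hL : L.Positive) (x : ℕ → (∀ i, S i) × (∀ i, A i)) (t : ℕ)
    (φ : (∀ i, S i) × (∀ i, A i) → ℝ) :
    ∫ ω in cylinder X x t, φ (X t ω) ∂μ =
      μ.real (cylinder X x t) * ∑ z, L.stepKernel s₀ x t z * φ z := by
  classical
  have h1 : ∀ ω, φ (X t ω) = ∑ z, {ω | X t ω = z}.indicator (fun _ => φ z) ω := by
    intro ω
    simp [Set.indicator_apply]
  simp_rw [h1]
  rw [integral_finsetSum _ fun z _ => (integrable_const _).indicator (hX.measurable t z),
    Finset.mul_sum]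
  refine Finset.sum_congr rfl fun z _ => ?_
  rw [integral_indicator (hX.measurable t z), setIntegral_const, smul_eq_mul,
    measureReal_restrict_apply (hX.measurable t z)]
  have h2 : {ω | X t ω = z} ∩ cylinder X x t = cylinder X (Function.update x t z) (t + 1) := by
    ext ω
    constructor
    · rintro ⟨h, h'⟩ u hu
      rcases Nat.lt_succ_iff_lt_or_eq.1 hu with hu | rfl
      · rw [Function.update_of_ne hu.ne]; exact h' u hu
      · rw [Function.update_self]; exact h
    · intro h
      refine ⟨by simpa using h t t.lt_succ_self, fun u hu => ?_⟩
      simpa [Function.update_of_ne hu.ne] using h u (by omega)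
  have h3 : ∀ u < t, Function.update x t z u = x u := fun u hu => Function.update_of_ne hu.ne _ _
  rw [h2, hX.measureReal_cylinder_succ hL, stepKernel_congr h3, Function.update_self,
    cylinder_congr h3]
  ring

/-- One step of the process, on an event that depends only on the past. -/
lemma IsRun.setIntegral_step [∀ i, Nonempty (A i)] (hX : L.IsRun s₀ μ X)
    (hL : L.Positive) {t : ℕ} {B : Set Ω}
    (hB : ∀ ω ω', ω ∈ B → (∀ u < t, X u ω = X u ω') → ω' ∈ B)
    {φ ψ : (∀ i, S i) × (∀ i, A i) → ℝ} {v : ℕ} (hBm : MeasurableSet B)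
    (hψ : ∀ ω ∈ B, ∑ z, L.stepKernel s₀ (fun u => X u ω) t z * φ z = ψ (X v ω)) (hv : v < t) :
    ∫ ω in B, φ (X t ω) ∂μ = ∫ ω in B, ψ (X v ω) ∂μ := by
  rw [← integral_indicator hBm, ← integral_indicator hBm, ← setIntegral_univ,
    ← setIntegral_univ (f := B.indicator fun ω => ψ (X v ω))]
  refine setIntegral_eq_of_cylinder (t := t) hX.measurable (fun _ _ _ _ => trivial)
    ((integrable_comp_step hX.measurable φ t).indicator hBm)
    ((integrable_comp_step hX.measurable ψ v).indicator hBm) fun x => ?_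
  rcases (cylinder X x t).eq_empty_or_nonempty with h0 | ⟨ω₀, hω₀⟩
  · simp [h0]
  have hx : cylinder X x t = cylinder X (fun u => X u ω₀) t :=
    cylinder_congr fun u hu => (hω₀ u hu).symm
  rw [hx]
  by_cases hωB : ω₀ ∈ B
  · have hsub : ∀ ω ∈ cylinder X (fun u => X u ω₀) t, ω ∈ B := fun ω hω =>
      hB ω₀ ω hωB fun u hu => (hω u hu).symm
    have hcyl := measurableSet_cylinder hX.measurable (fun u => X u ω₀) t
    rw [setIntegral_congr_fun (f := B.indicator fun ω => φ (X t ω))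
        (g := fun ω => φ (X t ω)) hcyl fun ω hω => Set.indicator_of_mem (hsub ω hω) _,
      setIntegral_congr_fun (f := B.indicator fun ω => ψ (X v ω))
        (g := fun _ => ψ (X v ω₀)) hcyl fun ω hω => by
        rw [Set.indicator_of_mem (hsub ω hω), hω v hv], hX.setIntegral_cylinder hL, hψ ω₀ hωB,
      setIntegral_const, smul_eq_mul]
  · have hsub : ∀ ω ∈ cylinder X (fun u => X u ω₀) t, ω ∉ B := fun ω hω hc =>
      hωB (hB ω ω₀ hc fun u hu => hω u hu)
    have hcyl := measurableSet_cylinder hX.measurable (fun u => X u ω₀) t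
    rw [setIntegral_congr_fun (g := fun ω => 0) hcyl fun ω hω =>
        Set.indicator_of_notMem (hsub ω hω) _,
      setIntegral_congr_fun (g := fun _ => 0) hcyl fun ω hω => Set.indicator_of_notMem (hsub ω hω) _]

end Scheme

end ChainGame

/-! ### The joint law of the players within a batch. -/

open MeasureTheory Filter Topology

namespace ChainGame

variable {n : ℕ} {S A : Fin n → Type*} [∀ i, Fintype (S i)] [∀ i, Fintype (A i)]
variable {G : ChainGame n S A}

namespace Scheme

variable (L : G.Scheme) {s₀ : ∀ i, S i} {Ω : Type*} [MeasurableSpace Ω] {μ : Measure Ω}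
  {X : ℕ → Ω → (∀ i, S i) × (∀ i, A i)}

/-- The chain of player `j` in a batch that starts at time `t` of the path `x`. -/
noncomputable def batchChain (x : ℕ → (∀ i, S i) × (∀ i, A i)) (t : ℕ) (j : Fin n) :
    S j → S j → ℝ :=
  G.inducedChain j (policyOf ((L.memory x t).ρ j))

open Classical in
/-- The law of the state of player `i`, `m` steps after the beginning of a batch at time `t`, on the
event that `s` has not been sampled. -/
noncomputable def unsampledLaw (s₀ : ∀ i, S i) (x : ℕ → (∀ i, S i) × (∀ i, A i)) (t : ℕ)
    (i : Fin n) (s : S i) (m : ℕ) : S i → ℝ :=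
  killedLaw (L.batchChain x t i) s (fun m => t - 1 + L.d ≤ t + m) (stateKernel (G := G) s₀ x t i) m

/-- The laws of the states of the players, `m` steps after the beginning of a batch at time `t`, on
the event that player `i` has not sampled `s`. -/
noncomputable def batchLaw (s₀ : ∀ i, S i) (x : ℕ → (∀ i, S i) × (∀ i, A i)) (t : ℕ)
    (i : Fin n) (s : S i) (m : ℕ) : ∀ j, S j → ℝ :=
  Function.update (fun j => pushLaw (L.batchChain x t j) (stateKernel (G := G) s₀ x t j) m) i
    (L.unsampledLaw s₀ x t i s m)

/-- Outcomes in the cylinder of `x` before time `t` for which, `m` steps later, batch `k` is still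
running and player `i` has not sampled `s`. -/
def aliveSet (X : ℕ → Ω → (∀ i, S i) × (∀ i, A i)) (x : ℕ → (∀ i, S i) × (∀ i, A i)) (k t : ℕ)
    (i : Fin n) (s : S i) (m : ℕ) : Set Ω :=
  {ω | ω ∈ cylinder X x t ∧ (L.memory (fun u => X u ω) (t + m)).batch = k ∧
    s ∈ (L.memory (fun u => X u ω) (t + m)).todo i}

variable {L} {x : ℕ → (∀ i, S i) × (∀ i, A i)} {k t : ℕ} {i : Fin n} {s : S i}

omit [MeasurableSpace Ω] in
lemma isFresh_of_mem_cylinder (hf : L.IsFresh x k t) {ω : Ω} (hω : ω ∈ cylinder X x t) :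
    L.IsFresh (fun u => X u ω) k t :=
  hf.congr fun u hu => (hω u hu).symm

/-- Any set of outcomes that is determined by the path before time `t` is measurable. -/
lemma measurableSet_of_prefix {Z : Type*} [Finite Z] {X : ℕ → Ω → Z}
    (hX : ∀ t z, MeasurableSet {ω | X t ω = z}) {B : Set Ω} (t : ℕ)
    (hB : ∀ ω ω', ω ∈ B → (∀ u < t, X u ω = X u ω') → ω' ∈ B) : MeasurableSet B := by
  have : B = ⋃ p : Fin t → Z, {ω | ω ∈ B ∧ ∀ u : Fin t, X u ω = p u} := by
    ext ω
    simp only [Set.mem_iUnion, Set.mem_ofPred_eq]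
    exact ⟨fun h => ⟨fun u => X u ω, h, fun _ => rfl⟩, fun ⟨_, h, _⟩ => h⟩
  rw [this]
  refine MeasurableSet.iUnion fun p => ?_
  rcases Set.eq_empty_or_nonempty {ω | ω ∈ B ∧ ∀ u : Fin t, X u ω = p u} with h0 | ⟨ω, hω⟩
  · rw [h0]; exact MeasurableSet.empty
  · convert measurableSet_cylinder hX (fun u => X u ω) t using 1
    ext ω'
    constructor
    · rintro ⟨-, h⟩ u hu
      exact (h ⟨u, hu⟩).trans (hω.2 ⟨u, hu⟩).symm
    · intro h
      exact ⟨hB ω ω' hω.1 fun u hu => (h u hu).symm, fun u => (h u u.2).trans (hω.2 u)⟩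

omit [MeasurableSpace Ω] in
lemma aliveSet_prefix {m : ℕ} {ω ω' : Ω} (h : ω ∈ L.aliveSet X x k t i s m)
    (h' : ∀ u < t + m, X u ω = X u ω') : ω' ∈ L.aliveSet X x k t i s m := by
  obtain ⟨h1, h2⟩ := h
  rw [memory_congr h'] at h2
  exact ⟨fun u hu => by rw [← h' u (by omega)]; exact h1 u hu, h2⟩

omit [MeasurableSpace Ω] in
lemma aliveSet_zero (hf : L.IsFresh x k t) : L.aliveSet X x k t i s 0 = cylinder X x t := by
  ext ω
  refine ⟨fun h => h.1, fun h => ⟨h, ?_⟩⟩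
  have h1 := isFresh_of_mem_cylinder hf h
  rw [add_zero]
  exact ⟨h1.1, by rw [h1.memory_fields.2.1]; trivial⟩

omit [MeasurableSpace Ω] in
lemma aliveSet_succ (hf : L.IsFresh x k t) (m : ℕ) :
    L.aliveSet X x k t i s (m + 1) =
      L.aliveSet X x k t i s m ∩ {ω | ¬ (t - 1 + L.d ≤ t + m ∧ (X (t + m) ω).1 i = s)} := by
  ext ω
  constructor
  · rintro ⟨h1, h2⟩
    have h3 := (alive_succ_iff (isFresh_of_mem_cylinder hf h1) (Nat.le_add_right t m)).1 h2
    exact ⟨⟨h1, h3.1⟩, h3.2⟩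
  · rintro ⟨⟨h1, h2⟩, h3⟩
    exact ⟨h1, (alive_succ_iff (isFresh_of_mem_cylinder hf h1) (Nat.le_add_right t m)).2 ⟨h2, h3⟩⟩

open Classical in
-- The killing factor is `1` for every player other than `i`, so one recursion describes the killed
-- chain of player `i` and the free chains of the others.
lemma batchLaw_succ (m : ℕ) (j : Fin n) (y' : S j) :
    L.batchLaw s₀ x t i s (m + 1) j y' = ∑ y, L.batchLaw s₀ x t i s m j y *
      Function.update (β := fun j => S j → ℝ) (fun _ _ => 1) i
        (fun y => if t - 1 + L.d ≤ t + m ∧ y = s then 0 else 1) j y * L.batchChain x t j y y' := by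
  by_cases hj : j = i
  · subst hj
    simp only [batchLaw, Function.update_self, unsampledLaw, killedLaw]
  · simp only [batchLaw, Function.update_of_ne hj, mul_one, pushLaw]

variable [IsProbabilityMeasure μ] [∀ i, Nonempty (A i)]

/-- The joint law within a batch, on the event that player `i` has not sampled `s`. -/
lemma IsRun.setIntegral_aliveSet (hX : L.IsRun s₀ μ X) (hL : L.Positive) (hf : L.IsFresh x k t)
    (i : Fin n) (s : S i) (m : ℕ) (φ : (∀ i, S i) × (∀ i, A i) → ℝ) :
    ∫ ω in L.aliveSet X x k t i s m, φ (X (t + m) ω) ∂μ =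
      μ.real (cylinder X x t) * ∑ z : (∀ i, S i) × (∀ i, A i),
        (∏ j, L.batchLaw s₀ x t i s m j (z.1 j) *
          policyOf ((L.memory x t).ρ j) (z.1 j) (z.2 j)) * φ z := by
  classical
  induction m generalizing φ with
  | zero =>
    rw [aliveSet_zero hf, add_zero, hX.setIntegral_cylinder hL]
    congr 1
    refine Finset.sum_congr rfl fun z _ => ?_
    rw [stepKernel, Finset.prod_mul_distrib]
    congr 3
    ext j
    by_cases hj : j = i
    · subst hj
      simp only [batchLaw, Function.update_self, unsampledLaw, killedLaw]
    · simp only [batchLaw, Function.update_of_ne hj, pushLaw]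
  | succ m ih =>
    -- `ψ` is the conditional expectation of `φ` one step later under the frozen policies, and `χ`
    -- is the indicator of surviving the current step.
    set ψ : (∀ i, S i) × (∀ i, A i) → ℝ := fun w => ∑ z : (∀ i, S i) × (∀ i, A i),
      ((∏ j, G.P j (w.1 j) (w.2 j) (z.1 j)) *
        ∏ j, policyOf ((L.memory x t).ρ j) (z.1 j) (z.2 j)) * φ z with hψ
    set χ : (∀ i, S i) × (∀ i, A i) → ℝ := fun w =>
      if t - 1 + L.d ≤ t + m ∧ w.1 i = s then 0 else 1 with hχ
    have hpre : ∀ ω ω', ω ∈ L.aliveSet X x k t i s (m + 1) →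
        (∀ u < t + (m + 1), X u ω = X u ω') → ω' ∈ L.aliveSet X x k t i s (m + 1) :=
      fun ω ω' h h' => aliveSet_prefix h h'
    have hmeas : ∀ m, MeasurableSet (L.aliveSet X x k t i s m) := fun m =>
      measurableSet_of_prefix hX.measurable (t + m) fun ω ω' h h' => aliveSet_prefix h h'
    have h1 : ∫ ω in L.aliveSet X x k t i s (m + 1), φ (X (t + (m + 1)) ω) ∂μ =
        ∫ ω in L.aliveSet X x k t i s (m + 1), ψ (X (t + m) ω) ∂μ := by
      refine hX.setIntegral_step hL hpre (hmeas _) (fun ω hω => ?_) (by omega)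
      have h2 := isFresh_of_mem_cylinder hf hω.1
      have h3 : (L.memory (fun u => X u ω) (t + (m + 1))).ρ = (L.memory x t).ρ := by
        rw [(h2.memory_eq (Nat.le_add_right t (m + 1)) hω.2.1).2.2, memory_congr hω.1]
      simp only [hψ, stepKernel, h3]
      rfl
    have h2 : ∫ ω in L.aliveSet X x k t i s (m + 1), ψ (X (t + m) ω) ∂μ =
        ∫ ω in L.aliveSet X x k t i s m, χ (X (t + m) ω) * ψ (X (t + m) ω) ∂μ := by
      have hset : MeasurableSet {ω | ¬ (t - 1 + L.d ≤ t + m ∧ (X (t + m) ω).1 i = s)} :=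
        measurableSet_of_prefix hX.measurable (t + m + 1) fun ω ω' h h' => by
          simp only [Set.mem_ofPred_eq] at h ⊢
          rwa [← h' (t + m) (by omega)]
      rw [aliveSet_succ hf, ← setIntegral_indicator hset]
      refine setIntegral_congr_fun (hmeas m) fun ω _ => ?_
      by_cases hc : t - 1 + L.d ≤ t + m ∧ (X (t + m) ω).1 i = s
      · simp only [hχ, if_pos hc, zero_mul]
        refine Set.indicator_of_notMem ?_ _
        simpa using hc
      · simp only [hχ, if_neg hc, one_mul]
        refine Set.indicator_of_mem ?_ _
        simpa using hc
    rw [h1, h2, ih fun w => χ w * ψ w]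
    congr 1
    -- Survival concerns the coordinate of player `i` only, so it is a factor of a product over the
    -- players. The sum over the old states and actions then splits player by player, and the law
    -- remains a product.
    have h3 : ∀ w : (∀ i, S i) × (∀ i, A i), (∏ j, L.batchLaw s₀ x t i s m j (w.1 j) *
        policyOf ((L.memory x t).ρ j) (w.1 j) (w.2 j)) * (χ w * ψ w) =
        ∑ z : (∀ i, S i) × (∀ i, A i), (∏ j, (L.batchLaw s₀ x t i s m j (w.1 j) *
          policyOf ((L.memory x t).ρ j) (w.1 j) (w.2 j) *
          Function.update (β := fun j => S j → ℝ) (fun _ _ => 1) i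
            (fun y => if t - 1 + L.d ≤ t + m ∧ y = s then 0 else 1) j (w.1 j) *
          G.P j (w.1 j) (w.2 j) (z.1 j))) *
          ((∏ j, policyOf ((L.memory x t).ρ j) (z.1 j) (z.2 j)) * φ z) := by
      intro w
      have h4 : χ w = ∏ j, Function.update (β := fun j => S j → ℝ) (fun _ _ => 1) i
            (fun y => if t - 1 + L.d ≤ t + m ∧ y = s then 0 else 1) j (w.1 j) := by
        rw [prod_update_apply]
        simp [hχ]
      simp_rw [h4, hψ, Finset.mul_sum, Finset.prod_mul_distrib]
      refine Finset.sum_congr rfl fun z _ => ?_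
      ring
    simp_rw [h3]
    rw [Finset.sum_comm]
    refine Finset.sum_congr rfl fun z _ => ?_
    rw [← Finset.sum_mul, sum_prod_pi_prod fun j y a => L.batchLaw s₀ x t i s m j y *
          policyOf ((L.memory x t).ρ j) y a *
          Function.update (β := fun j => S j → ℝ) (fun _ _ => 1) i
            (fun y => if t - 1 + L.d ≤ t + m ∧ y = s then 0 else 1) j y *
          G.P j y a (z.1 j), Finset.prod_mul_distrib, mul_assoc]
    congr 2
    ext j
    rw [batchLaw_succ]
    refine Finset.sum_congr rfl fun y _ => ?_
    rw [batchChain, inducedChain, Finset.mul_sum]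
    refine Finset.sum_congr rfl fun a _ => ?_
    ring

section Laws

variable {τ : ℝ}

lemma batchChain_mem_stdSimplex (hL : L.Positive) (x : ℕ → (∀ i, S i) × (∀ i, A i)) (t : ℕ)
    (j : Fin n) (y : S j) : L.batchChain x t j y ∈ stdSimplex ℝ (S j) :=
  inducedChain_mem_stdSimplex G (policyOf_mem_stdSimplex (hL x t j).2) y

lemma batchChain_contracts (hτ : G.MixesWithin τ) (hL : L.Positive)
    (x : ℕ → (∀ i, S i) × (∀ i, A i)) (t : ℕ) (j : Fin n) :
    ContractsSimplex (L.batchChain x t j) (Real.exp (-1 / τ)) :=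
  hτ j _ (policyOf_mem_stdSimplex (hL x t j).2)

/-- The total mass that has not been sampled `m` steps after the beginning of a batch. -/
noncomputable def unsampledMass (L : G.Scheme) (s₀ : ∀ i, S i)
    (x : ℕ → (∀ i, S i) × (∀ i, A i)) (t : ℕ) (i : Fin n) (s : S i) (m : ℕ) : ℝ :=
  ∑ y, L.unsampledLaw s₀ x t i s m y

lemma tendsto_unsampledMass (h0 : 0 < τ) (hτ : G.MixesWithin τ) (hL : L.Positive)
    (x : ℕ → (∀ i, S i) × (∀ i, A i)) (t : ℕ) (i : Fin n) (s : S i) :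
    Tendsto (L.unsampledMass s₀ x t i s) atTop (𝓝 0) := by
  classical
  exact tendsto_sum_killedLaw (batchChain_mem_stdSimplex hL x t i) (Real.exp_pos _).le
    (Real.exp_lt_one_iff.mpr (div_neg_of_neg_of_pos (by norm_num) h0)) (batchChain_contracts hτ hL x t i)
    (stateLaw_mem_stdSimplex (hL x t i).1) (stateLaw_stationary (hL x t i).1 (hL x t i).2)
    (stateLaw_pos (hL x t i).2 s) (stateKernel_mem_stdSimplex G x t i) (m₁ := L.d)
    fun m hm => by omega

lemma unsampledLaw_nonneg (hL : L.Positive) (m : ℕ) (y : S i) :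
    0 ≤ L.unsampledLaw s₀ x t i s m y := by
  classical
  exact killedLaw_nonneg (batchChain_mem_stdSimplex hL x t i) (stateKernel_mem_stdSimplex G x t i).1 m y

lemma sum_range_unsampledLaw (hL : L.Positive) (M : ℕ) :
    ∑ m ∈ Finset.range M, (if t - 1 + L.d ≤ t + m then L.unsampledLaw s₀ x t i s m s else 0) =
      1 - L.unsampledMass s₀ x t i s M := by
  classical
  rw [unsampledMass]
  unfold unsampledLaw
  rw [← sum_range_killedLaw (batchChain_mem_stdSimplex hL x t i) (stateKernel_mem_stdSimplex G x t i)]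

/-- After the waiting time, the state law of every player is close to its stationary law. -/
lemma sum_abs_pushLaw_batchChain_le (h0 : 0 < τ) (hτ : G.MixesWithin τ) (hL : L.Positive) {m : ℕ}
    (hm : t - 1 + L.d ≤ t + m) (j : Fin n) :
    ∑ y, |pushLaw (L.batchChain x t j) (stateKernel (G := G) s₀ x t j) m y -
      stateLaw ((L.memory x t).ρ j) y| ≤ 4 * Real.exp (-1 / τ) ^ L.d := by
  set c := Real.exp (-1 / τ)
  have hc : 0 ≤ c := (Real.exp_pos _).le
  have hc1 : c ≤ 1 := Real.exp_le_one_iff.2 (div_nonpos_of_nonpos_of_nonneg (by norm_num) h0.le)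
  have hst := stateKernel_mem_stdSimplex (s₀ := s₀) G x t j
  have hν := stateLaw_mem_stdSimplex (hL x t j).1
  have h1 := sum_abs_pushLaw_sub_le (batchChain_mem_stdSimplex hL x t j) hc
    (batchChain_contracts hτ hL x t j) hst hν (stateLaw_stationary (hL x t j).1 (hL x t j).2) m
  have h2 := sum_abs_sub_le_two hst hν
  have hpos := pow_nonneg hc L.d
  by_cases hd : L.d ≤ m
  · have h3 := pow_le_pow_of_le_one hc hc1 hd
    have h4 := mul_le_mul h3 h2 (Finset.sum_nonneg fun _ _ => abs_nonneg _) hpos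
    linarith
  · cases t with
    | zero => omega
    | succ t =>
      have hd' : L.d = m + 1 := by omega
      have h3 := sum_abs_P_sub_stateLaw_le hτ (hL x (t + 1) j).1 ((x t).1 j) ((x t).2 j)
      have h4 := mul_le_mul_of_nonneg_left h3 (pow_nonneg hc m)
      rw [hd', pow_succ]
      refine h1.trans (h4.trans (le_of_eq ?_))
      ring

end Laws

/-- In a batch that starts at `t`, every state is sampled almost surely. -/
lemma IsRun.measure_aliveSet (hX : L.IsRun s₀ μ X) (hL : L.Positive) (hf : L.IsFresh x k t)
    (i : Fin n) (s : S i) (m : ℕ) : μ.real (L.aliveSet X x k t i s m) =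
      μ.real (cylinder X x t) * L.unsampledMass s₀ x t i s m := by
  have h := hX.setIntegral_aliveSet hL hf i s m fun _ => 1
  rw [setIntegral_const, smul_eq_mul, mul_one] at h
  simp_rw [mul_one] at h
  rw [h, sum_prod_pi_prod fun j y a => L.batchLaw s₀ x t i s m j y *
          policyOf ((L.memory x t).ρ j) y a]
  simp_rw [← Finset.mul_sum, (policyOf_mem_stdSimplex (hL x t _).2 _).2, mul_one]
  rw [← Finset.mul_prod_erase _ _ (Finset.mem_univ i), Finset.prod_eq_one, mul_one, batchLaw,
    Function.update_self, unsampledMass]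
  intro j hj
  rw [batchLaw, Function.update_of_ne (Finset.ne_of_mem_erase hj)]
  exact (pushLaw_mem_stdSimplex (batchChain_mem_stdSimplex hL x t j)
    (stateKernel_mem_stdSimplex G x t j) m).2

variable {τ : ℝ} [∀ i, Nonempty (S i)]

/-- Until the next batch begins, at least one state of one player is unsampled. A union bound over
the finitely many states and the vanishing of each `unsampledMass` give probability zero. -/
lemma IsRun.ae_exists_isFresh_succ (hX : L.IsRun s₀ μ X) (hL : L.Positive) (h0 : 0 < τ)
    (hτ : G.MixesWithin τ) (hn : 0 < n) (hf : L.IsFresh x k t) :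
    ∀ᵐ ω ∂μ, ω ∈ cylinder X x t → ∃ u, L.IsFresh (fun v => X v ω) (k + 1) u := by
  rw [ae_iff]
  set B := {ω | ¬ (ω ∈ cylinder X x t → ∃ u, L.IsFresh (fun v => X v ω) (k + 1) u)}
  have hsub : ∀ m, B ⊆ ⋃ q : Σ i, S i, L.aliveSet X x k t q.1 q.2 m := by
    intro m ω hω
    obtain ⟨h1, h2⟩ := Classical.not_imp.1 hω
    obtain ⟨i, s, hs⟩ := exists_mem_todo (L := L) hn (fun v => X v ω) (t + m)
    refine Set.mem_iUnion.2 ⟨⟨i, s⟩, h1, ?_, hs⟩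
    have h3 := isFresh_of_mem_cylinder hf h1
    have h4 := batch_mono (L := L) (fun v => X v ω) (Nat.le_add_right t m)
    have h5 := h3.1
    simp only at h4
    by_contra hne
    exact h2 ((exists_isFresh_of_le (k := k + 1) (by omega) (t := t + m) (by omega)).imp
      fun u hu => hu.2)
  have hle : ∀ m, μ.real B ≤ ∑ q : Σ i, S i, μ.real (cylinder X x t) *
      L.unsampledMass s₀ x t q.1 q.2 m := by
    intro m
    refine (measureReal_mono (hsub m)).trans ((measureReal_iUnion_fintype_le _).trans ?_)
    exact Finset.sum_le_sum fun q _ => (hX.measure_aliveSet hL hf q.1 q.2 m).le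
  have hlim : Tendsto (fun m => ∑ q : Σ i, S i, μ.real (cylinder X x t) *
      L.unsampledMass s₀ x t q.1 q.2 m) atTop (𝓝 (∑ _q : Σ i, S i, μ.real (cylinder X x t) * 0)) :=
    tendsto_finsetSum _ fun q _ => (tendsto_unsampledMass h0 hτ hL x t q.1 q.2).const_mul _
  have h6 := ge_of_tendsto' hlim hle
  simp only [mul_zero, Finset.sum_const_zero] at h6
  exact (measureReal_eq_zero_iff).1 (le_antisymm h6 measureReal_nonneg)

/-- Almost surely every batch is reached. -/
lemma IsRun.ae_exists_isFresh (hX : L.IsRun s₀ μ X) (hL : L.Positive) (h0 : 0 < τ)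
    (hτ : G.MixesWithin τ) (hn : 0 < n) :
    ∀ᵐ ω ∂μ, ∀ k, ∃ t, L.IsFresh (fun v => X v ω) (k + 1) t := by
  rw [ae_all_iff]
  intro k
  induction k with
  | zero => exact Eventually.of_forall fun ω => ⟨0, isFresh_one⟩
  | succ k ih =>
    -- The preceding lemma speaks of one cylinder at a time. There are only countably many finite
    -- prefixes, so the exceptional sets may be united.
    have h1 : ∀ᵐ ω ∂μ, ∀ q : Σ t : ℕ, Fin t → (∀ i, S i) × (∀ i, A i), ∀ ω' : Ω,
        (∀ u : Fin q.1, X u ω' = q.2 u) → L.IsFresh (fun v => X v ω') (k + 1) q.1 →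
        (∀ u : Fin q.1, X u ω = q.2 u) → ∃ u, L.IsFresh (fun v => X v ω) (k + 1 + 1) u := by
      rw [ae_all_iff]
      rintro ⟨t, p⟩
      by_cases hex : ∃ ω' : Ω, (∀ u : Fin t, X u ω' = p u) ∧ L.IsFresh (fun v => X v ω') (k + 1) t
      · obtain ⟨ω', h1, h2⟩ := hex
        filter_upwards [hX.ae_exists_isFresh_succ hL h0 hτ hn h2] with ω hω
        intro _ _ _ h3
        exact hω fun u hu => (h3 ⟨u, hu⟩).trans (h1 ⟨u, hu⟩).symm
      · exact Eventually.of_forall fun ω ω' h1 h2 _ => absurd ⟨ω', h1, h2⟩ hex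
    filter_upwards [ih, h1] with ω hω h1
    obtain ⟨t, ht⟩ := hω
    exact h1 ⟨t, fun u => X u ω⟩ ω (fun _ => rfl) ht fun _ => rfl

end Scheme

end ChainGame

/-! ### Conditional moments of the sampled rewards. -/

open MeasureTheory Filter Topology

namespace ChainGame

variable {n : ℕ} {S A : Fin n → Type*} [∀ i, Fintype (S i)] [∀ i, Fintype (A i)]
variable {G : ChainGame n S A}

open Classical in
/-- The partial derivative of the payoff of player `i` with respect to the coordinate `p` of its
occupation measure. -/
noncomputable def gain (G : ChainGame n S A) (i : Fin n) (ρ : ∀ j, OccVec (S j) (A j))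
    (p : S i × A i) : ℝ :=
  G.payoff i (Function.update ρ i (EuclideanSpace.single p 1))

namespace Scheme

variable {L : G.Scheme} {s₀ : ∀ i, S i} {Ω : Type*} [MeasurableSpace Ω] {μ : Measure Ω}
  {X : ℕ → Ω → (∀ i, S i) × (∀ i, A i)}
  {x : ℕ → (∀ i, S i) × (∀ i, A i)} {k t : ℕ} {i : Fin n} {s : S i}

lemma measurable_of_prefix {Z α : Type*} [Finite Z] [MeasurableSpace α] {X : ℕ → Ω → Z}
    (hX : ∀ t z, MeasurableSet {ω | X t ω = z}) (T : ℕ) {f : Ω → α}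
    (hf : ∀ ω ω', (∀ u < T, X u ω = X u ω') → f ω = f ω') : Measurable f := fun B _ =>
  measurableSet_of_prefix hX T fun ω ω' h h' => by
    rw [Set.mem_preimage] at h ⊢
    rwa [← hf ω ω' h']

section Limit

variable [∀ i, Nonempty (A i)]

open Classical in
/-- The expectation of `φ` at the time of sampling `s`, given that this happens `m` steps after the
beginning of the batch. -/
noncomputable def hitMean (L : G.Scheme) (s₀ : ∀ i, S i) (x : ℕ → (∀ i, S i) × (∀ i, A i)) (t : ℕ)
    (i : Fin n) (s : S i) (m : ℕ) (φ : (∀ i, S i) × (∀ i, A i) → ℝ) : ℝ :=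
  ∑ z : (∀ i, S i) × (∀ i, A i), (∏ j, Function.update (fun j =>
      pushLaw (L.batchChain x t j) (stateKernel (G := G) s₀ x t j) m) i (Pi.single s 1) j (z.1 j) *
    policyOf ((L.memory x t).ρ j) (z.1 j) (z.2 j)) * φ z

variable [IsProbabilityMeasure μ]

open Classical in
-- By the product form of the joint law, the sampling event puts player `i` at `s` and leaves the
-- laws of the other players as they were; its probability factors out.
lemma IsRun.setIntegral_hits (hX : L.IsRun s₀ μ X) (hL : L.Positive) (hf : L.IsFresh x k t)
    (i : Fin n) (s : S i) (m : ℕ) (φ : (∀ i, S i) × (∀ i, A i) → ℝ) :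
    ∫ ω in cylinder X x t,
      (if L.Hits (fun u => X u ω) k i s (t + m) then φ (X (t + m) ω) else 0) ∂μ =
      μ.real (cylinder X x t) * ((if t - 1 + L.d ≤ t + m then L.unsampledLaw s₀ x t i s m s else 0) *
        L.hitMean s₀ x t i s m φ) := by
  have hcyl := measurableSet_cylinder hX.measurable x t
  have hmeas : MeasurableSet (L.aliveSet X x k t i s m) :=
    measurableSet_of_prefix hX.measurable (t + m) fun ω ω' h h' => aliveSet_prefix h h'
  have h1 : ∫ ω in cylinder X x t,
      (if L.Hits (fun u => X u ω) k i s (t + m) then φ (X (t + m) ω) else 0) ∂μ =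
      ∫ ω in L.aliveSet X x k t i s m, (fun z : (∀ i, S i) × (∀ i, A i) =>
        if t - 1 + L.d ≤ t + m ∧ z.1 i = s then φ z else 0) (X (t + m) ω) ∂μ := by
    have hsub : L.aliveSet X x k t i s m = cylinder X x t ∩ L.aliveSet X x k t i s m :=
      (Set.inter_eq_right.2 fun ω h => h.1).symm
    rw [hsub, ← setIntegral_indicator hmeas]
    refine setIntegral_congr_fun hcyl fun ω hω => ?_
    have h2 := hits_iff (s := s) (i := i) (isFresh_of_mem_cylinder hf hω) (Nat.le_add_right t m)
    simp only
    by_cases ha : ω ∈ L.aliveSet X x k t i s m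
    · rw [Set.indicator_of_mem ha]
      refine if_congr ?_ rfl rfl
      rw [h2]
      exact ⟨fun h => h.2, fun h => ⟨ha.2, h⟩⟩
    · rw [Set.indicator_of_notMem ha, if_neg]
      rw [h2]
      exact fun h => ha ⟨hω, h.1⟩
  rw [h1, hX.setIntegral_aliveSet hL hf i s m
    (fun z => if t - 1 + L.d ≤ t + m ∧ z.1 i = s then φ z else 0)]
  congr 1
  by_cases hact : t - 1 + L.d ≤ t + m
  · rw [if_pos hact, hitMean, Finset.mul_sum]
    refine Finset.sum_congr rfl fun z _ => ?_
    simp only [hact, true_and]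
    rw [Finset.prod_mul_distrib, Finset.prod_mul_distrib, batchLaw, prod_update_apply,
      prod_update_apply]
    by_cases hz : z.1 i = s
    · rw [if_pos hz, hz, Pi.single_eq_same]
      ring
    · rw [if_neg hz, Pi.single_eq_of_ne hz]
      ring
  · simp [hact]

lemma IsRun.setIntegral_sampledUpTo (hX : L.IsRun s₀ μ X) (hL : L.Positive)
    (hf : L.IsFresh x k t) (i : Fin n) (s : S i) (M : ℕ) (φ : (∀ i, S i) × (∀ i, A i) → ℝ) :
    ∫ ω in cylinder X x t, L.sampledUpTo φ (fun u => X u ω) k i s (t + M) ∂μ =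
      μ.real (cylinder X x t) * ∑ m ∈ Finset.range M,
        ((if t - 1 + L.d ≤ t + m then L.unsampledLaw s₀ x t i s m s else 0) *
          L.hitMean s₀ x t i s m φ) := by
  classical
  have hcyl := measurableSet_cylinder hX.measurable x t
  have h1 : ∫ ω in cylinder X x t, L.sampledUpTo φ (fun u => X u ω) k i s (t + M) ∂μ =
      ∫ ω in cylinder X x t, ∑ m ∈ Finset.range M,
        (if L.Hits (fun u => X u ω) k i s (t + m) then φ (X (t + m) ω) else 0) ∂μ := by
    refine setIntegral_congr_fun hcyl fun ω hω => ?_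
    simp only [sampledUpTo]
    rw [Finset.sum_range_add, Finset.sum_eq_zero, zero_add]
    intro u hu
    exact if_neg fun hc => (isFresh_of_mem_cylinder hf hω).2 u (Finset.mem_range.1 hu) hc.1
  rw [h1, integral_finsetSum, Finset.mul_sum]
  · exact Finset.sum_congr rfl fun m _ => hX.setIntegral_hits hL hf i s m φ
  · intro m _
    obtain ⟨b, hb⟩ := (Set.finite_range fun z => |φ z|).bddAbove
    refine Integrable.integrableOn (Integrable.of_bound (Measurable.aestronglyMeasurable ?_) (max b 0)
      (Eventually.of_forall fun ω => ?_))
    · refine measurable_of_prefix hX.measurable (t + m + 1) fun ω ω' h => ?_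
      have h2 : L.Hits (fun u => X u ω) k i s (t + m) ↔ L.Hits (fun u => X u ω') k i s (t + m) :=
        ⟨Hits.congr fun v hv => h v hv, Hits.congr fun v hv => (h v hv).symm⟩
      rw [h (t + m) (by omega)]
      exact if_congr h2 rfl rfl
    · split_ifs
      · exact (hb ⟨_, rfl⟩).trans (le_max_left _ _)
      · simp

variable {τ : ℝ} [∀ i, Nonempty (S i)]

omit [∀ (i : Fin n), Nonempty (A i)] [IsProbabilityMeasure μ] [∀ (i : Fin n), Nonempty (S i)] in
lemma IsRun.measurable_sampledUpTo (hX : L.IsRun s₀ μ X) (φ : (∀ i, S i) × (∀ i, A i) → ℝ)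
    (k : ℕ) (i : Fin n) (s : S i) (T : ℕ) :
    Measurable fun ω => L.sampledUpTo φ (fun u => X u ω) k i s T :=
  measurable_of_prefix hX.measurable T fun _ _ h => sampledUpTo_congr h

/-- Bounds on the conditional expectation of a sampled quantity, given the past at the beginning of
the batch. -/
lemma IsRun.setIntegral_sampled_mem (hX : L.IsRun s₀ μ X) (hL : L.Positive) (h0 : 0 < τ)
    (hτ : G.MixesWithin τ) (hn : 0 < n) (hf : L.IsFresh x k t) (i : Fin n) (s : S i)
    (φ : (∀ i, S i) × (∀ i, A i) → ℝ) {lo hi : ℝ}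
    (h : ∀ m, t - 1 + L.d ≤ t + m →
      lo ≤ L.hitMean s₀ x t i s m φ ∧ L.hitMean s₀ x t i s m φ ≤ hi) :
    μ.real (cylinder X x t) * lo ≤
        ∫ ω in cylinder X x t, L.sampled φ (fun u => X u ω) k i s ∂μ ∧
      ∫ ω in cylinder X x t, L.sampled φ (fun u => X u ω) k i s ∂μ ≤
        μ.real (cylinder X x t) * hi := by
  have hcyl := measurableSet_cylinder hX.measurable x t
  obtain ⟨b, hb⟩ := (Set.finite_range fun z => |φ z|).bddAbove
  have hbb : ∀ z, |φ z| ≤ max b 0 := fun z => (hb ⟨z, rfl⟩).trans (le_max_left _ _)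
  -- Almost surely the batch ends, after which the truncated sample no longer changes; dominated
  -- convergence applies.
  have hlim : Tendsto (fun M => ∫ ω in cylinder X x t,
      L.sampledUpTo φ (fun u => X u ω) k i s (t + M) ∂μ) atTop
      (𝓝 (∫ ω in cylinder X x t, L.sampled φ (fun u => X u ω) k i s ∂μ)) := by
    refine tendsto_integral_of_dominated_convergence (fun _ => max b 0)
      (fun M => (hX.measurable_sampledUpTo φ k i s _).aestronglyMeasurable)
      (integrable_const _) (fun M => Eventually.of_forall fun ω => ?_) ?_
    · exact abs_sampledUpTo_le (le_max_right _ _) hbb _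
    · rw [ae_restrict_iff' hcyl]
      filter_upwards [hX.ae_exists_isFresh_succ hL h0 hτ hn hf] with ω hω hωC
      obtain ⟨u, hu⟩ := hω hωC
      refine tendsto_const_nhds.congr' ?_
      filter_upwards [eventually_ge_atTop u] with M hM
      exact (sampledUpTo_eq_sampled hu (by omega)).symm
  have hU := tendsto_unsampledMass (s₀ := s₀) h0 hτ hL x t i s
  -- The sampling probabilities sum to one in the limit, so the conditional expectation is a mean of
  -- the values `hitMean` and inherits their bounds.
  have hlim' : ∀ c : ℝ, Tendsto (fun M => μ.real (cylinder X x t) *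
      ((1 - L.unsampledMass s₀ x t i s M) * c)) atTop (𝓝 (μ.real (cylinder X x t) * c)) := by
    intro c
    have := ((hU.const_sub 1).mul_const c).const_mul (μ.real (cylinder X x t))
    simpa using this
  have hq : ∀ m, 0 ≤ if t - 1 + L.d ≤ t + m then L.unsampledLaw s₀ x t i s m s else 0 := fun m => by
    split_ifs
    exacts [unsampledLaw_nonneg hL m s, le_rfl]
  constructor
  · refine le_of_tendsto_of_tendsto' (hlim' lo) hlim fun M => ?_
    rw [hX.setIntegral_sampledUpTo hL hf, ← sum_range_unsampledLaw hL, Finset.sum_mul]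
    refine mul_le_mul_of_nonneg_left (Finset.sum_le_sum fun m _ => ?_) measureReal_nonneg
    by_cases hm : t - 1 + L.d ≤ t + m
    · exact mul_le_mul_of_nonneg_left (h m hm).1 (hq m)
    · simp [hm]
  · refine le_of_tendsto_of_tendsto' hlim (hlim' hi) fun M => ?_
    rw [hX.setIntegral_sampledUpTo hL hf, ← sum_range_unsampledLaw hL, Finset.sum_mul]
    refine mul_le_mul_of_nonneg_left (Finset.sum_le_sum fun m _ => ?_) measureReal_nonneg
    by_cases hm : t - 1 + L.d ≤ t + m
    · exact mul_le_mul_of_nonneg_left (h m hm).2 (hq m)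
    · simp [hm]

end Limit

section Moments

variable [∀ i, Nonempty (A i)] {τ : ℝ}

open Classical in
/-- The policies in use, except that player `i` always plays `a`. -/
noncomputable def deviation (ρ : ∀ j, OccVec (S j) (A j)) (i : Fin n) (a : A i) :
    ∀ j, S j → A j → ℝ :=
  Function.update (fun j => policyOf (ρ j)) i fun _ => Pi.single a 1

omit [(i : Fin n) → Fintype (S i)] in
lemma deviation_mem_stdSimplex {ρ : ∀ j, OccVec (S j) (A j)} (hρ : ∀ j p, 0 < ρ j p) (i : Fin n)
    (a : A i) (j : Fin n) (y : S j) : deviation ρ i a j y ∈ stdSimplex ℝ (A j) := by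
  classical
  by_cases hj : j = i
  · subst hj
    simp only [deviation, Function.update_self]
    exact single_mem_stdSimplex ℝ a
  · simp only [deviation, Function.update_of_ne hj]
    exact policyOf_mem_stdSimplex (hρ j) y

open Classical in
-- Playing the action `p.2` has probability equal to the importance weight's denominator, which
-- cancels one of its `e + 1` powers. The mean is the case `e = 0`, the second moment the case `e =
-- 1`.
lemma hitMean_weightedReward_pow (hL : L.Positive) (x : ℕ → (∀ i, S i) × (∀ i, A i)) (t m : ℕ)
    (p : S i × A i) (e : ℕ) :
    L.hitMean s₀ x t i p.1 m
      (fun z => L.weightedReward i ((L.memory x t).ρ i) p z ^ (e + 1)) =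
    (∑ y : ∀ j, S j, (∏ j, Function.update (fun j => pushLaw (L.batchChain x t j)
      (stateKernel (G := G) s₀ x t j) m) i (Pi.single p.1 1) j (y j)) *
      ∑ a : ∀ j, A j, (∏ j, deviation (L.memory x t).ρ i p.2 j (y j) (a j)) *
        (G.r i y a - L.shift) ^ (e + 1)) / policyOf ((L.memory x t).ρ i) p.1 p.2 ^ e := by
  rw [hitMean, Fintype.sum_prod_type, Finset.sum_div]
  refine Finset.sum_congr rfl fun y _ => ?_
  rw [Finset.mul_sum, Finset.sum_div]
  refine Finset.sum_congr rfl fun a _ => ?_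
  have hpos := policyOf_pos (hL x t i).2 p.1 p.2
  simp only
  rw [Finset.prod_mul_distrib, prod_update_apply,
    ← Finset.mul_prod_erase Finset.univ (fun j => policyOf ((L.memory x t).ρ j) (y j) (a j))
      (Finset.mem_univ i),
    ← Finset.mul_prod_erase Finset.univ (fun j => deviation (L.memory x t).ρ i p.2 j (y j) (a j))
      (Finset.mem_univ i)]
  have h1 : ∏ j ∈ Finset.univ.erase i, deviation (L.memory x t).ρ i p.2 j (y j) (a j) =
      ∏ j ∈ Finset.univ.erase i, policyOf ((L.memory x t).ρ j) (y j) (a j) :=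
    Finset.prod_congr rfl fun j hj => by
      rw [deviation, Function.update_of_ne (Finset.ne_of_mem_erase hj)]
  rw [h1, deviation, Function.update_self, weightedReward]
  by_cases hy : y i = p.1
  · by_cases ha : a i = p.2
    · rw [if_pos ha, hy, ha, Pi.single_eq_same, Pi.single_eq_same]
      generalize policyOf ((L.memory x t).ρ i) p.1 p.2 = π at hpos ⊢
      rw [div_pow, pow_succ π]
      field_simp
    · rw [if_neg ha, Pi.single_eq_of_ne ha]
      simp
  · rw [Pi.single_eq_of_ne hy]
    simp

open Classical in
-- This brings the gradient into the shape of `hitMean`, with stationary laws in place of current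
-- laws, so that the bias becomes a distance of two product laws.
lemma gain_sub_shift_eq {ρ : ∀ j, OccVec (S j) (A j)} (hρ : ∀ j, ρ j ∈ G.polytope j)
    (hpos : ∀ j p, 0 < ρ j p) (p : S i × A i) (c : ℝ) :
    G.gain i ρ p - c =
    ∑ y : ∀ j, S j, (∏ j, Function.update (fun j => stateLaw (ρ j)) i (Pi.single p.1 1) j (y j)) *
      ∑ a : ∀ j, A j, (∏ j, deviation ρ i p.2 j (y j) (a j)) * (G.r i y a - c) := by
  have h1 : ∀ (y : ∀ j, S j) (a : ∀ j, A j),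
      (∏ j, Function.update (fun j => stateLaw (ρ j)) i (Pi.single p.1 1) j (y j)) *
        (∏ j, deviation ρ i p.2 j (y j) (a j)) =
      ∏ j, Function.update ρ i (EuclideanSpace.single p 1) j (y j, a j) := by
    intro y a
    rw [← Finset.prod_mul_distrib]
    refine Finset.prod_congr rfl fun j _ => ?_
    by_cases hj : j = i
    · subst hj
      simp only [deviation, Function.update_self, PiLp.single_apply, Pi.single_apply]
      by_cases hy : y j = p.1 <;> by_cases ha : a j = p.2 <;> simp [hy, ha, Prod.ext_iff]
    · simp only [deviation, Function.update_of_ne hj]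
      exact stateLaw_mul_policyOf (hpos j) _ _
  have h2 : ∑ y : ∀ j, S j, ∑ a : ∀ j, A j,
      ∏ j, Function.update ρ i (EuclideanSpace.single p 1) j (y j, a j) = 1 := by
    rw [← Fintype.sum_prod_type' (f := fun (y : ∀ j, S j) (a : ∀ j, A j) =>
      ∏ j, Function.update ρ i (EuclideanSpace.single p 1) j (y j, a j)),
      sum_prod_pi_prod fun j y a => Function.update ρ i (EuclideanSpace.single p 1) j (y, a)]
    refine Finset.prod_eq_one fun j _ => ?_
    rw [← Fintype.sum_prod_type' (f := fun y a =>
      (Function.update ρ i (EuclideanSpace.single p 1) j (y, a)))]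
    by_cases hj : j = i
    · subst hj
      simp [PiLp.single_apply]
    · simp only [Function.update_of_ne hj]
      exact (hρ j).2.2
  simp_rw [Finset.mul_sum, ← mul_assoc, h1, mul_sub, Finset.sum_sub_distrib, ← Finset.sum_mul, h2,
    one_mul]
  rfl

omit [(i : Fin n) → Fintype (S i)] in
lemma sum_deviation_mul_mem {ρ : ∀ j, OccVec (S j) (A j)} (hρ : ∀ j p, 0 < ρ j p) (a : A i)
    (y : ∀ j, S j) {φ : (∀ j, A j) → ℝ} {lo hi : ℝ} (hφ : ∀ b, lo ≤ φ b ∧ φ b ≤ hi) :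
    lo ≤ ∑ b : ∀ j, A j, (∏ j, deviation ρ i a j (y j) (b j)) * φ b ∧
      ∑ b : ∀ j, A j, (∏ j, deviation ρ i a j (y j) (b j)) * φ b ≤ hi := by
  have hnn : ∀ b : ∀ j, A j, 0 ≤ ∏ j, deviation ρ i a j (y j) (b j) := fun b =>
    Finset.prod_nonneg fun j _ => (deviation_mem_stdSimplex hρ i a j (y j)).1 _
  have hsum : ∑ b : ∀ j, A j, ∏ j, deviation ρ i a j (y j) (b j) = 1 := by
    rw [sum_pi_prod fun j b => deviation ρ i a j (y j) b]
    exact Finset.prod_eq_one fun j _ => (deviation_mem_stdSimplex hρ i a j (y j)).2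
  constructor
  · rw [← one_mul lo, ← hsum, Finset.sum_mul]
    exact Finset.sum_le_sum fun b _ => mul_le_mul_of_nonneg_left (hφ b).1 (hnn b)
  · rw [← one_mul hi, ← hsum, Finset.sum_mul]
    exact Finset.sum_le_sum fun b _ => mul_le_mul_of_nonneg_left (hφ b).2 (hnn b)

/-- The bias of the reward estimates that is due to the finite waiting time. -/
noncomputable def bias (L : G.Scheme) (τ : ℝ) : ℝ := 2 * n * Real.exp (-1 / τ) ^ L.d

lemma abs_hitMean_sub_le (hL : L.Positive) (h0 : 0 < τ) (hτ : G.MixesWithin τ) {m : ℕ}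
    (hm : t - 1 + L.d ≤ t + m) (p : S i × A i) :
    |L.hitMean s₀ x t i p.1 m (L.weightedReward i ((L.memory x t).ρ i) p) -
      (G.gain i (L.memory x t).ρ p - L.shift)| ≤ L.bias τ := by
  classical
  have h1 := hitMean_weightedReward_pow (s₀ := s₀) hL x t m p 0
  simp only [zero_add, pow_one, pow_zero, div_one] at h1
  rw [h1, gain_sub_shift_eq (fun j => (hL x t j).1) (fun j => (hL x t j).2)]
  have hs : ∀ v : ∀ j, S j → ℝ, (∀ j, v j ∈ stdSimplex ℝ (S j)) → ∀ j,
      Function.update v i (Pi.single p.1 1) j ∈ stdSimplex ℝ (S j) := by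
    intro v hv j
    by_cases hj : j = i
    · subst hj
      rw [Function.update_self]
      exact single_mem_stdSimplex ℝ _
    · rw [Function.update_of_ne hj]
      exact hv j
  refine (abs_sum_prod_mul_sub_le _ _
    (hs _ fun j => pushLaw_mem_stdSimplex (batchChain_mem_stdSimplex hL x t j)
      (stateKernel_mem_stdSimplex G x t j) m)
    (hs _ fun j => stateLaw_mem_stdSimplex (hL x t j).1) _ (-L.shift) fun y =>
      sum_deviation_mul_mem (fun j => (hL x t j).2) p.2 y fun b =>
        ⟨by linarith [G.r_nonneg i y b], by linarith [G.r_le_one i y b]⟩).trans ?_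
  -- Player `i` sits at the sampled state under both laws, the others are at distance at most `4 *
  -- exp (-1 / τ) ^ d`. Half of the sum over at most `n` players is `bias`.
  have h2 : ∀ j, ∑ y, |Function.update (fun j => pushLaw (L.batchChain x t j)
      (stateKernel (G := G) s₀ x t j) m) i (Pi.single p.1 1) j y -
      Function.update (fun j => stateLaw ((L.memory x t).ρ j)) i (Pi.single p.1 1) j y| ≤
      4 * Real.exp (-1 / τ) ^ L.d := by
    intro j
    by_cases hj : j = i
    · subst hj
      simp only [Function.update_self, sub_self, abs_zero, Finset.sum_const_zero]
      positivity
    · simp only [Function.update_of_ne hj]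
      exact sum_abs_pushLaw_batchChain_le h0 hτ hL hm j
  have h3 := Finset.sum_le_sum fun j (_ : j ∈ Finset.univ) => h2 j
  rw [Finset.sum_const, Finset.card_univ, Fintype.card_fin, nsmul_eq_mul] at h3
  rw [bias]
  linarith

/-- With `0 ≤ L.shift ≤ 1` the shifted rewards are at most one in absolute value, so just the
uncancelled power of the importance weight remains. -/
lemma hitMean_sq_le (hL : L.Positive) (hs0 : 0 ≤ L.shift) (hs1 : L.shift ≤ 1) (m : ℕ)
    (p : S i × A i) :
    0 ≤ L.hitMean s₀ x t i p.1 m (fun z => L.weightedReward i ((L.memory x t).ρ i) p z ^ 2) ∧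
    L.hitMean s₀ x t i p.1 m (fun z => L.weightedReward i ((L.memory x t).ρ i) p z ^ 2) ≤
      1 / policyOf ((L.memory x t).ρ i) p.1 p.2 := by
  classical
  rw [hitMean_weightedReward_pow hL x t m p 1, pow_one]
  have hpos := policyOf_pos (hL x t i).2 p.1 p.2
  have hv : ∀ j, Function.update (fun j => pushLaw (L.batchChain x t j)
      (stateKernel (G := G) s₀ x t j) m) i (Pi.single p.1 1) j ∈ stdSimplex ℝ (S j) := by
    intro j
    by_cases hj : j = i
    · subst hj
      rw [Function.update_self]
      exact single_mem_stdSimplex ℝ _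
    · rw [Function.update_of_ne hj]
      exact pushLaw_mem_stdSimplex (batchChain_mem_stdSimplex hL x t j)
        (stateKernel_mem_stdSimplex G x t j) m
  have hdev := fun y : ∀ j, S j => sum_deviation_mul_mem (fun j => (hL x t j).2) p.2 y
    (φ := fun b => (G.r i y b - L.shift) ^ (1 + 1)) (lo := 0) (hi := 1) fun b =>
      ⟨sq_nonneg _, (sq_le_one_iff_abs_le_one _).2 (abs_le.2
        ⟨by linarith [G.r_nonneg i y b], by linarith [G.r_le_one i y b]⟩)⟩
  have hnn : ∀ y : ∀ j, S j, 0 ≤ ∏ j, Function.update (fun j => pushLaw (L.batchChain x t j)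
      (stateKernel (G := G) s₀ x t j) m) i (Pi.single p.1 1) j (y j) := fun y =>
    Finset.prod_nonneg fun j _ => (hv j).1 _
  refine ⟨div_nonneg (Finset.sum_nonneg fun y _ => mul_nonneg (hnn y) (hdev y).1) hpos.le, ?_⟩
  refine div_le_div_of_nonneg_right ?_ hpos.le
  refine (Finset.sum_le_sum fun y _ => mul_le_mul_of_nonneg_left (hdev y).2 (hnn y)).trans
    (le_of_eq ?_)
  simp_rw [mul_one]
  rw [sum_pi_prod]
  exact Finset.prod_eq_one fun j _ => (hv j).2

variable [IsProbabilityMeasure μ] [∀ i, Nonempty (S i)]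

omit [MeasurableSpace Ω] [∀ (i : Fin n), Nonempty (A i)] [∀ (i : Fin n), Nonempty (S i)] in
lemma reward_of_mem_cylinder (hf : L.IsFresh x k t) {ω : Ω} (hω : ω ∈ cylinder X x t)
    (p : S i × A i) : L.reward (fun u => X u ω) k i p =
      L.sampled (L.weightedReward i ((L.memory x t).ρ i) p) (fun u => X u ω) k i p.1 := by
  have h1 : L.occ (fun u => X u ω) k = (L.memory x t).ρ := by
    rw [(isFresh_of_mem_cylinder hf hω).occ_eq, memory_congr hω]
  rw [reward, h1]

/-- Given the past at the beginning of a batch, the reward vector is an almost unbiased estimate of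
the gradient of the payoff. -/
lemma IsRun.abs_setIntegral_reward_sub_le (hX : L.IsRun s₀ μ X) (hL : L.Positive) (h0 : 0 < τ)
    (hτ : G.MixesWithin τ) (hn : 0 < n) (hf : L.IsFresh x k t) (p : S i × A i) :
    |∫ ω in cylinder X x t, L.reward (fun u => X u ω) k i p ∂μ -
      μ.real (cylinder X x t) * (G.gain i (L.memory x t).ρ p - L.shift)| ≤
      μ.real (cylinder X x t) * L.bias τ := by
  rw [setIntegral_congr_fun (measurableSet_cylinder hX.measurable x t)
    fun ω hω => reward_of_mem_cylinder hf hω p]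
  have h := hX.setIntegral_sampled_mem hL h0 hτ hn hf i p.1
    (L.weightedReward i ((L.memory x t).ρ i) p)
    (lo := G.gain i (L.memory x t).ρ p - L.shift - L.bias τ)
    (hi := G.gain i (L.memory x t).ρ p - L.shift + L.bias τ) fun m hm => by
      have := abs_le.1 (abs_hitMean_sub_le (s₀ := s₀) (x := x) hL h0 hτ hm p)
      constructor <;> linarith [this.1, this.2]
  rw [abs_le]
  constructor <;> nlinarith [h.1, h.2]

lemma IsRun.setIntegral_reward_sq_le (hX : L.IsRun s₀ μ X) (hL : L.Positive) (h0 : 0 < τ)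
    (hτ : G.MixesWithin τ) (hn : 0 < n) (hf : L.IsFresh x k t) (hs0 : 0 ≤ L.shift)
    (hs1 : L.shift ≤ 1) (p : S i × A i) :
    ∫ ω in cylinder X x t, L.reward (fun u => X u ω) k i p ^ 2 ∂μ ≤
      μ.real (cylinder X x t) * (1 / policyOf ((L.memory x t).ρ i) p.1 p.2) := by
  rw [setIntegral_congr_fun (g := fun ω => L.sampled (fun z =>
    L.weightedReward i ((L.memory x t).ρ i) p z ^ 2) (fun u => X u ω) k i p.1)
    (measurableSet_cylinder hX.measurable x t) fun ω hω => by
      simp only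
      rw [reward_of_mem_cylinder hf hω p, sampled, sampled, sampledUpTo_sq]]
  exact (hX.setIntegral_sampled_mem hL h0 hτ hn hf i p.1 _
    fun m _ => hitMean_sq_le hL hs0 hs1 m p).2

end Moments

end Scheme

end ChainGame

open MeasureTheory Filter Topology

namespace ChainGame

variable {n : ℕ} {S A : Fin n → Type*} [∀ i, Fintype (S i)] [∀ i, Fintype (A i)]
variable {G : ChainGame n S A}

/-! ### Payoffs and regrets in the virtual game -/

section Sets

lemma polytope_subset_occSimplex (G : ChainGame n S A) (i : Fin n) :
    G.polytope i ⊆ occSimplex (S i) (A i) := fun _ h => ⟨h.1, h.2.2⟩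

lemma le_one_of_mem_occSimplex {S A : Type*} [Fintype S] [Fintype A] {x : OccVec S A}
    (h : x ∈ occSimplex S A) (p : S × A) : x p ≤ 1 := by
  rw [← h.2]
  exact Finset.single_le_sum (f := fun p => x p) (fun p _ => h.1 p) (Finset.mem_univ p)

lemma convex_polytope (G : ChainGame n S A) (i : Fin n) : Convex ℝ (G.polytope i) := by
  rintro x ⟨hx1, hx2, hx3⟩ y ⟨hy1, hy2, hy3⟩ a b ha hb hab
  refine ⟨fun p => ?_, fun s' => ?_, ?_⟩
  · simp only [PiLp.add_apply, PiLp.smul_apply, smul_eq_mul]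
    exact add_nonneg (mul_nonneg ha (hx1 p)) (mul_nonneg hb (hy1 p))
  · simp only [PiLp.add_apply, PiLp.smul_apply, smul_eq_mul, mul_add, Finset.sum_add_distrib]
    simp_rw [mul_left_comm _ a, mul_left_comm _ b, ← Finset.mul_sum, hx2, hy2]
  · simp only [PiLp.add_apply, PiLp.smul_apply, smul_eq_mul, Finset.sum_add_distrib]
    rw [← Finset.mul_sum, ← Finset.mul_sum, hx3, hy3, mul_one, mul_one, hab]

lemma isClosed_polytope (G : ChainGame n S A) (i : Fin n) : IsClosed (G.polytope i) := by
  have h : G.polytope i = (⋂ p, {x : OccVec (S i) (A i) | 0 ≤ x p}) ∩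
      ((⋂ s', {x : OccVec (S i) (A i) | ∑ s, ∑ a, G.P i s a s' * x (s, a) = ∑ a, x (s', a)}) ∩
        {x : OccVec (S i) (A i) | ∑ p, x p = 1}) := by
    ext; simp [polytope]
  rw [h]
  refine (isClosed_iInter fun p => isClosed_le continuous_const (by fun_prop)).inter
    ((isClosed_iInter fun s' => isClosed_eq (by fun_prop) (by fun_prop)).inter
      (isClosed_eq (by fun_prop) continuous_const))

lemma norm_le_one_of_mem_occSimplex {S A : Type*} [Fintype S] [Fintype A] {x : OccVec S A}
    (h : x ∈ occSimplex S A) : ‖x‖ ≤ 1 := by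
  rw [EuclideanSpace.norm_eq, Real.sqrt_le_iff]
  refine ⟨zero_le_one, ?_⟩
  rw [one_pow, ← h.2]
  refine Finset.sum_le_sum fun p _ => ?_
  rw [Real.norm_eq_abs, sq_abs]
  nlinarith [h.1 p, le_one_of_mem_occSimplex h p]

lemma isCompact_polytope (G : ChainGame n S A) (i : Fin n) : IsCompact (G.polytope i) :=
  Metric.isCompact_of_isClosed_isBounded (G.isClosed_polytope i)
    ((Metric.isBounded_closedBall (x := 0) (r := 1)).subset fun x hx => by
      rw [mem_closedBall_zero_iff]
      exact norm_le_one_of_mem_occSimplex (G.polytope_subset_occSimplex i hx))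

lemma isCompact_shrunkPolytope (G : ChainGame n S A) (i : Fin n) (δ : ℝ) :
    IsCompact (G.shrunkPolytope i δ) := by
  have h : G.shrunkPolytope i δ = G.polytope i ∩ ⋂ p, {x : OccVec (S i) (A i) | δ ≤ x p} := by
    ext; simp [shrunkPolytope]
  rw [h]
  exact (G.isCompact_polytope i).inter_right (isClosed_iInter fun p =>
    isClosed_le continuous_const (by fun_prop))

lemma convex_shrunkPolytope (G : ChainGame n S A) (i : Fin n) (δ : ℝ) :
    Convex ℝ (G.shrunkPolytope i δ) := by
  rintro x ⟨hx1, hx2⟩ y ⟨hy1, hy2⟩ a b ha hb hab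
  refine ⟨G.convex_polytope i hx1 hy1 ha hb hab, fun p => ?_⟩
  simp only [PiLp.add_apply, PiLp.smul_apply, smul_eq_mul]
  have h1 := mul_le_mul_of_nonneg_left (hx2 p) ha
  have h2 := mul_le_mul_of_nonneg_left (hy2 p) hb
  have h3 : a * δ + b * δ = δ := by rw [← add_mul, hab, one_mul]
  linarith

/-- The `ℓ¹` distance of two probability vectors is at most the minimum of `2` and the number of
coordinates. -/
lemma sum_abs_sub_le_min {S A : Type*} [Fintype S] [Fintype A] {x y : OccVec S A}
    (hx : x ∈ occSimplex S A) (hy : y ∈ occSimplex S A) :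
    ∑ p, |x p - y p| ≤ min 2 ((Fintype.card A : ℝ) * Fintype.card S) := by
  refine le_min (sum_abs_sub_le_two (v := fun p => x p) (ν := fun p => y p) ⟨hx.1, hx.2⟩
    ⟨hy.1, hy.2⟩) ?_
  calc _ ≤ ∑ _p : S × A, (1 : ℝ) := Finset.sum_le_sum fun p _ => by
        rw [abs_le]
        constructor <;> linarith [hx.1 p, hy.1 p, le_one_of_mem_occSimplex hx p,
          le_one_of_mem_occSimplex hy p]
    _ = _ := by simp [Fintype.card_prod, mul_comm]

end Sets

section Payoff

omit [(i : Fin n) → Fintype (S i)] [(i : Fin n) → Fintype (A i)] in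
lemma prod_update_occ (ρ : ∀ j, OccVec (S j) (A j)) (i : Fin n) (x : OccVec (S i) (A i))
    (s : ∀ j, S j) (a : ∀ j, A j) : ∏ j, Function.update ρ i x j (s j, a j) =
      x (s i, a i) * ∏ j ∈ Finset.univ.erase i, ρ j (s j, a j) := by
  rw [← Finset.mul_prod_erase _ _ (Finset.mem_univ i), Function.update_self]
  congr 1
  exact Finset.prod_congr rfl fun j hj => by
    rw [Function.update_of_ne (Finset.ne_of_mem_erase hj)]

/-- The payoff is multilinear, hence linear in the player's own measure with gradient `gain`, which
does not depend on that measure. -/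
lemma payoff_update (G : ChainGame n S A) (i : Fin n) (ρ : ∀ j, OccVec (S j) (A j))
    (x : OccVec (S i) (A i)) : G.payoff i (Function.update ρ i x) = ∑ p, x p * G.gain i ρ p := by
  classical
  simp only [gain, payoff, Finset.mul_sum]
  conv_rhs => rw [Finset.sum_comm]
  refine Finset.sum_congr rfl fun s _ => ?_
  conv_rhs => rw [Finset.sum_comm]
  refine Finset.sum_congr rfl fun a _ => ?_
  simp_rw [prod_update_occ, PiLp.single_apply]
  rw [Finset.sum_eq_single (s i, a i)]
  · rw [if_pos rfl]; ring
  · intro p _ hp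
    rw [if_neg (Ne.symm hp)]; ring
  · exact fun h => absurd (Finset.mem_univ _) h

lemma payoff_eq_sum (G : ChainGame n S A) (i : Fin n) (ρ : ∀ j, OccVec (S j) (A j)) :
    G.payoff i ρ = ∑ p, ρ i p * G.gain i ρ p := by
  rw [← payoff_update, Function.update_eq_self]

lemma payoff_mem (G : ChainGame n S A) (i : Fin n) {ρ : ∀ j, OccVec (S j) (A j)}
    (h : ∀ j, ρ j ∈ occSimplex (S j) (A j)) : 0 ≤ G.payoff i ρ ∧ G.payoff i ρ ≤ 1 := by
  have hnn : ∀ (s : ∀ j, S j) (a : ∀ j, A j), 0 ≤ ∏ j, ρ j (s j, a j) := fun s a =>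
    Finset.prod_nonneg fun j _ => (h j).1 _
  have hsum : ∑ s : ∀ j, S j, ∑ a : ∀ j, A j, ∏ j, ρ j (s j, a j) = 1 := by
    rw [← Fintype.sum_prod_type' (f := fun (y : ∀ j, S j) (a : ∀ j, A j) =>
      ∏ j, ρ j (y j, a j)), sum_prod_pi_prod fun j y a => ρ j (y, a)]
    refine Finset.prod_eq_one fun j _ => ?_
    rw [← Fintype.sum_prod_type' (f := fun y a => ρ j (y, a))]
    exact (h j).2
  refine ⟨Finset.sum_nonneg fun s _ => Finset.sum_nonneg fun a _ =>
    mul_nonneg (hnn s a) (G.r_nonneg i s a), ?_⟩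
  rw [← hsum]
  exact Finset.sum_le_sum fun s _ => Finset.sum_le_sum fun a _ =>
    mul_le_of_le_one_right (hnn s a) (G.r_le_one i s a)

lemma gain_mem (G : ChainGame n S A) (i : Fin n) {ρ : ∀ j, OccVec (S j) (A j)}
    (h : ∀ j, ρ j ∈ occSimplex (S j) (A j)) (p : S i × A i) :
    0 ≤ G.gain i ρ p ∧ G.gain i ρ p ≤ 1 := by
  classical
  refine payoff_mem G i fun j => ?_
  by_cases hj : j = i
  · subst hj
    rw [Function.update_self]
    refine ⟨fun q => ?_, by simp [PiLp.single_apply]⟩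
    rw [PiLp.single_apply]
    split_ifs <;> norm_num
  · rw [Function.update_of_ne hj]
    exact h j

/-- The weighted sum over all players of the profits from the unilateral deviations from `ρ`
to `θ`. -/
noncomputable def gapSum (G : ChainGame n S A) (lam : Fin n → ℝ) (θ ρ : ∀ j, OccVec (S j) (A j)) :
    ℝ :=
  ∑ j, lam j * (G.payoff j (Function.update ρ j (θ j)) - G.payoff j ρ)

lemma gapSum_eq (G : ChainGame n S A) (lam : Fin n → ℝ) (θ ρ : ∀ j, OccVec (S j) (A j)) :
    G.gapSum lam θ ρ = ∑ j, lam j * ∑ p, G.gain j ρ p * (θ j p - ρ j p) := by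
  refine Finset.sum_congr rfl fun j _ => ?_
  rw [payoff_update, payoff_eq_sum, ← Finset.sum_sub_distrib]
  congr 1
  exact Finset.sum_congr rfl fun p _ => by ring

/-- Both halves of social concavity enter: the deviation payoffs are convex in the profile, and the
weighted sum of the actual payoffs, which is subtracted, is concave. -/
lemma SociallyConcave.convexOn_gapSum {lam : Fin n → ℝ} (h : G.SociallyConcave lam)
    {θ : ∀ j, OccVec (S j) (A j)} (hθ : ∀ j, θ j ∈ G.polytope j) :
    ConvexOn ℝ (Set.univ.pi G.polytope) (G.gapSum lam θ) := by
  have h1 : ConvexOn ℝ (Set.univ.pi G.polytope)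
      (∑ j, fun ρ => lam j * G.payoff j (Function.update ρ j (θ j))) := by
    refine Finset.sum_induction _ (fun f => ConvexOn ℝ (Set.univ.pi G.polytope) f)
      (fun _ _ hf hg => hf.add hg) (convexOn_const 0 h.2.1.1) fun j _ => ?_
    exact (h.2.2 j (θ j) (hθ j)).smul (h.1 j).le
  have h2 := h1.sub h.2.1
  have h3 : G.gapSum lam θ = (∑ j, fun ρ => lam j * G.payoff j (Function.update ρ j (θ j))) -
      fun ρ => ∑ i, lam i * G.payoff i ρ := by
    ext ρ
    simp only [gapSum, Pi.sub_apply, Finset.sum_apply, mul_sub, Finset.sum_sub_distrib]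
  rwa [h3]

/-- A comparator that moves one player isolates the incentive of that player, so bounds on `gapSum`
become equilibrium conditions. -/
lemma gapSum_update_self (G : ChainGame n S A) (lam : Fin n → ℝ) (ρ : ∀ j, OccVec (S j) (A j))
    (i : Fin n) (x : OccVec (S i) (A i)) : G.gapSum lam (Function.update ρ i x) ρ =
      lam i * (G.payoff i (Function.update ρ i x) - G.payoff i ρ) := by
  rw [gapSum, Finset.sum_eq_single i]
  · rw [Function.update_self]
  · intro j _ hj
    rw [Function.update_of_ne hj, Function.update_eq_self, sub_self, mul_zero]
  · exact fun h => absurd (Finset.mem_univ _) h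

lemma isEpsNash_of_gapSum_le {lam : Fin n → ℝ} (hlam : ∀ i, 0 < lam i) {ε : ℝ}
    {ρ : ∀ j, OccVec (S j) (A j)} (hρ : ∀ j, ρ j ∈ G.polytope j)
    (h : ∀ i, ∀ x ∈ G.polytope i, G.gapSum lam (Function.update ρ i x) ρ ≤ lam i * ε) :
    G.IsEpsNash ε ρ := by
  refine ⟨hρ, fun i x hx => ?_⟩
  have h1 := h i x hx
  rw [gapSum_update_self] at h1
  linarith [le_of_mul_le_mul_left h1 (hlam i)]

lemma continuous_gapSum (G : ChainGame n S A) (lam : Fin n → ℝ) (θ : ∀ j, OccVec (S j) (A j)) :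
    Continuous (G.gapSum lam θ) := by
  have h1 : ∀ i, Continuous (G.payoff i) := fun i => by
    unfold payoff
    fun_prop
  refine continuous_finsetSum _ fun j _ => continuous_const.mul (Continuous.sub ?_ (h1 j))
  exact (h1 j).comp (continuous_id.update j continuous_const)

end Payoff

end ChainGame

/-! ### Dual averaging -/

section DualAveraging

variable {E : Type*} [NormedAddCommGroup E] [InnerProductSpace ℝ E] {s : Set E} {K : ℝ}
  {h : E → ℝ}

/-- Quadratic growth around the maximizer: compare it with a point at fraction `t` of the way to
`y`, divide by `t`, and let `t → 0`. -/
lemma StrongConvexOn.le_of_isMaxOn (hh : StrongConvexOn s K h) {Y x y : E} (hx : x ∈ s)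
    (hmax : IsMaxOn (fun x => inner ℝ x Y - h x) s x) (hy : y ∈ s) :
    inner ℝ y Y - h y + K / 2 * ‖x - y‖ ^ 2 ≤ inner ℝ x Y - h x := by
  have key : ∀ t : ℝ, 0 < t → t < 1 →
      inner ℝ y Y - h y + (1 - t) * (K / 2 * ‖x - y‖ ^ 2) ≤ inner ℝ x Y - h x := by
    intro t ht ht1
    have h1 := hh.2 hx hy (sub_pos.2 ht1).le ht.le (by ring : (1 - t) + t = 1)
    have h2 := hmax (hh.1 hx hy (sub_pos.2 ht1).le ht.le (by ring : (1 - t) + t = 1))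
    simp only [Set.mem_ofPred_eq, inner_add_left, inner_smul_left, RCLike.conj_to_real,
      smul_eq_mul] at h1 h2
    have h3 : t * (inner ℝ y Y - h y + (1 - t) * (K / 2 * ‖x - y‖ ^ 2)) ≤
        t * (inner ℝ x Y - h x) := by nlinarith
    exact le_of_mul_le_mul_left h3 ht
  have hlim : Filter.Tendsto (fun t : ℝ => inner ℝ y Y - h y + (1 - t) * (K / 2 * ‖x - y‖ ^ 2))
      (nhdsWithin 0 (Set.Ioi 0)) (nhds (inner ℝ y Y - h y + (1 - 0) * (K / 2 * ‖x - y‖ ^ 2))) :=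
    Filter.Tendsto.mono_left (Continuous.tendsto (by fun_prop) 0) nhdsWithin_le_nhds
  rw [sub_zero, one_mul] at hlim
  refine le_of_tendsto hlim ?_
  filter_upwards [Ioo_mem_nhdsGT (one_pos (α := ℝ))] with t ht using key t ht.1 ht.2

/-- The regret bound of dual averaging. -/
lemma StrongConvexOn.sum_inner_le (hK : 0 < K) (hh : StrongConvexOn s K h) {z g : ℕ → E}
    (hz : ∀ l, z l ∈ s) (k : ℕ) (hmax : ∀ l ≤ k, IsMaxOn
      (fun x => inner ℝ x (∑ j ∈ Finset.range l, g j) - h x) s (z l)) {θ : E} (hθ : θ ∈ s) :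
    ∑ l ∈ Finset.range k, inner ℝ (g l) (θ - z l) ≤
      h θ - h (z 0) + ∑ l ∈ Finset.range k, ‖g l‖ ^ 2 / (2 * K) := by
  -- The optimal value of the regularized problem grows in each round by at most the reward of the
  -- current iterate plus a square: the quadratic growth at `z l` pays for the move to `z (l + 1)`
  -- through Young's inequality.
  have key : ∀ l ≤ k, inner ℝ (z l) (∑ j ∈ Finset.range l, g j) - h (z l) ≤
      - h (z 0) + ∑ j ∈ Finset.range l, (inner ℝ (g j) (z j) + ‖g j‖ ^ 2 / (2 * K)) := by
    intro l hl
    induction l with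
    | zero => simp
    | succ l ih =>
      have h1 := hh.le_of_isMaxOn (hz l) (hmax l (by omega)) (hz (l + 1))
      have h2 := ih (by omega)
      rw [Finset.sum_range_succ, Finset.sum_range_succ, inner_add_right]
      have h3 : inner ℝ (z (l + 1)) (g l) ≤
          inner ℝ (g l) (z l) + ‖g l‖ ^ 2 / (2 * K) + K / 2 * ‖z l - z (l + 1)‖ ^ 2 := by
        have h4 : inner ℝ (z (l + 1)) (g l) =
            inner ℝ (g l) (z l) - inner ℝ (g l) (z l - z (l + 1)) := by
          rw [inner_sub_right, real_inner_comm]; ring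
        have h5 := neg_le_of_abs_le (abs_real_inner_le_norm (g l) (z l - z (l + 1)))
        have h6 : ‖g l‖ * ‖z l - z (l + 1)‖ ≤
            ‖g l‖ ^ 2 / (2 * K) + K / 2 * ‖z l - z (l + 1)‖ ^ 2 := by
          have h7 : ‖g l‖ ^ 2 / (2 * K) + K / 2 * ‖z l - z (l + 1)‖ ^ 2 -
              ‖g l‖ * ‖z l - z (l + 1)‖ = (‖g l‖ - K * ‖z l - z (l + 1)‖) ^ 2 / (2 * K) := by
            field_simp
            ring
          have h8 : 0 ≤ (‖g l‖ - K * ‖z l - z (l + 1)‖) ^ 2 / (2 * K) := by positivity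
          linarith
        linarith
      linarith
  have h1 := key k le_rfl
  have h2 := hmax k le_rfl hθ
  simp only [Set.mem_ofPred_eq] at h2
  simp_rw [inner_sub_right, Finset.sum_sub_distrib]
  rw [Finset.sum_add_distrib] at h1
  have h3 : ∑ l ∈ Finset.range k, inner ℝ (g l) θ = inner ℝ θ (∑ j ∈ Finset.range k, g j) := by
    rw [inner_sum]
    exact Finset.sum_congr rfl fun l _ => real_inner_comm _ _
  rw [h3]
  linarith

end DualAveraging

/-! ### Mirror descent with the Kullback-Leibler divergence -/

lemma argmaxOn_spec {E : Type*} [Nonempty E] {s : Set E} {f : E → ℝ}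
    (h : ∃ x ∈ s, IsMaxOn f s x) : argmaxOn s f ∈ s ∧ IsMaxOn f s (argmaxOn s f) :=
  Classical.epsilon_spec (p := fun x => x ∈ s ∧ IsMaxOn f s x) h

section KL

variable {S A : Type*} [Fintype S] [Fintype A] {x y h ρ : OccVec S A}

lemma sub_le_mul_log_div {a b : ℝ} (ha : 0 ≤ a) (hb : 0 < b) : a - b ≤ a * Real.log (a / b) := by
  rcases ha.eq_or_lt with rfl | ha
  · simp [hb.le]
  · have h1 := Real.log_le_sub_one_of_pos (div_pos hb ha)
    have h2 : Real.log (a / b) = - Real.log (b / a) := by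
      rw [← Real.log_inv, inv_div]
    rw [h2]
    have h3 : a * (b / a) = b := by field_simp
    nlinarith

lemma eq_of_mul_log_div_le {a b : ℝ} (ha : 0 ≤ a) (hb : 0 < b)
    (h : a * Real.log (a / b) ≤ a - b) : a = b := by
  rcases ha.eq_or_lt with rfl | ha
  · simp at h; linarith
  · by_contra hne
    have h1 := Real.log_lt_sub_one_of_pos (div_pos hb ha) (fun hc => hne (by
      rw [div_eq_one_iff_eq ha.ne'] at hc; exact hc.symm))
    have h2 : Real.log (a / b) = - Real.log (b / a) := by
      rw [← Real.log_inv, inv_div]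
    rw [h2] at h
    have h3 : a * (b / a) = b := by field_simp
    nlinarith

lemma klDivergence_nonneg (hx : x ∈ occSimplex S A) (hy : y ∈ occSimplex S A)
    (hpos : ∀ p, 0 < y p) : 0 ≤ klDivergence x y := by
  have h1 : ∑ p, (x p - y p) ≤ klDivergence x y :=
    Finset.sum_le_sum fun p _ => sub_le_mul_log_div (hx.1 p) (hpos p)
  rw [Finset.sum_sub_distrib, hx.2, hy.2, sub_self] at h1
  exact h1

lemma eq_of_klDivergence_le_zero (hx : x ∈ occSimplex S A) (hy : y ∈ occSimplex S A)
    (hpos : ∀ p, 0 < y p) (h : klDivergence x y ≤ 0) : x = y := by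
  have h1 : ∑ p, (x p * Real.log (x p / y p) - (x p - y p)) = klDivergence x y := by
    rw [Finset.sum_sub_distrib, Finset.sum_sub_distrib, hx.2, hy.2, sub_self, sub_zero]
    rfl
  have hnn : ∀ p ∈ Finset.univ, 0 ≤ x p * Real.log (x p / y p) - (x p - y p) := fun p _ =>
    sub_nonneg.2 (sub_le_mul_log_div (hx.1 p) (hpos p))
  have h2 := (Finset.sum_eq_zero_iff_of_nonneg hnn).1
    (le_antisymm (h1.trans_le h) (Finset.sum_nonneg hnn))
  ext p
  exact eq_of_mul_log_div_le (hx.1 p) (hpos p) (by linarith [h2 p (Finset.mem_univ p)])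

lemma klDivergence_self (hpos : ∀ p, 0 < x p) : klDivergence x x = 0 :=
  Finset.sum_eq_zero fun p _ => by rw [div_self (hpos p).ne', Real.log_one, mul_zero]

/-- The normalizing factor of the exponential reweighting of `ρ` with weights `y`. -/
noncomputable def expMass (ρ y : OccVec S A) : ℝ := ∑ p, ρ p * Real.exp (y p)

/-- The exponential reweighting of `ρ` with weights `y`. -/
noncomputable def expWeights (ρ y : OccVec S A) : OccVec S A :=
  WithLp.toLp 2 fun p => ρ p * Real.exp (y p) / expMass ρ y

lemma expMass_pos [Nonempty S] [Nonempty A] (hρ : ∀ p, 0 < ρ p) : 0 < expMass ρ y :=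
  Finset.sum_pos (fun p _ => mul_pos (hρ p) (Real.exp_pos _)) Finset.univ_nonempty

lemma expWeights_pos [Nonempty S] [Nonempty A] (hρ : ∀ p, 0 < ρ p) (p : S × A) :
    0 < expWeights ρ y p :=
  div_pos (mul_pos (hρ p) (Real.exp_pos _)) (expMass_pos hρ)

lemma expWeights_mem [Nonempty S] [Nonempty A] (hρ : ∀ p, 0 < ρ p) :
    expWeights ρ y ∈ occSimplex S A := by
  refine ⟨fun p => (expWeights_pos hρ p).le, ?_⟩
  simp only [expWeights]
  rw [← Finset.sum_div]
  exact div_self (expMass_pos hρ).ne'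

/-- Up to sign and a constant, the entropic objective is a divergence from `expWeights`; this gives
the explicit maximizer and, after projection, the regret inequality. -/
lemma klDivergence_expWeights [Nonempty S] [Nonempty A] (hρ : ∀ p, 0 < ρ p)
    (hx : x ∈ occSimplex S A) :
    klDivergence x (expWeights ρ y) =
      klDivergence x ρ - ∑ p, y p * x p + Real.log (expMass ρ y) := by
  have h1 : Real.log (expMass ρ y) = ∑ p, x p * Real.log (expMass ρ y) := by
    rw [← Finset.sum_mul, hx.2, one_mul]
  rw [h1, klDivergence, klDivergence, ← Finset.sum_sub_distrib, ← Finset.sum_add_distrib]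
  refine Finset.sum_congr rfl fun p _ => ?_
  rcases (hx.1 p).eq_or_lt with h0 | h0
  · simp [← h0]
  · have hZ := expMass_pos (y := y) hρ
    have h2 : x p / expWeights ρ y p = x p / ρ p * (Real.exp (y p))⁻¹ * expMass ρ y := by
      simp only [expWeights]
      have := (hρ p).ne'
      field_simp
    rw [h2, Real.log_mul (by have := hρ p; positivity) hZ.ne',
      Real.log_mul (div_pos h0 (hρ p)).ne' (by positivity), Real.log_inv, Real.log_exp]
    ring

lemma inner_eq_sum (x y : OccVec S A) : inner ℝ x y = ∑ p, x p * y p := by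
  rw [PiLp.inner_apply]
  exact Finset.sum_congr rfl fun p _ => by simp [mul_comm]

/-- Gibbs variational principle. Since `argmaxOn` chooses an unspecified maximizer, uniqueness is
needed; it comes from the equality case of the nonnegativity of the divergence. -/
lemma argmaxOn_occSimplex_eq [Nonempty S] [Nonempty A] (hρ : ∀ p, 0 < ρ p) :
    argmaxOn (occSimplex S A) (fun x => inner ℝ y x - klDivergence x ρ) = expWeights ρ y := by
  have h1 : ∀ x ∈ occSimplex S A, inner ℝ y x - klDivergence x ρ =
      Real.log (expMass ρ y) - klDivergence x (expWeights ρ y) := by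
    intro x hx
    rw [klDivergence_expWeights hρ hx, inner_eq_sum]
    ring
  have hw := expWeights_mem (y := y) hρ
  have hpos := expWeights_pos (y := y) hρ
  have hmax : IsMaxOn (fun x => inner ℝ y x - klDivergence x ρ) (occSimplex S A)
      (expWeights ρ y) := by
    intro x hx
    simp only [Set.mem_ofPred_eq]
    rw [h1 x hx, h1 _ hw, klDivergence_self hpos]
    linarith [klDivergence_nonneg hx hw hpos]
  obtain ⟨h2, h3⟩ := argmaxOn_spec ⟨_, hw, hmax⟩
  refine eq_of_klDivergence_le_zero h2 hw hpos ?_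
  have h4 := h3 hw
  simp only [Set.mem_ofPred_eq] at h4
  rw [h1 _ h2, h1 _ hw, klDivergence_self hpos] at h4
  linarith

/-- Rescaling each coordinate reduces this to the function `u * log u`, which is continuous also at
zero. -/
lemma continuous_klDivergence (hh : ∀ p, 0 < h p) :
    Continuous fun x : OccVec S A => klDivergence x h := by
  refine continuous_finsetSum _ fun p _ => ?_
  have h1 : ∀ x : OccVec S A, x p * Real.log (x p / h p) =
      h p * (x p / h p * Real.log (x p / h p)) := fun x => by
    have := (hh p).ne'
    field_simp
  simp_rw [h1]
  exact continuous_const.mul (Real.continuous_mul_log.comp (by fun_prop))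

/-- The gradient inequality for `u ↦ u log (u / c)` at a positive point, up to a linear term. -/
lemma mul_log_div_sub_le {a b c : ℝ} (ha : 0 ≤ a) (hb : 0 < b) (hc : 0 < c) :
    b * Real.log (b / c) + Real.log (b / c) * (a - b) + (a - b) ≤ a * Real.log (a / c) := by
  have h1 := sub_le_mul_log_div ha hb
  rcases ha.eq_or_lt with rfl | ha
  · simp; linarith
  · have h2 : Real.log (a / c) = Real.log (a / b) + Real.log (b / c) := by
      rw [← Real.log_mul (by positivity) (by positivity)]
      congr 1
      field_simp
    rw [h2]
    nlinarith

variable {s : Set (OccVec S A)} {x' θ : OccVec S A}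

/-- First-order optimality along the segment from a Kullback-Leibler projection to a point. -/
lemma sum_log_mul_sub_nonpos (hs : Convex ℝ s) (hsub : s ⊆ occSimplex S A) (hh : ∀ p, 0 < h p)
    (hx' : x' ∈ s) (hmin : ∀ z ∈ s, klDivergence x' h ≤ klDivergence z h) (hθ : θ ∈ s) {t : ℝ}
    (ht : 0 < t) (ht1 : t ≤ 1) (hpos : ∀ p, 0 < (1 - t) * x' p + t * θ p) :
    ∑ p, Real.log (((1 - t) * x' p + t * θ p) / h p) * (x' p - θ p) ≤ 0 := by
  have h1 := hmin _ (hs hx' hθ (sub_nonneg.2 ht1) ht.le (by ring))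
  -- The gradient is taken at the intermediate point, which is positive, and not at `x'`, whose
  -- coordinates might still vanish.
  have h2 : klDivergence ((1 - t) • x' + t • θ) h +
      t * ∑ p, Real.log (((1 - t) * x' p + t * θ p) / h p) * (x' p - θ p) +
      t * ∑ p, (x' p - θ p) ≤ klDivergence x' h := by
    rw [Finset.mul_sum, Finset.mul_sum, klDivergence, klDivergence, ← Finset.sum_add_distrib,
      ← Finset.sum_add_distrib]
    refine Finset.sum_le_sum fun p _ => ?_
    have h3 := mul_log_div_sub_le ((hsub hx').1 p) (hpos p) (hh p)
    simp only [PiLp.add_apply, PiLp.smul_apply, smul_eq_mul]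
    refine le_trans (le_of_eq ?_) h3
    ring
  rw [Finset.sum_sub_distrib, (hsub hx').2, (hsub hθ).2, sub_self, mul_zero, add_zero] at h2
  exact nonpos_of_mul_nonpos_right (by linarith) ht

/-- A Kullback-Leibler projection onto a set with a positive point is positive. -/
lemma pos_of_isMin_klDivergence (hs : Convex ℝ s) (hsub : s ⊆ occSimplex S A) (hh : ∀ p, 0 < h p)
    (hx' : x' ∈ s) (hmin : ∀ z ∈ s, klDivergence x' h ≤ klDivergence z h) (hρ : ρ ∈ s)
    (hpos : ∀ p, 0 < ρ p) (p : S × A) : 0 < x' p := by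
  classical
  by_contra hp
  have hp0 : x' p = 0 := le_antisymm (not_lt.1 hp) ((hsub hx').1 p)
  set C := ∑ q ∈ Finset.univ.erase p, (x' q - ρ q) * Real.log (ρ q / h q) with hC
  have key : ∀ t : ℝ, 0 < t → t ≤ 1 → C ≤ ρ p * Real.log (t * ρ p / h p) := by
    intro t ht ht1
    have hpt : ∀ q, 0 < (1 - t) * x' q + t * ρ q := fun q =>
      add_pos_of_nonneg_of_pos (mul_nonneg (sub_nonneg.2 ht1) ((hsub hx').1 q))
        (mul_pos ht (hpos q))
    have h1 := sum_log_mul_sub_nonpos hs hsub hh hx' hmin hρ ht ht1 hpt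
    rw [← Finset.add_sum_erase _ _ (Finset.mem_univ p), hp0, mul_zero, zero_add] at h1
    -- The mixture lies between `x' q` and `ρ q`, so by monotonicity of the logarithm each term is
    -- at least its value with the mixture replaced by `ρ q`, whichever of the two is larger. This
    -- bound does not depend on `t`.
    have h2 : C ≤ ∑ q ∈ Finset.univ.erase p,
        Real.log (((1 - t) * x' q + t * ρ q) / h q) * (x' q - ρ q) := by
      refine Finset.sum_le_sum fun q _ => ?_
      rw [mul_comm]
      rcases le_total (ρ q) (x' q) with hle | hle
      · refine mul_le_mul_of_nonneg_right (Real.log_le_log (div_pos (hpos q) (hh q)) ?_)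
          (sub_nonneg.2 hle)
        exact div_le_div_of_nonneg_right (by nlinarith) (hh q).le
      · refine mul_le_mul_of_nonpos_right (Real.log_le_log (div_pos (hpt q) (hh q)) ?_)
          (sub_nonpos.2 hle)
        exact div_le_div_of_nonneg_right (by nlinarith) (hh q).le
    linarith
  set m := ρ p * Real.log (ρ p / h p) with hm
  -- With `t = exp (-u)` the vanishing coordinate forces the fixed number `C` below a decreasing
  -- affine function of `u`, which is absurd for large `u`.
  have h3 : ∀ u : ℝ, 0 ≤ u → C ≤ m - ρ p * u := by
    intro u hu
    have h4 := key (Real.exp (-u)) (Real.exp_pos _) (Real.exp_le_one_iff.2 (by linarith))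
    rw [mul_div_assoc, Real.log_mul (Real.exp_pos _).ne' (div_pos (hpos p) (hh p)).ne',
      Real.log_exp] at h4
    rw [hm]
    linarith
  have h5 := h3 ((|m| + |C| + 1) / ρ p) (div_nonneg (by positivity) (hpos p).le)
  rw [mul_div_cancel₀ _ (hpos p).ne'] at h5
  linarith [le_abs_self m, neg_abs_le C]

/-- The generalized Pythagorean inequality for Kullback-Leibler projections. -/
lemma klDivergence_add_le_of_isMin (hs : Convex ℝ s) (hsub : s ⊆ occSimplex S A)
    (hh : ∀ p, 0 < h p) (hx' : x' ∈ s) (hmin : ∀ z ∈ s, klDivergence x' h ≤ klDivergence z h)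
    (hpos : ∀ p, 0 < x' p) (hθ : θ ∈ s) :
    klDivergence θ x' + klDivergence x' h ≤ klDivergence θ h := by
  -- As `x'` is now known to be positive, the optimality condition along the segment passes to the
  -- limit `t → 0`.
  have h1 : ∑ p, Real.log (x' p / h p) * (x' p - θ p) ≤ 0 := by
    have hlim : Filter.Tendsto
        (fun t : ℝ => ∑ p, Real.log (((1 - t) * x' p + t * θ p) / h p) * (x' p - θ p))
        (nhdsWithin 0 (Set.Ioi 0))
        (nhds (∑ p, Real.log (((1 - 0) * x' p + 0 * θ p) / h p) * (x' p - θ p))) := by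
      refine Filter.Tendsto.mono_left (tendsto_finsetSum _ fun p _ => ?_) nhdsWithin_le_nhds
      refine Filter.Tendsto.mul_const _ (ContinuousAt.tendsto
        (f := fun t : ℝ => Real.log (((1 - t) * x' p + t * θ p) / h p)) ?_)
      refine ContinuousAt.log (by fun_prop) ?_
      have := hpos p
      have := hh p
      simp only [sub_zero, one_mul, zero_mul, add_zero]
      positivity
    simp only [sub_zero, one_mul, zero_mul, add_zero] at hlim
    refine le_of_tendsto hlim ?_
    filter_upwards [Ioo_mem_nhdsGT (one_pos (α := ℝ))] with t ht
    refine sum_log_mul_sub_nonpos hs hsub hh hx' hmin hθ ht.1 ht.2.le fun p => ?_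
    exact add_pos_of_pos_of_nonneg (mul_pos (sub_pos.2 ht.2) (hpos p))
      (mul_nonneg ht.1.le ((hsub hθ).1 p))
  have h2 : klDivergence θ x' + klDivergence x' h - klDivergence θ h =
      ∑ p, Real.log (x' p / h p) * (x' p - θ p) := by
    rw [klDivergence, klDivergence, klDivergence, ← Finset.sum_add_distrib,
      ← Finset.sum_sub_distrib]
    refine Finset.sum_congr rfl fun p _ => ?_
    rcases ((hsub hθ).1 p).eq_or_lt with h0 | h0
    · simp only [← h0]; ring
    · rw [Real.log_div h0.ne' (hpos p).ne', Real.log_div (hpos p).ne' (hh p).ne',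
        Real.log_div h0.ne' (hh p).ne']
      ring
  linarith

/-- Reciprocal of the quadratic lower bound for `exp (-y)`: the two quadratics multiply to `1 + y ^
4 / 4`. No lower bound on `y` is required, and this is why the rewards are shifted to be
nonpositive: importance weights may be arbitrarily large. -/
lemma exp_le_one_add_add_sq {y : ℝ} (hy : y ≤ 0) : Real.exp y ≤ 1 + y + y ^ 2 / 2 := by
  have h := Real.quadratic_le_exp_of_nonneg (neg_nonneg.2 hy)
  rw [Real.exp_neg] at h
  have h1 : 0 < 1 + -y + (-y) ^ 2 / 2 := by nlinarith
  have h2 : Real.exp y ≤ (1 + -y + (-y) ^ 2 / 2)⁻¹ := by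
    rw [le_inv_comm₀ (Real.exp_pos y) h1]
    exact h
  refine h2.trans ?_
  rw [inv_le_iff_one_le_mul₀ h1]
  nlinarith [sq_nonneg (y ^ 2)]

/-- One step of mirror descent: the update is well defined, and it satisfies the usual regret
inequality. -/
lemma mirrorStep_spec [Nonempty S] [Nonempty A] (hs : Convex ℝ s) (hcomp : IsCompact s)
    (hsub : s ⊆ occSimplex S A) (hρ : ρ ∈ s) (hpos : ∀ p, 0 < ρ p) (y : OccVec S A) :
    argmaxOn s (fun x => - klDivergence x (argmaxOn (occSimplex S A)
      (fun x => inner ℝ y x - klDivergence x ρ))) ∈ s ∧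
    (∀ p, 0 < argmaxOn s (fun x => - klDivergence x (argmaxOn (occSimplex S A)
      (fun x => inner ℝ y x - klDivergence x ρ))) p) ∧
    ((∀ p, y p ≤ 0) → ∀ θ ∈ s, ∑ p, y p * (θ p - ρ p) ≤ klDivergence θ ρ -
      klDivergence θ (argmaxOn s (fun x => - klDivergence x (argmaxOn (occSimplex S A)
        (fun x => inner ℝ y x - klDivergence x ρ)))) + (∑ p, ρ p * y p ^ 2) / 2) := by
  rw [argmaxOn_occSimplex_eq hpos]
  have hh := expWeights_pos (y := y) hpos
  obtain ⟨z, hz, hzmax⟩ := hcomp.exists_isMaxOn ⟨ρ, hρ⟩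
    (f := fun x => - klDivergence x (expWeights ρ y)) (continuous_klDivergence hh).neg.continuousOn
  obtain ⟨h1, h2⟩ := argmaxOn_spec ⟨z, hz, hzmax⟩
  set x' := argmaxOn s fun x => - klDivergence x (expWeights ρ y)
  have hmin : ∀ z ∈ s, klDivergence x' (expWeights ρ y) ≤ klDivergence z (expWeights ρ y) :=
    fun z hz => neg_le_neg_iff.1 (h2 hz)
  have hx'pos := pos_of_isMin_klDivergence hs hsub hh h1 hmin hρ hpos
  refine ⟨h1, hx'pos, fun hy θ hθ => ?_⟩
  have h3 := klDivergence_add_le_of_isMin hs hsub hh h1 hmin hx'pos hθ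
  have h4 := klDivergence_nonneg (hsub h1) (expWeights_mem (y := y) hpos) hh
  rw [klDivergence_expWeights (x := θ) hpos (hsub hθ)] at h3
  -- The log-normalizer exceeds its linear part by at most half the second moment of `y` under `ρ`
  -- itself; this local norm is the whole cost of a step.
  have h5 : Real.log (expMass ρ y) ≤ ∑ p, y p * ρ p + (∑ p, ρ p * y p ^ 2) / 2 := by
    refine (Real.log_le_sub_one_of_pos (expMass_pos hpos)).trans ?_
    have h6 : expMass ρ y ≤ ∑ p, (ρ p + y p * ρ p + ρ p * y p ^ 2 / 2) :=
      Finset.sum_le_sum fun p _ => by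
        have := mul_le_mul_of_nonneg_left (exp_le_one_add_add_sq (hy p)) (hpos p).le
        linarith
    rw [Finset.sum_add_distrib, Finset.sum_add_distrib, (hsub hρ).2, ← Finset.sum_div] at h6
    linarith
  simp_rw [mul_sub, Finset.sum_sub_distrib]
  linarith

end KL

open MeasureTheory Filter Topology

namespace ChainGame

variable {n : ℕ} {S A : Fin n → Type*} [∀ i, Fintype (S i)] [∀ i, Fintype (A i)]
variable {G : ChainGame n S A}

namespace Scheme

variable (L : G.Scheme)

/-! ### Quantities that are known at the beginning of a batch -/

/-- `f` depends only on the path before the beginning of batch `k`, if there is such a batch. -/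
def Determined {α : Type*} (k : ℕ) (f : (ℕ → (∀ i, S i) × (∀ i, A i)) → α) : Prop :=
  ∀ x x' t, L.IsFresh x k t → (∀ u < t, x u = x' u) → f x = f x'

section Determined

variable {L} {x x' : ℕ → (∀ i, S i) × (∀ i, A i)} {k t : ℕ}

lemma determined_occ (k : ℕ) : L.Determined k fun x => L.occ x k := fun x x' t hf h => by
  simp only
  rw [hf.occ_eq, (hf.congr h).occ_eq, memory_congr h]

lemma determined_freshTime (k : ℕ) : L.Determined k fun x => L.freshTime x k :=
  fun x x' t hf h => by
    simp only
    rw [hf.freshTime_eq, (hf.congr h).freshTime_eq]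

lemma Determined.succ {α : Type*} {f : (ℕ → (∀ i, S i) × (∀ i, A i)) → α}
    (hf : L.Determined (k + 1) f) : L.Determined (k + 2) f := fun x x' t ht h => by
  obtain ⟨u, hu, hfu⟩ := exists_isFresh_of_le (k := k + 1) (by omega) (by rw [ht.1]; omega)
  exact hf x x' u hfu fun v hv => h v (hv.trans_le hu)

lemma determined_reward (k : ℕ) : L.Determined (k + 2) fun x => L.reward x (k + 1) :=
  fun x x' t hf h => by
    have h1 := (determined_occ (L := L) (k + 1)).succ x x' t hf h
    simp only at h1 ⊢
    ext i p
    simp only [reward, sampled]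
    rw [h1, hf.freshTime_eq, (hf.congr h).freshTime_eq, sampledUpTo_congr h]

lemma reward_of_not_reached (h : ∀ t, (L.memory x t).batch ≠ k + 1) : L.reward x k = 0 := by
  ext i p
  simp [reward, sampled, sampledUpTo, freshTime_of_not_reached h]

/-- Each coordinate is zero or the importance-weighted reward of one of finitely many state-action
profiles under one of finitely many occupation measures. -/
lemma reward_mem_finite {o : Set (∀ i, OccVec (S i) (A i))} (ho : o.Finite) (k : ℕ) :
    {R | ∃ x, L.occ x k ∈ o ∧ R = L.reward x k}.Finite := by
  set T : ∀ i : Fin n, S i × A i → Set ℝ := fun i p =>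
    insert 0 (Set.image2 (fun (ρ : ∀ i, OccVec (S i) (A i)) z => L.weightedReward i (ρ i) p z) o
      Set.univ) with hT
  have hTfin : ∀ i p, (T i p).Finite := fun i p =>
    (ho.image2 _ Set.finite_univ).insert _
  have h1 : (Set.univ.pi fun i => Set.univ.pi (T i)).Finite :=
    Set.Finite.pi fun i => Set.Finite.pi (hTfin i)
  refine (h1.image fun g i => (WithLp.toLp 2 (g i) : OccVec (S i) (A i))).subset ?_
  rintro R ⟨x, hx, rfl⟩
  refine ⟨fun i p => L.reward x k i p, ?_, rfl⟩
  intro i _ p _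
  rcases sampledUpTo_eq (L := L) (L.weightedReward i (L.occ x k i) p) x k i p.1
    (L.freshTime x (k + 1)) with ⟨u, -, -, h⟩ | ⟨-, h⟩
  · exact Or.inr ⟨L.occ x k, hx, x u, trivial, h.symm⟩
  · exact Or.inl h

/-- Up to a given batch, only finitely many occupation measures can occur. -/
lemma finite_range_occ_score (L : G.Scheme) (k : ℕ) :
    (Set.range fun x => L.occ x (k + 1)).Finite ∧ (Set.range fun x => L.score x k).Finite := by
  induction k with
  | zero =>
    constructor
    · refine (Set.finite_singleton L.init).subset ?_
      rintro _ ⟨x, rfl⟩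
      exact occ_one
    · refine (Set.finite_singleton 0).subset ?_
      rintro _ ⟨x, rfl⟩
      ext i p
      simp [score]
  | succ k ih =>
    have hR := reward_mem_finite (L := L) ih.1 (k + 1)
    have hscore : (Set.range fun x => L.score x (k + 1)).Finite := by
      refine (Set.Finite.image2 (fun (Y R : ∀ i, OccVec (S i) (A i)) => Y + L.η (k + 1) • R)
        ih.2 hR).subset ?_
      rintro _ ⟨x, rfl⟩
      refine ⟨_, ⟨x, rfl⟩, L.reward x (k + 1), ⟨x, ⟨x, rfl⟩, rfl⟩, ?_⟩
      ext1 i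
      exact (Finset.sum_range_succ (fun l => L.η (l + 1) • L.reward x (l + 1) i) k).symm
    refine ⟨?_, hscore⟩
    refine (((hscore.prod (hR.prod ih.1)).image fun q : (∀ i, OccVec (S i) (A i)) ×
      (∀ i, OccVec (S i) (A i)) × (∀ i, OccVec (S i) (A i)) => fun i =>
        L.next i (q.1 i) (L.η (k + 1) • q.2.1 i) (q.2.2 i)).insert L.init).subset ?_
    rintro _ ⟨x, rfl⟩
    by_cases h : ∃ t, (L.memory x t).batch = k + 2
    · obtain ⟨t, ht⟩ := h
      obtain ⟨u, -, hu⟩ := exists_isFresh ht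
      refine Or.inr ⟨(L.score x (k + 1), L.reward x (k + 1), L.occ x (k + 1)),
        ⟨⟨x, rfl⟩, ⟨x, ⟨x, rfl⟩, rfl⟩, ⟨x, rfl⟩⟩, ?_⟩
      ext1 i
      exact (occ_succ hu i).symm
    · exact Or.inl (occ_of_not_reached fun t ht => h ⟨t, ht⟩)

/-- The bound may grow with the batch; it only serves to make all quantities of a given batch
integrable. -/
lemma exists_abs_reward_le (L : G.Scheme) (k : ℕ) :
    ∃ M : ℝ, ∀ x i p, |L.reward x (k + 1) i p| ≤ M := by
  have h := reward_mem_finite (L := L) (L.finite_range_occ_score k).1 (k + 1)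
  obtain ⟨M, hM⟩ := (h.image fun R => ∑ i, ∑ p, |R i p|).bddAbove
  refine ⟨M, fun x i p => ?_⟩
  refine le_trans ?_ (hM ⟨L.reward x (k + 1), ⟨x, ⟨x, rfl⟩, rfl⟩, rfl⟩)
  refine le_trans ?_ (Finset.single_le_sum (f := fun i => ∑ p, |L.reward x (k + 1) i p|)
    (fun i _ => Finset.sum_nonneg fun p _ => abs_nonneg _) (Finset.mem_univ i))
  exact Finset.single_le_sum (f := fun p => |L.reward x (k + 1) i p|)
    (fun p _ => abs_nonneg _) (Finset.mem_univ p)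

end Determined

section Filtration

variable {L} {s₀ : ∀ i, S i} {Ω : Type*} [mΩ : MeasurableSpace Ω] {μ : Measure Ω}
  {X : ℕ → Ω → (∀ i, S i) × (∀ i, A i)} {k t : ℕ}

/-- The events that are known at the beginning of batch `l + 1`. -/
def batchFiltration (L : G.Scheme) (X : ℕ → Ω → (∀ i, S i) × (∀ i, A i)) : Filtration ℕ mΩ where
  seq l :=
    { MeasurableSet' := fun B => MeasurableSet B ∧ ∀ ω ω' t, ω ∈ B →
        L.IsFresh (fun u => X u ω) (l + 1) t → (∀ u < t, X u ω = X u ω') → ω' ∈ B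
      measurableSet_empty := ⟨MeasurableSet.empty, fun _ _ _ h => absurd h (Set.notMem_empty _)⟩
      measurableSet_compl := fun B hB => ⟨hB.1.compl, fun ω ω' t hω hf h hω' =>
        hω (hB.2 ω' ω t hω' (hf.congr h) fun u hu => (h u hu).symm)⟩
      measurableSet_iUnion := fun B hB => ⟨MeasurableSet.iUnion fun m => (hB m).1,
        fun ω ω' t hω hf h => by
          obtain ⟨m, hm⟩ := Set.mem_iUnion.1 hω
          exact Set.mem_iUnion.2 ⟨m, (hB m).2 ω ω' t hm hf h⟩⟩ }
  mono' := monotone_nat_of_le_succ fun l B hB => ⟨hB.1, fun ω ω' t hω hf h => by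
    obtain ⟨u, hu, hfu⟩ := exists_isFresh_of_le (k := l + 1) (by omega) (by rw [hf.1]; omega)
    exact hB.2 ω ω' u hω hfu fun v hv => h v (hv.trans_le hu)⟩
  le' := fun _ _ hB => hB.1

lemma measurableSet_isFresh (hX : ∀ t z, MeasurableSet {ω | X t ω = z}) (k t : ℕ) :
    MeasurableSet {ω | L.IsFresh (fun u => X u ω) k t} :=
  measurableSet_of_prefix hX t fun _ _ h h' => IsFresh.congr h h'

/-- `Determined` is silent about paths that never reach the batch. Prescribing one common value `c`
there makes the function measurable everywhere, not just almost everywhere. -/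
lemma measurable_of_determined {α : Type*} [MeasurableSpace α]
    (hX : ∀ t z, MeasurableSet {ω | X t ω = z})
    {f : (ℕ → (∀ i, S i) × (∀ i, A i)) → α} (hf : L.Determined (k + 1) f) {c : α}
    (hc : ∀ x, (∀ t, (L.memory x t).batch ≠ k + 1) → f x = c) :
    Measurable[L.batchFiltration X k] fun ω => f fun u => X u ω := by
  intro B _
  refine ⟨?_, fun ω ω' t hω hfr h => ?_⟩
  · classical
    have h1 : (fun ω => f fun u => X u ω) ⁻¹' B =
        (⋃ t, {ω | L.IsFresh (fun u => X u ω) (k + 1) t ∧ f (fun u => X u ω) ∈ B}) ∪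
          (⋃ t, {ω | L.IsFresh (fun u => X u ω) (k + 1) t})ᶜ ∩ (if c ∈ B then Set.univ else ∅) := by
      ext ω
      simp only [Set.mem_preimage, Set.mem_union, Set.mem_iUnion, Set.mem_ofPred_eq,
        Set.mem_inter_iff, Set.mem_compl_iff]
      by_cases hr : ∃ t, L.IsFresh (fun u => X u ω) (k + 1) t
      · obtain ⟨t, ht⟩ := hr
        constructor
        · exact fun h => Or.inl ⟨t, ht, h⟩
        · rintro (⟨_, -, h⟩ | ⟨h, -⟩)
          exacts [h, absurd ⟨t, ht⟩ h]
      · have h2 := hc (fun u => X u ω) fun t ht => hr ((exists_isFresh ht).imp fun u hu => hu.2)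
        rw [h2]
        constructor
        · exact fun h => Or.inr ⟨hr, by rw [if_pos h]; trivial⟩
        · rintro (⟨t, ht, -⟩ | ⟨-, h⟩)
          · exact absurd ⟨t, ht⟩ hr
          · by_contra hcB
            rw [if_neg hcB] at h
            exact h
    rw [h1]
    refine (MeasurableSet.iUnion fun t => measurableSet_of_prefix hX t fun ω ω' h h' => ?_).union
      ((MeasurableSet.iUnion fun t => measurableSet_isFresh hX _ t).compl.inter ?_)
    · simp only [Set.mem_ofPred_eq] at h ⊢
      exact ⟨h.1.congr h', by rw [← hf _ _ t h.1 h']; exact h.2⟩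
    · split_ifs
      exacts [MeasurableSet.univ, MeasurableSet.empty]
  · rw [Set.mem_preimage] at hω ⊢
    rwa [← hf _ _ t hfr h]

/-- The level set of `g` through `ω` is an event of the filtration, hence it contains every outcome
with the same past. -/
lemma eq_of_measurable_batchFiltration {g : Ω → ℝ} (hg : Measurable[L.batchFiltration X k] g)
    {ω ω' : Ω} (hf : L.IsFresh (fun u => X u ω) (k + 1) t) (h : ∀ u < t, X u ω = X u ω') :
    g ω' = g ω :=
  (hg (measurableSet_singleton (g ω))).2 ω ω' t rfl hf h

/-- An inequality between integrals over an event that is known at the beginning of a batch follows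
from the inequalities over the cylinders at whose end the batch begins. -/
lemma setIntegral_le_of_isFresh (hX : ∀ t z, MeasurableSet {ω | X t ω = z})
    (hae : ∀ᵐ ω ∂μ, ∃ t, L.IsFresh (fun v => X v ω) (k + 1) t) {B : Set Ω}
    (hB : MeasurableSet[L.batchFiltration X k] B) {f g : Ω → ℝ} (hf : Integrable f μ)
    (hg : Integrable g μ) (h : ∀ x t, L.IsFresh x (k + 1) t →
      ∫ ω in cylinder X x t, f ω ∂μ ≤ ∫ ω in cylinder X x t, g ω ∂μ) :
    ∫ ω in B, f ω ∂μ ≤ ∫ ω in B, g ω ∂μ :=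
  setIntegral_le_of_cylinder hX (fun x t => L.IsFresh x (k + 1) t) (fun _ _ _ h h' => h.congr h')
    (fun _ _ _ h h' => h.unique h') (fun ω ω' t hω hfr hag => hB.2 ω ω' t hω hfr hag)
    (hae.mono fun _ h _ => h) hf hg fun x t hfr _ => h x t hfr

lemma integral_le_of_isFresh (hX : ∀ t z, MeasurableSet {ω | X t ω = z})
    (hae : ∀ᵐ ω ∂μ, ∃ t, L.IsFresh (fun v => X v ω) (k + 1) t) {f g : Ω → ℝ}
    (hf : Integrable f μ) (hg : Integrable g μ) (h : ∀ x t, L.IsFresh x (k + 1) t →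
      ∫ ω in cylinder X x t, f ω ∂μ ≤ ∫ ω in cylinder X x t, g ω ∂μ) :
    ∫ ω, f ω ∂μ ≤ ∫ ω, g ω ∂μ := by
  have := setIntegral_le_of_isFresh hX hae (B := Set.univ) MeasurableSet.univ hf hg h
  rwa [setIntegral_univ, setIntegral_univ] at this

end Filtration

/-! ### A maximal inequality for sums over batches. -/

section Maximal

variable {L} {s₀ : ∀ i, S i} {Ω : Type*} [mΩ : MeasurableSpace Ω] {μ : Measure Ω}
  [IsProbabilityMeasure μ] {X : ℕ → Ω → (∀ i, S i) × (∀ i, A i)} {ι : Type*} [Fintype ι]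
  {D : ι → ℕ → Ω → ℝ} {F : ℕ → Ω → ℝ}

/-- The sum of the squares of the partial sums of `D i` plus the partial sums of `F`. -/
noncomputable def energy (D : ι → ℕ → Ω → ℝ) (F : ℕ → Ω → ℝ) (k : ℕ) (ω : Ω) : ℝ :=
  ∑ i, (∑ l ∈ Finset.range k, D i l ω) ^ 2 + ∑ l ∈ Finset.range k, F l ω

omit mΩ in
lemma energy_succ (k : ℕ) (ω : Ω) : energy D F (k + 1) ω = energy D F k ω +
    (∑ i, 2 * (∑ l ∈ Finset.range k, D i l ω) * D i k ω) + (∑ i, D i k ω ^ 2 + F k ω) := by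
  simp only [energy, Finset.sum_range_succ, add_sq, Finset.sum_add_distrib]
  ring

lemma measurable_energy {k : ℕ} (hD : ∀ i l, Measurable[L.batchFiltration X (l + 1)] (D i l))
    (hF : ∀ l, Measurable[L.batchFiltration X (l + 1)] (F l)) :
    Measurable[L.batchFiltration X k] (energy D F k) := by
  have h1 : ∀ i, ∀ l ∈ Finset.range k, Measurable[L.batchFiltration X k] (D i l) :=
    fun i l hl => (hD i l).mono ((L.batchFiltration X).mono (Finset.mem_range.1 hl)) le_rfl
  have h2 : ∀ l ∈ Finset.range k, Measurable[L.batchFiltration X k] (F l) :=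
    fun l hl => (hF l).mono ((L.batchFiltration X).mono (Finset.mem_range.1 hl)) le_rfl
  exact (Finset.measurable_fun_sum _ fun i _ =>
    (Finset.measurable_fun_sum _ (h1 i)).pow_const 2).add (Finset.measurable_fun_sum _ h2)

lemma integrable_of_measurable_of_bound {l : ℕ} {f : Ω → ℝ}
    (hf : Measurable[L.batchFiltration X l] f) (hb : ∃ M, ∀ ω, |f ω| ≤ M) : Integrable f μ := by
  obtain ⟨M, hM⟩ := hb
  exact Integrable.of_bound (hf.mono ((L.batchFiltration X).le l) le_rfl).aestronglyMeasurable M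
    (Eventually.of_forall hM)

omit mΩ in
lemma exists_abs_energy_le (hDb : ∀ i l, ∃ M, ∀ ω, |D i l ω| ≤ M)
    (hFb : ∀ l, ∃ M, ∀ ω, |F l ω| ≤ M) (k : ℕ) : ∃ M, ∀ ω, |energy D F k ω| ≤ M := by
  choose MD hMD using hDb
  choose MF hMF using hFb
  refine ⟨∑ i, (∑ l ∈ Finset.range k, MD i l) ^ 2 + ∑ l ∈ Finset.range k, MF l, fun ω => ?_⟩
  refine (abs_add_le _ _).trans (add_le_add ?_ ?_)
  · refine (Finset.abs_sum_le_sum_abs _ _).trans (Finset.sum_le_sum fun i _ => ?_)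
    rw [abs_pow]
    refine pow_le_pow_left₀ (abs_nonneg _) ?_ 2
    exact (Finset.abs_sum_le_sum_abs _ _).trans (Finset.sum_le_sum fun l _ => hMD i l ω)
  · exact (Finset.abs_sum_le_sum_abs _ _).trans (Finset.sum_le_sum fun l _ => hMF l ω)

/-- Orthogonality of martingale differences: on a cylinder that ends where the batch begins, the
earlier partial sums are constants and the new difference integrates to zero, so the cross term
vanishes. -/
lemma setIntegral_energy_succ (hX : ∀ t z, MeasurableSet {ω | X t ω = z})
    (hD : ∀ i l, Measurable[L.batchFiltration X (l + 1)] (D i l))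
    (hF : ∀ l, Measurable[L.batchFiltration X (l + 1)] (F l))
    (hDb : ∀ i l, ∃ M, ∀ ω, |D i l ω| ≤ M) (hFb : ∀ l, ∃ M, ∀ ω, |F l ω| ≤ M)
    (hD0 : ∀ i l x t, L.IsFresh x (l + 1) t → ∫ ω in cylinder X x t, D i l ω ∂μ = 0)
    {k t : ℕ} {x : ℕ → (∀ i, S i) × (∀ i, A i)} (hfr : L.IsFresh x (k + 1) t) :
    ∫ ω in cylinder X x t, energy D F (k + 1) ω ∂μ = ∫ ω in cylinder X x t, energy D F k ω ∂μ +
      ∫ ω in cylinder X x t, (∑ i, D i k ω ^ 2 + F k ω) ∂μ := by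
  have hDi : ∀ i l, Integrable (D i l) μ := fun i l =>
    integrable_of_measurable_of_bound (hD i l) (hDb i l)
  have hcyl := measurableSet_cylinder hX x t
  rcases (cylinder X x t).eq_empty_or_nonempty with h0 | ⟨ω₀, hω₀⟩
  · simp [h0]
  have hcross : ∫ ω in cylinder X x t,
      (∑ i, 2 * (∑ l ∈ Finset.range k, D i l ω) * D i k ω) ∂μ = 0 := by
    have h1 : ∫ ω in cylinder X x t,
        (∑ i, 2 * (∑ l ∈ Finset.range k, D i l ω) * D i k ω) ∂μ =
        ∫ ω in cylinder X x t,
        (∑ i, 2 * (∑ l ∈ Finset.range k, D i l ω₀) * D i k ω) ∂μ := by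
      refine setIntegral_congr_fun hcyl fun ω hω => Finset.sum_congr rfl fun i _ => ?_
      congr 2
      refine Finset.sum_congr rfl fun l hl => ?_
      refine eq_of_measurable_batchFiltration ((hD i l).mono
        ((L.batchFiltration X).mono (Finset.mem_range.1 hl)) le_rfl)
        (isFresh_of_mem_cylinder hfr hω₀) fun u hu => (hω₀ u hu).trans (hω u hu).symm
    rw [h1, integral_finsetSum _ fun i _ => ((hDi i k).const_mul _).integrableOn]
    refine Finset.sum_eq_zero fun i _ => ?_
    rw [integral_const_mul, hD0 i k x t hfr, mul_zero]
  have hmD : ∀ i l, Measurable (D i l) := fun i l =>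
    (hD i l).mono ((L.batchFiltration X).le _) le_rfl
  have hmF : ∀ l, Measurable (F l) := fun l => (hF l).mono ((L.batchFiltration X).le _) le_rfl
  have hint1 : Integrable (energy D F k) μ :=
    integrable_of_measurable_of_bound (measurable_energy hD hF) (exists_abs_energy_le hDb hFb k)
  have hint2 : Integrable (fun ω => ∑ i, 2 * (∑ l ∈ Finset.range k, D i l ω) * D i k ω) μ := by
    choose MD hMD using hDb
    refine Integrable.of_bound (Measurable.aestronglyMeasurable ?_)
      (∑ i, 2 * (∑ l ∈ Finset.range k, MD i l) * MD i k) (Eventually.of_forall fun ω => ?_)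
    · exact Finset.measurable_fun_sum _ fun i _ => (measurable_const.mul
        (Finset.measurable_fun_sum _ fun l _ => hmD i l)).mul (hmD i k)
    · refine (norm_sum_le _ _).trans (Finset.sum_le_sum fun i _ => ?_)
      rw [norm_mul, norm_mul, Real.norm_ofNat]
      refine mul_le_mul (mul_le_mul_of_nonneg_left ?_ two_pos.le) (hMD i k ω) (norm_nonneg _)
        (mul_nonneg two_pos.le (Finset.sum_nonneg fun l _ => (abs_nonneg _).trans (hMD i l ω)))
      exact (norm_sum_le _ _).trans (Finset.sum_le_sum fun l _ => hMD i l ω)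
  have hint3 : Integrable (fun ω => ∑ i, D i k ω ^ 2 + F k ω) μ := by
    have h2 : (fun ω => ∑ i, D i k ω ^ 2 + F k ω) =
        energy (fun i _ => D i k) (fun _ => F k) 1 := by
      ext ω; simp [energy]
    rw [h2]
    obtain ⟨M, hM⟩ := exists_abs_energy_le (D := fun i (_ : ℕ) => D i k) (F := fun _ => F k)
      (fun i _ => hDb i k) (fun _ => hFb k) 1
    refine Integrable.of_bound (Measurable.aestronglyMeasurable ?_) M (Eventually.of_forall hM)
    rw [← h2]
    exact (Finset.measurable_fun_sum _ fun i _ => (hmD i k).pow_const 2).add (hmF k)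
  simp_rw [energy_succ]
  rw [integral_add (f := fun ω => energy D F k ω +
      ∑ i, 2 * (∑ l ∈ Finset.range k, D i l ω) * D i k ω)
    (g := fun ω => ∑ i, D i k ω ^ 2 + F k ω)
    (hint1.add hint2).integrableOn hint3.integrableOn,
    integral_add hint1.integrableOn hint2.integrableOn, hcross, add_zero]

/-- A maximal inequality for the energy of martingale differences. -/
lemma measure_exists_le_energy (hX : ∀ t z, MeasurableSet {ω | X t ω = z})
    (hae : ∀ᵐ ω ∂μ, ∀ k, ∃ t, L.IsFresh (fun v => X v ω) (k + 1) t)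
    (hD : ∀ i l, Measurable[L.batchFiltration X (l + 1)] (D i l))
    (hF : ∀ l, Measurable[L.batchFiltration X (l + 1)] (F l))
    (hDb : ∀ i l, ∃ M, ∀ ω, |D i l ω| ≤ M) (hFb : ∀ l, ∃ M, ∀ ω, |F l ω| ≤ M)
    (hF0 : ∀ l ω, 0 ≤ F l ω)
    (hD0 : ∀ i l x t, L.IsFresh x (l + 1) t → ∫ ω in cylinder X x t, D i l ω ∂μ = 0)
    {c : ℕ → ℝ} (hc : ∀ l x t, L.IsFresh x (l + 1) t →
      ∫ ω in cylinder X x t, (∑ i, D i l ω ^ 2 + F l ω) ∂μ ≤ μ.real (cylinder X x t) * c l)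
    {C : ℝ} (hC : ∀ k, ∑ l ∈ Finset.range k, c l ≤ C) {ε : ℝ} (hε : 0 < ε) :
    μ {ω | ∃ k, ε ≤ energy D F k ω} ≤ ENNReal.ofReal (C / ε) := by
  have hmeas : ∀ k, Measurable[L.batchFiltration X k] (energy D F k) := fun k =>
    measurable_energy hD hF
  have hint : ∀ k, Integrable (energy D F k) μ := fun k =>
    integrable_of_measurable_of_bound (hmeas k) (exists_abs_energy_le hDb hFb k)
  have hnn : ∀ k ω, 0 ≤ energy D F k ω := fun k ω =>
    add_nonneg (Finset.sum_nonneg fun i _ => sq_nonneg _) (Finset.sum_nonneg fun l _ => hF0 l ω)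
  have hae' : ∀ k, ∀ᵐ ω ∂μ, ∃ t, L.IsFresh (fun v => X v ω) (k + 1) t := fun k =>
    hae.mono fun ω h => h k
  -- On every cylinder the increment of the energy integrates to the integral of a nonnegative
  -- function.
  have hsub : Submartingale (energy D F) (L.batchFiltration X) μ := by
    refine submartingale_of_setIntegral_le_succ (fun k => (hmeas k).stronglyMeasurable) hint ?_
    intro k B hB
    refine setIntegral_le_of_isFresh hX (hae' k) hB (hint k) (hint (k + 1)) fun x t hfr => ?_
    rw [setIntegral_energy_succ hX hD hF hDb hFb hD0 hfr]
    refine le_add_of_nonneg_right (integral_nonneg fun ω => ?_)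
    exact add_nonneg (Finset.sum_nonneg fun i _ => sq_nonneg _) (hF0 k ω)
  have hmean : ∀ k, ∫ ω, energy D F k ω ∂μ ≤ ∑ l ∈ Finset.range k, c l := by
    intro k
    induction k with
    | zero => simp [energy]
    | succ k ih =>
      have h1 : ∫ ω, energy D F (k + 1) ω ∂μ ≤ ∫ ω, (energy D F k ω + c k) ∂μ := by
        refine integral_le_of_isFresh hX (hae' k) (hint (k + 1))
          ((hint k).add (integrable_const _)) fun x t hfr => ?_
        rw [setIntegral_energy_succ hX hD hF hDb hFb hD0 hfr,
          integral_add (hint k).integrableOn (integrable_const _), setIntegral_const, smul_eq_mul]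
        linarith [hc k x t hfr]
      rw [integral_add (hint k) (integrable_const _), integral_const, probReal_univ, one_smul] at h1
      rw [Finset.sum_range_succ]
      linarith
  set ε' : NNReal := ⟨ε, hε.le⟩
  -- Doob's inequality is available for finite horizons, here with a bound independent of `N`; the
  -- events increase with `N`, so the bound passes to their union.
  set V : ℕ → Set Ω := fun N => {ω | (ε' : ℝ) ≤ (Finset.range (N + 1)).sup'
    Finset.nonempty_range_add_one fun k => energy D F k ω} with hV
  have hVle : ∀ N, μ (V N) ≤ ENNReal.ofReal (C / ε) := by
    intro N
    have h1 := maximal_ineq hsub (fun k ω => hnn k ω) (ε := ε') N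
    have h2 : ENNReal.ofReal (∫ ω in V N, energy D F N ω ∂μ) ≤ ENNReal.ofReal C :=
      ENNReal.ofReal_le_ofReal (((setIntegral_le_integral (hint N)
        (Eventually.of_forall (hnn N))).trans (hmean N)).trans (hC N))
    have h3 := h1.trans h2
    rw [ENNReal.ofReal_div_of_pos hε, ENNReal.le_div_iff_mul_le
      (Or.inl (by simpa using hε)) (Or.inl ENNReal.ofReal_ne_top), mul_comm]
    have h4 : ENNReal.ofReal ε = (ε' : ENNReal) := by
      rw [← ENNReal.ofReal_coe_nnreal]; rfl
    rw [h4]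
    exact h3
  have hmono : Monotone V := by
    intro N N' hN ω hω
    simp only [hV, Set.mem_ofPred_eq] at hω ⊢
    exact hω.trans (Finset.sup'_mono _ (Finset.range_mono (by omega)) _)
  have hcov : {ω | ∃ k, ε ≤ energy D F k ω} ⊆ ⋃ N, V N := by
    rintro ω ⟨k, hk⟩
    refine Set.mem_iUnion.2 ⟨k, ?_⟩
    simp only [hV, Set.mem_ofPred_eq]
    exact hk.trans (Finset.le_sup' (fun k => energy D F k ω) (Finset.self_mem_range_succ k))
  refine (measure_mono hcov).trans ?_
  rw [hmono.measure_iUnion]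
  exact iSup_le hVle

end Maximal

end Scheme

end ChainGame

open MeasureTheory Filter Topology

namespace ChainGame

variable {n : ℕ} {S A : Fin n → Type*} [∀ i, Fintype (S i)] [∀ i, Fintype (A i)]
variable {G : ChainGame n S A}

namespace Scheme

/-! ### Conditional means of the reward vectors -/

section Mean

variable {L : G.Scheme} {s₀ : ∀ i, S i} {Ω : Type*} [mΩ : MeasurableSpace Ω] {μ : Measure Ω}
  {X : ℕ → Ω → (∀ i, S i) × (∀ i, A i)} {x : ℕ → (∀ i, S i) × (∀ i, A i)} {k l t : ℕ} {i : Fin n}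

lemma Positive.occ_mem (hL : L.Positive) (x : ℕ → (∀ i, S i) × (∀ i, A i)) (k : ℕ) (i : Fin n) :
    L.occ x k i ∈ G.polytope i := by
  unfold occ
  split_ifs with h
  exacts [(hL x _ i).1, (hL x 0 i).1]

lemma Positive.occ_pos (hL : L.Positive) (x : ℕ → (∀ i, S i) × (∀ i, A i)) (k : ℕ) (i : Fin n)
    (p : S i × A i) : 0 < L.occ x k i p := by
  unfold occ
  split_ifs with h
  exacts [(hL x _ i).2 p, (hL x 0 i).2 p]

lemma Positive.occ_mem_occSimplex (hL : L.Positive) (x : ℕ → (∀ i, S i) × (∀ i, A i)) (k : ℕ)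
    (i : Fin n) : L.occ x k i ∈ occSimplex (S i) (A i) :=
  G.polytope_subset_occSimplex i (hL.occ_mem x k i)

open Classical in
/-- The conditional mean of the reward vector of batch `k`, given the past at the beginning of that
batch. -/
noncomputable def rewardMean (L : G.Scheme) (μ : Measure Ω)
    (X : ℕ → Ω → (∀ i, S i) × (∀ i, A i)) (x : ℕ → (∀ i, S i) × (∀ i, A i)) (k : ℕ) (i : Fin n) :
    OccVec (S i) (A i) :=
  WithLp.toLp 2 fun p => if μ.real (cylinder X x (L.freshTime x k)) = 0 then
      G.gain i (L.occ x k) p - L.shift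
    else (μ.real (cylinder X x (L.freshTime x k)))⁻¹ *
      ∫ ω in cylinder X x (L.freshTime x k), L.reward (fun u => X u ω) k i p ∂μ

/-- The reward vector of batch `k` minus its conditional mean. -/
noncomputable def noise (L : G.Scheme) (μ : Measure Ω)
    (X : ℕ → Ω → (∀ i, S i) × (∀ i, A i)) (k : ℕ) (i : Fin n) (ω : Ω) : OccVec (S i) (A i) :=
  L.reward (fun u => X u ω) k i - L.rewardMean μ X (fun u => X u ω) k i

lemma determined_rewardMean (k : ℕ) (i : Fin n) (p : S i × A i) :
    L.Determined k fun x => L.rewardMean μ X x k i p := fun x x' t hf h => by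
  have h1 := determined_occ k x x' t hf h
  have h2 := determined_freshTime k x x' t hf h
  simp only at h1 h2
  simp only [rewardMean]
  rw [← h1, ← h2, hf.freshTime_eq, cylinder_congr h]

lemma measurable_rewardMean (hX : ∀ t z, MeasurableSet {ω | X t ω = z}) (k : ℕ) (i : Fin n)
    (p : S i × A i) :
    Measurable[L.batchFiltration X k] fun ω => L.rewardMean μ X (fun u => X u ω) (k + 1) i p := by
  -- All paths that miss the batch share `freshTime = 0` and the initial occupation measures, so
  -- they have a common conditional mean, which serves as the constant.
  by_cases hx : ∃ x, ∀ t, (L.memory x t).batch ≠ k + 1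
  · obtain ⟨x, hx⟩ := hx
    refine measurable_of_determined hX (determined_rewardMean (k + 1) i p)
      (c := L.rewardMean μ X x (k + 1) i p) fun x' hx' => ?_
    simp only [rewardMean]
    rw [freshTime_of_not_reached hx, freshTime_of_not_reached hx', occ_of_not_reached hx,
      occ_of_not_reached hx', cylinder_congr (x := x) (x' := x') fun u hu => absurd hu u.not_lt_zero]
  · exact measurable_of_determined hX (determined_rewardMean (k + 1) i p)
      (c := 0) fun x' hx' => absurd ⟨x', hx'⟩ hx

lemma measurable_occ (hX : ∀ t z, MeasurableSet {ω | X t ω = z}) (k : ℕ) (i : Fin n)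
    (p : S i × A i) :
    Measurable[L.batchFiltration X k] fun ω => L.occ (fun u => X u ω) (k + 1) i p :=
  measurable_of_determined hX (f := fun x => L.occ x (k + 1) i p)
    (fun x x' t hf h => by
      have := determined_occ (k + 1) x x' t hf h
      simp only at this ⊢
      rw [this])
    (c := L.init i p) fun x hx => by rw [occ_of_not_reached hx]

lemma measurable_reward (hX : ∀ t z, MeasurableSet {ω | X t ω = z}) (k : ℕ) (i : Fin n)
    (p : S i × A i) :
    Measurable[L.batchFiltration X (k + 1)] fun ω => L.reward (fun u => X u ω) (k + 1) i p :=
  measurable_of_determined hX (f := fun x => L.reward x (k + 1) i p)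
    (fun x x' t hf h => by
      have := determined_reward k x x' t hf h
      simp only at this ⊢
      rw [this])
    (c := 0) fun x hx => by rw [reward_of_not_reached hx]; rfl

lemma measurable_noise (hX : ∀ t z, MeasurableSet {ω | X t ω = z}) (k : ℕ) (i : Fin n)
    (p : S i × A i) :
    Measurable[L.batchFiltration X (k + 1)] fun ω => L.noise μ X (k + 1) i ω p :=
  (measurable_reward hX k i p).sub ((measurable_rewardMean hX k i p).mono
    ((L.batchFiltration X).mono k.le_succ) le_rfl)

variable [IsProbabilityMeasure μ]

lemma integrable_reward (hX : ∀ t z, MeasurableSet {ω | X t ω = z}) (k : ℕ) (i : Fin n)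
    (p : S i × A i) : Integrable (fun ω => L.reward (fun u => X u ω) (k + 1) i p) μ := by
  obtain ⟨M, hM⟩ := L.exists_abs_reward_le k
  exact integrable_of_measurable_of_bound (measurable_reward hX k i p) ⟨M, fun ω => hM _ i p⟩

lemma integrable_reward_sq (hX : ∀ t z, MeasurableSet {ω | X t ω = z}) (k : ℕ) (i : Fin n)
    (p : S i × A i) : Integrable (fun ω => L.reward (fun u => X u ω) (k + 1) i p ^ 2) μ := by
  obtain ⟨M, hM⟩ := L.exists_abs_reward_le k
  refine integrable_of_measurable_of_bound ((measurable_reward hX k i p).pow_const 2)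
    ⟨M ^ 2, fun ω => ?_⟩
  rw [abs_pow]
  exact pow_le_pow_left₀ (abs_nonneg _) (hM _ i p) 2

lemma exists_abs_rewardMean_le (hL : L.Positive) (k : ℕ) :
    ∃ M : ℝ, ∀ x i p, |L.rewardMean μ X x (k + 1) i p| ≤ M := by
  obtain ⟨M, hM⟩ := L.exists_abs_reward_le k
  refine ⟨max M (1 + |L.shift|), fun x i p => ?_⟩
  simp only [rewardMean]
  split_ifs with h
  · have := G.gain_mem i (fun j => hL.occ_mem_occSimplex x (k + 1) j) p
    refine le_trans ?_ (le_max_right _ _)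
    refine (abs_sub _ _).trans (add_le_add ?_ le_rfl)
    rw [abs_of_nonneg this.1]; exact this.2
  · refine le_trans ?_ (le_max_left _ _)
    have h0 : 0 < μ.real (cylinder X x (L.freshTime x (k + 1))) :=
      lt_of_le_of_ne measureReal_nonneg (Ne.symm h)
    rw [abs_mul, abs_of_pos (inv_pos.2 h0), inv_mul_le_iff₀ h0, mul_comm]
    exact norm_setIntegral_le_of_norm_le_const
      (f := fun ω => L.reward (fun u => X u ω) (k + 1) i p) (measure_lt_top _ _) fun ω _ => hM _ i p

lemma exists_abs_noise_le (hL : L.Positive) (k : ℕ) :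
    ∃ M : ℝ, ∀ ω i p, |L.noise μ X (k + 1) i ω p| ≤ M := by
  obtain ⟨M, hM⟩ := L.exists_abs_reward_le k
  obtain ⟨M', hM'⟩ := exists_abs_rewardMean_le (μ := μ) (X := X) hL k
  exact ⟨M + M', fun ω i p => (abs_sub _ _).trans (add_le_add (hM _ i p) (hM' _ i p))⟩

lemma integrable_noise (hX : ∀ t z, MeasurableSet {ω | X t ω = z}) (hL : L.Positive) (k : ℕ)
    (i : Fin n) (p : S i × A i) : Integrable (fun ω => L.noise μ X (k + 1) i ω p) μ := by
  obtain ⟨M, hM⟩ := exists_abs_noise_le (μ := μ) (X := X) hL k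
  exact integrable_of_measurable_of_bound (measurable_noise hX k i p) ⟨M, fun ω => hM ω i p⟩

lemma integrable_noise_sq (hX : ∀ t z, MeasurableSet {ω | X t ω = z}) (hL : L.Positive) (k : ℕ)
    (i : Fin n) (p : S i × A i) : Integrable (fun ω => L.noise μ X (k + 1) i ω p ^ 2) μ := by
  obtain ⟨M, hM⟩ := exists_abs_noise_le (μ := μ) (X := X) hL k
  refine integrable_of_measurable_of_bound ((measurable_noise hX k i p).pow_const 2)
    ⟨M ^ 2, fun ω => ?_⟩
  rw [abs_pow]
  exact pow_le_pow_left₀ (abs_nonneg _) (hM _ i p) 2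

omit [IsProbabilityMeasure μ] in
lemma rewardMean_of_mem_cylinder (hf : L.IsFresh x k t) {ω : Ω} (hω : ω ∈ cylinder X x t)
    (p : S i × A i) : L.rewardMean μ X (fun u => X u ω) k i p = L.rewardMean μ X x k i p :=
  (determined_rewardMean k i p x _ t hf fun u hu => (hω u hu).symm).symm

lemma measureReal_mul_rewardMean (hf : L.IsFresh x k t) (p : S i × A i) :
    μ.real (cylinder X x t) * L.rewardMean μ X x k i p =
      ∫ ω in cylinder X x t, L.reward (fun u => X u ω) k i p ∂μ := by
  simp only [rewardMean]
  rw [hf.freshTime_eq]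
  split_ifs with h
  · rw [h, zero_mul, setIntegral_measure_zero]
    exact (measureReal_eq_zero_iff).1 h
  · rw [mul_inv_cancel_left₀ h]

lemma setIntegral_noise (hX : ∀ t z, MeasurableSet {ω | X t ω = z}) (hf : L.IsFresh x (k + 1) t)
    (p : S i × A i) : ∫ ω in cylinder X x t, L.noise μ X (k + 1) i ω p ∂μ = 0 := by
  have h1 : ∫ ω in cylinder X x t, L.noise μ X (k + 1) i ω p ∂μ = ∫ ω in cylinder X x t,
      (L.reward (fun u => X u ω) (k + 1) i p - L.rewardMean μ X x (k + 1) i p) ∂μ :=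
    setIntegral_congr_fun (measurableSet_cylinder hX x t) fun ω hω => by
      simp only [noise, PiLp.sub_apply]
      rw [rewardMean_of_mem_cylinder hf hω]
  rw [h1, integral_sub (integrable_reward hX k i p).integrableOn (integrable_const _),
    setIntegral_const, smul_eq_mul, measureReal_mul_rewardMean hf, sub_self]

/-- A conditional variance is at most the conditional second moment. -/
lemma setIntegral_noise_sq_le (hX : ∀ t z, MeasurableSet {ω | X t ω = z})
    (hf : L.IsFresh x (k + 1) t) (p : S i × A i) :
    ∫ ω in cylinder X x t, L.noise μ X (k + 1) i ω p ^ 2 ∂μ ≤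
      ∫ ω in cylinder X x t, L.reward (fun u => X u ω) (k + 1) i p ^ 2 ∂μ := by
  set m := L.rewardMean μ X x (k + 1) i p with hm
  have h1 : ∫ ω in cylinder X x t, L.noise μ X (k + 1) i ω p ^ 2 ∂μ = ∫ ω in cylinder X x t,
      (L.reward (fun u => X u ω) (k + 1) i p ^ 2 -
        (2 * m * L.reward (fun u => X u ω) (k + 1) i p - m ^ 2)) ∂μ :=
    setIntegral_congr_fun (measurableSet_cylinder hX x t) fun ω hω => by
      simp only [noise, PiLp.sub_apply]
      rw [rewardMean_of_mem_cylinder hf hω]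
      ring
  have hR := integrable_reward (μ := μ) (L := L) hX k i p
  have hR' : Integrable (fun ω => 2 * m * L.reward (fun u => X u ω) (k + 1) i p - m ^ 2) μ :=
    (hR.const_mul (2 * m)).sub (integrable_const (m ^ 2))
  rw [h1, integral_sub (integrable_reward_sq hX k i p).integrableOn hR'.integrableOn,
    integral_sub (hR.const_mul (2 * m)).integrableOn (integrable_const _),
    setIntegral_const, smul_eq_mul, integral_const_mul, ← measureReal_mul_rewardMean hf]
  nlinarith [mul_nonneg (measureReal_nonneg (μ := μ) (s := cylinder X x t)) (sq_nonneg m)]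

variable [∀ i, Nonempty (S i)] [∀ i, Nonempty (A i)] {τ : ℝ}

lemma IsRun.abs_rewardMean_sub_le (hX : L.IsRun s₀ μ X) (hL : L.Positive) (h0 : 0 < τ)
    (hτ : G.MixesWithin τ) (hn : 0 < n) (hf : L.IsFresh x k t) (p : S i × A i) :
    |L.rewardMean μ X x k i p - (G.gain i (L.occ x k) p - L.shift)| ≤ L.bias τ := by
  have h1 := hX.abs_setIntegral_reward_sub_le (i := i) hL h0 hτ hn hf p
  rw [← measureReal_mul_rewardMean hf, ← hf.occ_eq, ← mul_sub, abs_mul,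
    abs_of_nonneg measureReal_nonneg] at h1
  rcases (measureReal_nonneg (μ := μ) (s := cylinder X x t)).eq_or_lt with h | h
  -- On a null cylinder `rewardMean` is by definition the exact gradient, so the estimate holds
  -- along every path and not only almost surely.
  · simp only [rewardMean]
    rw [hf.freshTime_eq, if_pos h.symm, sub_self, abs_zero]
    unfold bias
    positivity
  · exact le_of_mul_le_mul_left h1 h

end Mean

/-! ### The energy of the noise -/

section Energy

variable {L : G.Scheme} {s₀ : ∀ i, S i} {Ω : Type*} [mΩ : MeasurableSpace Ω] {μ : Measure Ω}
  {X : ℕ → Ω → (∀ i, S i) × (∀ i, A i)} {x : ℕ → (∀ i, S i) × (∀ i, A i)} {k l t : ℕ} {i : Fin n}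

/-- The martingale differences that enter the regret of the players: the coordinates of the weighted
noise, and its inner product with the occupation measure in use. -/
noncomputable def noiseTerm (L : G.Scheme) (μ : Measure Ω) (X : ℕ → Ω → (∀ i, S i) × (∀ i, A i)) :
    (Σ i, S i × A i) ⊕ Fin n → ℕ → Ω → ℝ
  | .inl q, l, ω => L.η (l + 1) * L.noise μ X (l + 1) q.1 ω q.2
  | .inr i, l, ω => L.η (l + 1) *
      ∑ p, L.occ (fun u => X u ω) (l + 1) i p * L.noise μ X (l + 1) i ω p

/-- The sum of the squared norms of the weighted reward vectors of batch `l + 1`. -/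
noncomputable def rewardEnergy (L : G.Scheme) (X : ℕ → Ω → (∀ i, S i) × (∀ i, A i)) (l : ℕ) (ω : Ω) :
    ℝ :=
  ∑ i, ∑ p, L.η (l + 1) ^ 2 * L.reward (fun u => X u ω) (l + 1) i p ^ 2

lemma measurable_noiseTerm (hX : ∀ t z, MeasurableSet {ω | X t ω = z})
    (q : (Σ i, S i × A i) ⊕ Fin n) (l : ℕ) :
    Measurable[L.batchFiltration X (l + 1)] (L.noiseTerm μ X q l) := by
  rcases q with q | i
  · exact measurable_const.mul (measurable_noise hX l q.1 q.2)
  · exact measurable_const.mul (Finset.measurable_fun_sum _ fun p _ =>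
      ((measurable_occ hX l i p).mono ((L.batchFiltration X).mono l.le_succ) le_rfl).mul
        (measurable_noise hX l i p))

variable [IsProbabilityMeasure μ]

lemma exists_abs_noiseTerm_le (hL : L.Positive) (q : (Σ i, S i × A i) ⊕ Fin n) (l : ℕ) :
    ∃ M, ∀ ω, |L.noiseTerm μ X q l ω| ≤ M := by
  obtain ⟨M, hM⟩ := exists_abs_noise_le (μ := μ) (X := X) hL l
  rcases q with q | i
  · refine ⟨|L.η (l + 1)| * M, fun ω => ?_⟩
    simp only [noiseTerm]
    rw [abs_mul]
    exact mul_le_mul_of_nonneg_left (hM _ _ _) (abs_nonneg _)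
  · refine ⟨|L.η (l + 1)| * ∑ _p : S i × A i, M, fun ω => ?_⟩
    simp only [noiseTerm]
    rw [abs_mul]
    refine mul_le_mul_of_nonneg_left ((Finset.abs_sum_le_sum_abs _ _).trans
      (Finset.sum_le_sum fun p _ => ?_)) (abs_nonneg _)
    rw [abs_mul, abs_of_pos (hL.occ_pos _ _ _ _)]
    have h1 := le_one_of_mem_occSimplex (hL.occ_mem_occSimplex (fun u => X u ω) (l + 1) i) p
    calc _ ≤ 1 * |L.noise μ X (l + 1) i ω p| := mul_le_mul_of_nonneg_right h1 (abs_nonneg _)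
      _ ≤ M := by rw [one_mul]; exact hM _ _ _

omit [IsProbabilityMeasure μ] in
lemma measurable_rewardEnergy (hX : ∀ t z, MeasurableSet {ω | X t ω = z}) (l : ℕ) :
    Measurable[L.batchFiltration X (l + 1)] (L.rewardEnergy X l) :=
  Finset.measurable_fun_sum _ fun i _ => Finset.measurable_fun_sum _ fun p _ =>
    measurable_const.mul ((measurable_reward hX l i p).pow_const 2)

omit mΩ in
lemma exists_abs_rewardEnergy_le (L : G.Scheme) (X : ℕ → Ω → (∀ i, S i) × (∀ i, A i)) (l : ℕ) :
    ∃ M, ∀ ω, |L.rewardEnergy X l ω| ≤ M := by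
  obtain ⟨M, hM⟩ := L.exists_abs_reward_le l
  refine ⟨∑ i, ∑ _p : S i × A i, L.η (l + 1) ^ 2 * M ^ 2, fun ω => ?_⟩
  refine (Finset.abs_sum_le_sum_abs _ _).trans (Finset.sum_le_sum fun i _ =>
    (Finset.abs_sum_le_sum_abs _ _).trans (Finset.sum_le_sum fun p _ => ?_))
  rw [abs_of_nonneg (by positivity), ← sq_abs (L.reward _ _ _ _)]
  exact mul_le_mul_of_nonneg_left (pow_le_pow_left₀ (abs_nonneg _) (hM _ i p) 2) (sq_nonneg _)

omit mΩ in
lemma rewardEnergy_nonneg (L : G.Scheme) (X : ℕ → Ω → (∀ i, S i) × (∀ i, A i)) (l : ℕ) (ω : Ω) :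
    0 ≤ L.rewardEnergy X l ω :=
  Finset.sum_nonneg fun _ _ => Finset.sum_nonneg fun _ _ => by positivity

lemma setIntegral_noiseTerm (hX : ∀ t z, MeasurableSet {ω | X t ω = z}) (hL : L.Positive)
    (hf : L.IsFresh x (l + 1) t) (q : (Σ i, S i × A i) ⊕ Fin n) :
    ∫ ω in cylinder X x t, L.noiseTerm μ X q l ω ∂μ = 0 := by
  rcases q with q | i
  · simp only [noiseTerm]
    rw [integral_const_mul, setIntegral_noise hX hf, mul_zero]
  · simp only [noiseTerm]
    rw [integral_const_mul]
    have h1 : ∫ ω in cylinder X x t,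
        (∑ p, L.occ (fun u => X u ω) (l + 1) i p * L.noise μ X (l + 1) i ω p) ∂μ =
        ∫ ω in cylinder X x t,
        (∑ p, L.occ x (l + 1) i p * L.noise μ X (l + 1) i ω p) ∂μ :=
      setIntegral_congr_fun (measurableSet_cylinder hX x t) fun ω hω => by
        have := determined_occ (l + 1) x _ t hf fun u hu => (hω u hu).symm
        simp only at this ⊢
        rw [this]
    rw [h1, integral_finsetSum _ fun p _ => ((integrable_noise hX hL l i p).const_mul _).integrableOn]
    rw [Finset.sum_eq_zero fun p _ => by rw [integral_const_mul, setIntegral_noise hX hf, mul_zero],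
      mul_zero]

omit [IsProbabilityMeasure μ] in
-- Cauchy–Schwarz bounds the inner-product terms by the coordinate terms, as the squares of a
-- probability vector sum to at most one; hence the factor two.
lemma sum_noiseTerm_sq_le (hL : L.Positive) (l : ℕ) (ω : Ω) :
    ∑ q, L.noiseTerm μ X q l ω ^ 2 ≤
      2 * ∑ i, ∑ p, L.η (l + 1) ^ 2 * L.noise μ X (l + 1) i ω p ^ 2 := by
  rw [Fintype.sum_sum_type, Fintype.sum_sigma, two_mul]
  refine add_le_add (le_of_eq ?_) (Finset.sum_le_sum fun i _ => ?_)
  · simp only [noiseTerm, mul_pow]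
  · simp only [noiseTerm, mul_pow]
    rw [← Finset.mul_sum]
    refine mul_le_mul_of_nonneg_left ?_ (sq_nonneg _)
    refine (Finset.sum_mul_sq_le_sq_mul_sq _ _ _).trans ?_
    refine mul_le_of_le_one_left (Finset.sum_nonneg fun _ _ => sq_nonneg _) ?_
    have h1 := hL.occ_mem_occSimplex (fun u => X u ω) (l + 1) i
    calc ∑ p, L.occ (fun u => X u ω) (l + 1) i p ^ 2 ≤ ∑ p, L.occ (fun u => X u ω) (l + 1) i p :=
        Finset.sum_le_sum fun p _ => by
          have := le_one_of_mem_occSimplex h1 p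
          nlinarith [h1.1 p]
      _ = 1 := h1.2

variable [∀ i, Nonempty (S i)] [∀ i, Nonempty (A i)] {τ : ℝ}

/-- The constant `3` counts the noise twice and the rewards once, each with second moment at most
`V` times the squared step. -/
lemma IsRun.setIntegral_energy_le (hX : L.IsRun s₀ μ X) (hL : L.Positive) (h0 : 0 < τ)
    (hτ : G.MixesWithin τ) (hn : 0 < n) (hs0 : 0 ≤ L.shift) (hs1 : L.shift ≤ 1) {V : ℝ}
    (hV : ∀ x t, ∑ i, ∑ p : S i × A i, 1 / policyOf ((L.memory x t).ρ i) p.1 p.2 ≤ V)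
    (hf : L.IsFresh x (l + 1) t) :
    ∫ ω in cylinder X x t, (∑ q, L.noiseTerm μ X q l ω ^ 2 + L.rewardEnergy X l ω) ∂μ ≤
      μ.real (cylinder X x t) * (3 * V * L.η (l + 1) ^ 2) := by
  have hm := hX.measurable
  have hi1 : Integrable (fun ω => 2 * ∑ i, ∑ p, L.η (l + 1) ^ 2 * L.noise μ X (l + 1) i ω p ^ 2) μ :=
    (integrable_finsetSum _ fun i _ => integrable_finsetSum _ fun p _ =>
      (integrable_noise_sq hm hL l i p).const_mul _).const_mul 2
  have hi2 : Integrable (L.rewardEnergy X l) μ :=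
    integrable_finsetSum _ fun i _ => integrable_finsetSum _ fun p _ =>
      (integrable_reward_sq hm l i p).const_mul _
  have hi3 : Integrable (fun ω => ∑ q, L.noiseTerm μ X q l ω ^ 2 + L.rewardEnergy X l ω) μ := by
    refine Integrable.add (integrable_finsetSum _ fun q _ => ?_) hi2
    obtain ⟨M, hM⟩ := exists_abs_noiseTerm_le (μ := μ) (X := X) hL q l
    refine integrable_of_measurable_of_bound ((measurable_noiseTerm hm q l).pow_const 2)
      ⟨M ^ 2, fun ω => ?_⟩
    rw [abs_pow]
    exact pow_le_pow_left₀ (abs_nonneg _) (hM _) 2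
  have hR : ∫ ω in cylinder X x t, L.rewardEnergy X l ω ∂μ ≤
      μ.real (cylinder X x t) * (V * L.η (l + 1) ^ 2) := by
    simp only [rewardEnergy]
    rw [integral_finsetSum _ fun i _ => integrable_finsetSum _ fun p _ =>
      ((integrable_reward_sq hm l i p).const_mul _).integrableOn]
    calc _ ≤ ∑ i, ∑ p : S i × A i, L.η (l + 1) ^ 2 * (μ.real (cylinder X x t) *
          (1 / policyOf ((L.memory x t).ρ i) p.1 p.2)) := by
          refine Finset.sum_le_sum fun i _ => ?_
          rw [integral_finsetSum _ fun p _ =>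
            ((integrable_reward_sq hm l i p).const_mul _).integrableOn]
          refine Finset.sum_le_sum fun p _ => ?_
          rw [integral_const_mul]
          exact mul_le_mul_of_nonneg_left
            (hX.setIntegral_reward_sq_le hL h0 hτ hn hf hs0 hs1 p) (sq_nonneg _)
      _ = μ.real (cylinder X x t) * (L.η (l + 1) ^ 2 *
          ∑ i, ∑ p : S i × A i, 1 / policyOf ((L.memory x t).ρ i) p.1 p.2) := by
          simp only [Finset.mul_sum]
          refine Finset.sum_congr rfl fun i _ => Finset.sum_congr rfl fun p _ => by ring
      _ ≤ _ := by
          rw [mul_comm V]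
          exact mul_le_mul_of_nonneg_left (mul_le_mul_of_nonneg_left (hV x t) (sq_nonneg _))
            measureReal_nonneg
  have hN : ∫ ω in cylinder X x t,
      (∑ i, ∑ p, L.η (l + 1) ^ 2 * L.noise μ X (l + 1) i ω p ^ 2) ∂μ ≤
      ∫ ω in cylinder X x t, L.rewardEnergy X l ω ∂μ := by
    simp only [rewardEnergy]
    rw [integral_finsetSum _ fun i _ => integrable_finsetSum _ fun p _ =>
      ((integrable_noise_sq hm hL l i p).const_mul _).integrableOn,
      integral_finsetSum _ fun i _ => integrable_finsetSum _ fun p _ =>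
      ((integrable_reward_sq hm l i p).const_mul _).integrableOn]
    refine Finset.sum_le_sum fun i _ => ?_
    rw [integral_finsetSum _ fun p _ =>
        ((integrable_noise_sq hm hL l i p).const_mul _).integrableOn,
      integral_finsetSum _ fun p _ =>
        ((integrable_reward_sq hm l i p).const_mul _).integrableOn]
    refine Finset.sum_le_sum fun p _ => ?_
    rw [integral_const_mul, integral_const_mul]
    exact mul_le_mul_of_nonneg_left (setIntegral_noise_sq_le hm hf p) (sq_nonneg _)
  calc _ ≤ ∫ ω in cylinder X x t,
        (2 * (∑ i, ∑ p, L.η (l + 1) ^ 2 * L.noise μ X (l + 1) i ω p ^ 2) +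
          L.rewardEnergy X l ω) ∂μ :=
        setIntegral_mono hi3.integrableOn (hi1.add hi2).integrableOn fun ω =>
          add_le_add (sum_noiseTerm_sq_le hL l ω) le_rfl
    _ = 2 * ∫ ω in cylinder X x t,
        (∑ i, ∑ p, L.η (l + 1) ^ 2 * L.noise μ X (l + 1) i ω p ^ 2) ∂μ +
        ∫ ω in cylinder X x t, L.rewardEnergy X l ω ∂μ := by
        rw [integral_add hi1.integrableOn hi2.integrableOn, integral_const_mul]
    _ ≤ _ := by linarith

/-- The energy of the noise and of the rewards stays below a given level with high probability. -/
lemma IsRun.measure_exists_le_energy (hX : L.IsRun s₀ μ X) (hL : L.Positive) (h0 : 0 < τ)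
    (hτ : G.MixesWithin τ) (hn : 0 < n) (hs0 : 0 ≤ L.shift) (hs1 : L.shift ≤ 1) {V : ℝ}
    (hV : ∀ x t, ∑ i, ∑ p : S i × A i, 1 / policyOf ((L.memory x t).ρ i) p.1 p.2 ≤ V)
    (hV0 : 0 ≤ V) {W : ℝ} (hW : ∀ k, ∑ l ∈ Finset.range k, L.η (l + 1) ^ 2 ≤ W) {E : ℝ}
    (hE : 0 < E) :
    μ {ω | ∃ k, E ≤ energy (L.noiseTerm μ X) (L.rewardEnergy X) k ω} ≤
      ENNReal.ofReal (3 * V * W / E) := by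
  refine Scheme.measure_exists_le_energy hX.measurable (hX.ae_exists_isFresh hL h0 hτ hn)
    (measurable_noiseTerm hX.measurable) (measurable_rewardEnergy hX.measurable)
    (exists_abs_noiseTerm_le hL) (exists_abs_rewardEnergy_le L X) (rewardEnergy_nonneg L X)
    (fun q l x t hf => setIntegral_noiseTerm hX.measurable hL hf q)
    (c := fun l => 3 * V * L.η (l + 1) ^ 2)
    (fun l x t hf => hX.setIntegral_energy_le hL h0 hτ hn hs0 hs1 hV hf) (fun k => ?_) hE
  rw [← Finset.mul_sum]
  exact mul_le_mul_of_nonneg_left (hW k) (by positivity)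

end Energy

end Scheme

end ChainGame

/-! ### Regret along a fixed path, and dual averaging. -/

open MeasureTheory Filter Topology

namespace ChainGame

variable {n : ℕ} {S A : Fin n → Type*} [∀ i, Fintype (S i)] [∀ i, Fintype (A i)]
variable {G : ChainGame n S A}

lemma sum_Icc_one_eq {M : Type*} [AddCommMonoid M] (f : ℕ → M) (k : ℕ) :
    ∑ l ∈ Finset.Icc 1 k, f l = ∑ l ∈ Finset.range k, f (l + 1) := by
  rw [Finset.range_eq_Ico, Finset.sum_Ico_add' f 0 k 1]
  rfl

lemma sum_abs_le_sqrt_card_mul_norm {S A : Type*} [Fintype S] [Fintype A] (x : OccVec S A) :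
    ∑ p, |x p| ≤ √((Fintype.card A : ℝ) * Fintype.card S) * ‖x‖ := by
  rw [EuclideanSpace.norm_eq, ← Real.sqrt_mul (by positivity)]
  refine Real.le_sqrt_of_sq_le ?_
  have h := sq_sum_le_card_mul_sum_sq (s := Finset.univ) (f := fun p => |x p|)
  rw [Finset.card_univ, Fintype.card_prod, Nat.cast_mul] at h
  simp only [Real.norm_eq_abs]
  rwa [mul_comm (Fintype.card A : ℝ)]

/-- The gains lie in `[0, 1]`, so the gap is Lipschitz in the comparator. This allows a comparator
from the polytope to be replaced by one from the shrunk polytope, in which dual averaging competes.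
-/
lemma gapSum_le_add {lam : Fin n → ℝ} (hlam : ∀ i, 0 ≤ lam i) {θ θ' ρ : ∀ j, OccVec (S j) (A j)}
    (hρ : ∀ j, ρ j ∈ occSimplex (S j) (A j)) :
    G.gapSum lam θ ρ ≤ G.gapSum lam θ' ρ + ∑ j, lam j *
      (√((Fintype.card (A j) : ℝ) * Fintype.card (S j)) * ‖θ j - θ' j‖) := by
  rw [gapSum_eq, gapSum_eq, ← Finset.sum_add_distrib]
  refine Finset.sum_le_sum fun j _ => ?_
  rw [← mul_add]
  refine mul_le_mul_of_nonneg_left ?_ (hlam j)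
  refine le_trans ?_ (add_le_add le_rfl (sum_abs_le_sqrt_card_mul_norm _))
  rw [← Finset.sum_add_distrib]
  refine Finset.sum_le_sum fun p _ => ?_
  have hg := G.gain_mem j hρ p
  have h1 : G.gain j ρ p * (θ j p - θ' j p) ≤ |θ j p - θ' j p| := by
    refine (le_abs_self _).trans ?_
    rw [abs_mul, abs_of_nonneg hg.1]
    exact mul_le_of_le_one_left (abs_nonneg _) hg.2
  simp only [PiLp.sub_apply]
  linarith

namespace Scheme

variable {L : G.Scheme} {x : ℕ → (∀ i, S i) × (∀ i, A i)} {k : ℕ}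

lemma avgOcc_eq (L : G.Scheme) (x : ℕ → (∀ i, S i) × (∀ i, A i)) (k : ℕ) :
    L.avgOcc x k = ∑ l ∈ Finset.range k,
      (L.η (l + 1) / ∑ j ∈ Finset.range k, L.η (j + 1)) • L.occ x (l + 1) := by
  rw [avgOcc, sum_Icc_one_eq, sum_Icc_one_eq]

lemma avgOcc_mem {s : ∀ i, Set (OccVec (S i) (A i))} (hs : ∀ i, Convex ℝ (s i))
    (hη : ∀ l, 0 < L.η (l + 1)) (hk : 1 ≤ k) (h : ∀ l i, L.occ x (l + 1) i ∈ s i) (i : Fin n) :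
    L.avgOcc x k i ∈ s i := by
  have hw : 0 < ∑ j ∈ Finset.range k, L.η (j + 1) :=
    Finset.sum_pos (fun l _ => hη l) (Finset.nonempty_range_iff.2 (by omega))
  rw [avgOcc_eq, Finset.sum_apply]
  refine (hs i).sum_mem (fun l _ => (div_pos (hη l) hw).le) ?_ fun l _ => h l i
  rw [← Finset.sum_div, div_self hw.ne']

/-- Jensen's inequality for the averaged occupation measures. -/
lemma sum_mul_gapSum_avgOcc_le {lam : Fin n → ℝ} (hG : G.SociallyConcave lam)
    {θ : ∀ j, OccVec (S j) (A j)} (hθ : ∀ j, θ j ∈ G.polytope j) (hη : ∀ l, 0 < L.η (l + 1))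
    (hk : 1 ≤ k) (h : ∀ l i, L.occ x (l + 1) i ∈ G.polytope i) :
    (∑ l ∈ Finset.range k, L.η (l + 1)) * G.gapSum lam θ (L.avgOcc x k) ≤
      ∑ j, lam j * ∑ l ∈ Finset.range k, L.η (l + 1) *
        ∑ p, G.gain j (L.occ x (l + 1)) p * (θ j p - L.occ x (l + 1) j p) := by
  have hw : 0 < ∑ j ∈ Finset.range k, L.η (j + 1) :=
    Finset.sum_pos (fun l _ => hη l) (Finset.nonempty_range_iff.2 (by omega))
  have h1 := (hG.convexOn_gapSum hθ).map_sum_le (t := Finset.range k)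
    (w := fun l => L.η (l + 1) / ∑ j ∈ Finset.range k, L.η (j + 1))
    (p := fun l => L.occ x (l + 1)) (fun l _ => (div_pos (hη l) hw).le)
    (by rw [← Finset.sum_div, div_self hw.ne']) (fun l _ i _ => h l i)
  rw [← avgOcc_eq] at h1
  refine (mul_le_mul_of_nonneg_left h1 hw.le).trans (le_of_eq ?_)
  simp only [smul_eq_mul, gapSum_eq, Finset.mul_sum]
  rw [Finset.sum_comm]
  refine Finset.sum_congr rfl fun j _ => Finset.sum_congr rfl fun l _ =>
    Finset.sum_congr rfl fun p _ => ?_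
  field_simp

/-- The bias that remains after the waiting time. -/
lemma mul_bias_le {τ ε M : ℝ} (h0 : 0 < τ) (hε : 0 < ε) (hn : 0 < n) (hM : 0 < M)
    (hd : τ * Real.log (6 * n / ε * M) ≤ L.d) : M * L.bias τ ≤ ε / 3 := by
  have hn' : (0 : ℝ) < n := Nat.cast_pos.2 hn
  have h1 : Real.exp (-1 / τ) ^ L.d ≤ (6 * n / ε * M)⁻¹ := by
    rw [← Real.exp_nat_mul, ← Real.exp_log (by positivity : 0 < 6 * n / ε * M), ← Real.exp_neg]
    refine Real.exp_le_exp.2 ?_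
    have h2 : Real.log (6 * n / ε * M) ≤ L.d / τ := by
      rw [le_div_iff₀ h0, mul_comm]; exact hd
    have h3 : (L.d : ℝ) * (-1 / τ) = - (L.d / τ) := by ring
    rw [h3]
    exact neg_le_neg h2
  calc M * L.bias τ = 2 * n * M * Real.exp (-1 / τ) ^ L.d := by unfold bias; ring
    _ ≤ 2 * n * M * (6 * n / ε * M)⁻¹ := mul_le_mul_of_nonneg_left h1 (by positivity)
    _ = ε / 3 := by field_simp; norm_num

section Regret

variable {Ω : Type*} [mΩ : MeasurableSpace Ω] {μ : Measure Ω}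
  {X : ℕ → Ω → (∀ i, S i) × (∀ i, A i)} {ω : Ω} {i : Fin n} {b : ℝ}

/-- The contribution of player `i` to the energy. -/
noncomputable def playerEnergy (L : G.Scheme) (μ : Measure Ω)
    (X : ℕ → Ω → (∀ i, S i) × (∀ i, A i)) (k : ℕ) (i : Fin n) (ω : Ω) : ℝ :=
  ∑ p, (∑ l ∈ Finset.range k, L.noiseTerm μ X (.inl ⟨i, p⟩) l ω) ^ 2 +
    (∑ l ∈ Finset.range k, L.noiseTerm μ X (.inr i) l ω) ^ 2 +
    ∑ l ∈ Finset.range k, ‖L.η (l + 1) • L.reward (fun u => X u ω) (l + 1) i‖ ^ 2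

lemma sum_playerEnergy (k : ℕ) (ω : Ω) : ∑ i, L.playerEnergy μ X k i ω =
    energy (L.noiseTerm μ X) (L.rewardEnergy X) k ω := by
  simp only [playerEnergy, energy, Finset.sum_add_distrib, Fintype.sum_sum_type,
    Fintype.sum_sigma, rewardEnergy]
  congr 1
  rw [Finset.sum_comm]
  refine Finset.sum_congr rfl fun l _ => Finset.sum_congr rfl fun i _ => ?_
  rw [EuclideanSpace.norm_sq_eq]
  refine Finset.sum_congr rfl fun p _ => ?_
  rw [PiLp.smul_apply, smul_eq_mul, Real.norm_eq_abs, sq_abs, mul_pow]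

/-- The comparator enters linearly and comes out of the sums over the batches; what remains are the
partial sums of `noiseTerm`. -/
lemma sum_noise_mul_eq (L : G.Scheme) (μ : Measure Ω) (X : ℕ → Ω → (∀ i, S i) × (∀ i, A i)) (k : ℕ)
    (ω : Ω) (θ : OccVec (S i) (A i)) :
    ∑ l ∈ Finset.range k, L.η (l + 1) * ∑ p, L.noise μ X (l + 1) i ω p *
      (θ p - L.occ (fun u => X u ω) (l + 1) i p) =
      ∑ p, θ p * (∑ l ∈ Finset.range k, L.noiseTerm μ X (.inl ⟨i, p⟩) l ω) -
        ∑ l ∈ Finset.range k, L.noiseTerm μ X (.inr i) l ω := by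
  simp only [noiseTerm, Finset.mul_sum]
  rw [Finset.sum_comm (s := Finset.univ), ← Finset.sum_sub_distrib]
  refine Finset.sum_congr rfl fun l _ => ?_
  rw [← Finset.sum_sub_distrib]
  exact Finset.sum_congr rfl fun p _ => by ring

/-- Young's inequality in each coordinate and for the inner-product term. The bound does not involve
`θ`, so the comparator may depend on the outcome, as it does in (a). -/
lemma neg_sum_noise_le (L : G.Scheme) (μ : Measure Ω) (X : ℕ → Ω → (∀ i, S i) × (∀ i, A i)) (k : ℕ)
    (ω : Ω) {θ : OccVec (S i) (A i)} (hθ : θ ∈ occSimplex (S i) (A i)) :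
    - ∑ l ∈ Finset.range k, L.η (l + 1) * ∑ p, L.noise μ X (l + 1) i ω p *
      (θ p - L.occ (fun u => X u ω) (l + 1) i p) ≤
    1 + (∑ p, (∑ l ∈ Finset.range k, L.noiseTerm μ X (.inl ⟨i, p⟩) l ω) ^ 2 +
      (∑ l ∈ Finset.range k, L.noiseTerm μ X (.inr i) l ω) ^ 2) / 2 := by
  rw [sum_noise_mul_eq]
  set M : S i × A i → ℝ := fun p => ∑ l ∈ Finset.range k, L.noiseTerm μ X (.inl ⟨i, p⟩) l ω
  set m := ∑ l ∈ Finset.range k, L.noiseTerm μ X (.inr i) l ω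
  have h2 : ∑ p, - (θ p * M p) ≤ ∑ p, (θ p + M p ^ 2) / 2 := Finset.sum_le_sum fun p _ => by
    nlinarith [sq_nonneg (θ p + M p), hθ.1 p, le_one_of_mem_occSimplex hθ p]
  rw [Finset.sum_neg_distrib, ← Finset.sum_div, Finset.sum_add_distrib, hθ.2] at h2
  nlinarith [sq_nonneg (m - 1)]

/-- The regret with respect to the gains is at most the regret with respect to the observed rewards,
up to noise and bias. -/
lemma sum_gain_le (hL : L.Positive) (hη : ∀ l, 0 < L.η (l + 1)) (hb : 0 ≤ b)
    (hbias : ∀ l p, |L.rewardMean μ X (fun u => X u ω) (l + 1) i p -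
      (G.gain i (L.occ (fun u => X u ω) (l + 1)) p - L.shift)| ≤ b)
    {θ : OccVec (S i) (A i)} (hθ : θ ∈ occSimplex (S i) (A i)) (k : ℕ) :
    ∑ l ∈ Finset.range k, L.η (l + 1) * ∑ p, G.gain i (L.occ (fun u => X u ω) (l + 1)) p *
        (θ p - L.occ (fun u => X u ω) (l + 1) i p) ≤
      ∑ l ∈ Finset.range k, inner ℝ (L.η (l + 1) • L.reward (fun u => X u ω) (l + 1) i)
        (θ - L.occ (fun u => X u ω) (l + 1) i) -
      ∑ l ∈ Finset.range k, L.η (l + 1) * ∑ p, L.noise μ X (l + 1) i ω p *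
        (θ p - L.occ (fun u => X u ω) (l + 1) i p) +
      min 2 ((Fintype.card (A i) : ℝ) * Fintype.card (S i)) * b *
        ∑ l ∈ Finset.range k, L.η (l + 1) := by
  rw [Finset.mul_sum, ← Finset.sum_sub_distrib, ← Finset.sum_add_distrib]
  refine Finset.sum_le_sum fun l _ => ?_
  set ρ := L.occ (fun u => X u ω) (l + 1) with hρ
  have hρi : ρ i ∈ occSimplex (S i) (A i) := hL.occ_mem_occSimplex _ _ i
  -- Both measures have mass one, so the shift of the rewards does not affect regrets.
  have h0 : ∑ p, L.shift * (θ p - ρ i p) = 0 := by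
    rw [← Finset.mul_sum, Finset.sum_sub_distrib, hθ.2, hρi.2, sub_self, mul_zero]
  rw [inner_smul_left, inner_eq_sum, RCLike.conj_to_real,
    mul_comm (min _ _ * b), ← mul_sub, ← mul_add]
  refine mul_le_mul_of_nonneg_left ?_ (hη l).le
  have h1 : ∑ p, |θ p - ρ i p| * b ≤
      min 2 ((Fintype.card (A i) : ℝ) * Fintype.card (S i)) * b := by
    rw [← Finset.sum_mul]
    exact mul_le_mul_of_nonneg_right (sum_abs_sub_le_min hθ hρi) hb
  suffices key : ∑ p, (G.gain i ρ p * (θ p - ρ i p) - L.shift * (θ p - ρ i p)) ≤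
      ∑ p, ((L.reward (fun u => X u ω) (l + 1) i p * (θ p - ρ i p) -
        L.noise μ X (l + 1) i ω p * (θ p - ρ i p)) + |θ p - ρ i p| * b) by
    rw [Finset.sum_sub_distrib, h0, sub_zero, Finset.sum_add_distrib, Finset.sum_sub_distrib] at key
    exact key.trans (add_le_add le_rfl h1)
  refine Finset.sum_le_sum fun p _ => ?_
  have h2 := hbias l p
  rw [← hρ] at h2
  have h3 : -(|θ p - ρ i p| * b) ≤ (L.rewardMean μ X (fun u => X u ω) (l + 1) i p -
      (G.gain i ρ p - L.shift)) * (θ p - ρ i p) := by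
    refine (abs_le.1 ?_).1
    rw [abs_mul, mul_comm]
    exact mul_le_mul_of_nonneg_left h2 (abs_nonneg _)
  simp only [noise, PiLp.sub_apply]
  linarith

end Regret

end Scheme

section DualAveraging

variable {d : ℕ} {η : ℕ → ℝ} {δ : Fin n → ℝ} {h : ∀ i, OccVec (S i) (A i) → ℝ}
  {ρ₁ : ∀ i, OccVec (S i) (A i)} {x : ℕ → (∀ i, S i) × (∀ i, A i)} {K : ℝ} {i : Fin n}

lemma dualAveraging_memory_mem (hρ₁ : ∀ i, ρ₁ i ∈ G.shrunkPolytope i (δ i))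
    (hmax : ∀ i Y, ∃ x ∈ G.shrunkPolytope i (δ i),
      IsMaxOn (fun x => inner ℝ x Y - h i x) (G.shrunkPolytope i (δ i)) x)
    (x : ℕ → (∀ i, S i) × (∀ i, A i)) (t : ℕ) (i : Fin n) :
    ((G.dualAveraging d η δ h ρ₁).memory x t).ρ i ∈ G.shrunkPolytope i (δ i) := by
  induction t with
  | zero => exact hρ₁ i
  | succ t ih =>
    by_cases he : ∀ i, ((G.dualAveraging d η δ h ρ₁).sampledMemory x t).todo i = ∅
    · rw [Scheme.memory_succ_of_end he]
      exact (argmaxOn_spec (hmax i _)).1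
    · rw [Scheme.memory_succ_of_not_end he, Scheme.sampledMemory, Scheme.sample_ρ]
      exact ih

lemma dualAveraging_positive (hδ : ∀ i, 0 < δ i) (hρ₁ : ∀ i, ρ₁ i ∈ G.shrunkPolytope i (δ i))
    (hmax : ∀ i Y, ∃ x ∈ G.shrunkPolytope i (δ i),
      IsMaxOn (fun x => inner ℝ x Y - h i x) (G.shrunkPolytope i (δ i)) x) :
    (G.dualAveraging d η δ h ρ₁).Positive := fun x t i =>
  ⟨(dualAveraging_memory_mem hρ₁ hmax x t i).1, fun p =>
    (hδ i).trans_le ((dualAveraging_memory_mem hρ₁ hmax x t i).2 p)⟩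

lemma dualAveraging_occ_mem (hρ₁ : ∀ i, ρ₁ i ∈ G.shrunkPolytope i (δ i))
    (hmax : ∀ i Y, ∃ x ∈ G.shrunkPolytope i (δ i),
      IsMaxOn (fun x => inner ℝ x Y - h i x) (G.shrunkPolytope i (δ i)) x)
    (x : ℕ → (∀ i, S i) × (∀ i, A i)) (k : ℕ) (i : Fin n) :
    (G.dualAveraging d η δ h ρ₁).occ x k i ∈ G.shrunkPolytope i (δ i) := by
  unfold Scheme.occ
  split_ifs
  exacts [dualAveraging_memory_mem hρ₁ hmax x _ i, hρ₁ i]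

/-- The regret of dual averaging along a fixed path, for an arbitrary first iterate. -/
lemma dualAveraging_regret (hρ₁ : ∀ i, ρ₁ i ∈ G.shrunkPolytope i (δ i))
    (hmax : ∀ i Y, ∃ x ∈ G.shrunkPolytope i (δ i),
      IsMaxOn (fun x => inner ℝ x Y - h i x) (G.shrunkPolytope i (δ i)) x)
    (hK : 0 < K) (hh : StrongConvexOn (G.shrunkPolytope i (δ i)) K (h i))
    (hx : ∀ k, ∃ t, (G.dualAveraging d η δ h ρ₁).IsFresh x (k + 1) t) {k : ℕ} (hk : 1 ≤ k)
    {z₀ : OccVec (S i) (A i)} (hz₀ : z₀ ∈ G.shrunkPolytope i (δ i))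
    (hz₀' : ∀ y ∈ G.shrunkPolytope i (δ i), h i z₀ ≤ h i y)
    {θ : OccVec (S i) (A i)} (hθ : θ ∈ G.shrunkPolytope i (δ i)) :
    ∑ l ∈ Finset.range k, inner ℝ (η (l + 1) • (G.dualAveraging d η δ h ρ₁).reward x (l + 1) i)
      (θ - (G.dualAveraging d η δ h ρ₁).occ x (l + 1) i) ≤
    h i θ - h i z₀ + 1 + (1 + 1 / (2 * K)) * ∑ l ∈ Finset.range k,
      ‖η (l + 1) • (G.dualAveraging d η δ h ρ₁).reward x (l + 1) i‖ ^ 2 := by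
  set L := G.dualAveraging d η δ h ρ₁ with hLdef
  set g : ℕ → OccVec (S i) (A i) := fun l => η (l + 1) • L.reward x (l + 1) i with hg
  -- The given first iterate need not maximize the objective for score zero. It is replaced by the
  -- minimizer `z₀` of `h i`, and all later iterates are the true maximizers.
  set z : ℕ → OccVec (S i) (A i) := fun l => if l = 0 then z₀ else L.occ x (l + 1) i with hz
  have hocc : ∀ l, L.occ x (l + 1) i ∈ G.shrunkPolytope i (δ i) := fun l =>
    dualAveraging_occ_mem hρ₁ hmax x (l + 1) i
  have hzs : ∀ l, z l ∈ G.shrunkPolytope i (δ i) := fun l => by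
    simp only [hz]; split_ifs; exacts [hz₀, hocc l]
  have hzmax : ∀ l, IsMaxOn (fun x => inner ℝ x (∑ j ∈ Finset.range l, g j) - h i x)
      (G.shrunkPolytope i (δ i)) (z l) := by
    rintro (_ | l)
    · intro y hy
      simpa [hz] using hz₀' y hy
    · obtain ⟨t, ht⟩ := hx (l + 1)
      have h1 := Scheme.occ_succ ht i
      have h2 := (argmaxOn_spec (hmax i (∑ j ∈ Finset.range (l + 1), g j))).2
      simp only [hz, if_neg l.succ_ne_zero]
      rw [h1]
      exact h2
  have hreg := hh.sum_inner_le hK hzs k (fun l _ => hzmax l) hθ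
  have hz0 : z 0 = z₀ := if_pos rfl
  rw [hz0, ← Finset.sum_div] at hreg
  -- The price of the replacement is one inner product with a vector of norm at most `2`.
  have h0 : inner ℝ (g 0) (z₀ - L.occ x 1 i) ≤ 1 + ∑ l ∈ Finset.range k, ‖g l‖ ^ 2 := by
    have h1 : ‖z₀ - L.occ x 1 i‖ ≤ 2 := by
      refine (norm_sub_le _ _).trans ?_
      have := norm_le_one_of_mem_occSimplex (G.polytope_subset_occSimplex i hz₀.1)
      have := norm_le_one_of_mem_occSimplex (G.polytope_subset_occSimplex i (hocc 0).1)
      linarith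
    have h2 : ‖g 0‖ ^ 2 ≤ ∑ l ∈ Finset.range k, ‖g l‖ ^ 2 :=
      Finset.single_le_sum (f := fun l => ‖g l‖ ^ 2) (fun l _ => sq_nonneg _)
        (Finset.mem_range.2 hk)
    have h3 := real_inner_le_norm (g 0) (z₀ - L.occ x 1 i)
    nlinarith [mul_le_mul_of_nonneg_left h1 (norm_nonneg (g 0)), sq_nonneg (‖g 0‖ - 1)]
  have hsplit : ∑ l ∈ Finset.range k, inner ℝ (g l) (θ - L.occ x (l + 1) i) =
      ∑ l ∈ Finset.range k, inner ℝ (g l) (θ - z l) + inner ℝ (g 0) (z₀ - L.occ x 1 i) := by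
    obtain ⟨k, rfl⟩ : ∃ m, k = m + 1 := ⟨k - 1, by omega⟩
    rw [Finset.sum_range_succ', Finset.sum_range_succ' (fun l => inner ℝ (g l) (θ - z l)), add_assoc]
    refine congrArg₂ _ (Finset.sum_congr rfl fun l _ => ?_) ?_
    · simp [hz]
    · rw [hz0, ← inner_add_right, sub_add_sub_cancel]
  rw [hsplit]
  have : (1 + 1 / (2 * K)) * ∑ l ∈ Finset.range k, ‖g l‖ ^ 2 =
      ∑ l ∈ Finset.range k, ‖g l‖ ^ 2 + (∑ l ∈ Finset.range k, ‖g l‖ ^ 2) / (2 * K) := by ring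
  rw [this]
  linarith

variable {Ω : Type*} [mΩ : MeasurableSpace Ω] {μ : Measure Ω}
  {X : ℕ → Ω → (∀ i, S i) × (∀ i, A i)} {ω : Ω} {b ε ε₁ ε₂ H Λ : ℝ} {lam : Fin n → ℝ}

/-- A sufficient condition, along a fixed path, for the averages to be an approximate equilibrium. -/
lemma dualAveraging_isEpsNash (hδ : ∀ i, 0 < δ i) (hρ₁ : ∀ i, ρ₁ i ∈ G.shrunkPolytope i (δ i))
    (hmax : ∀ i Y, ∃ x ∈ G.shrunkPolytope i (δ i),
      IsMaxOn (fun x => inner ℝ x Y - h i x) (G.shrunkPolytope i (δ i)) x)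
    (hK : 0 < K) (hh : ∀ i, StrongConvexOn (G.shrunkPolytope i (δ i)) K (h i))
    (hG : G.SociallyConcave lam) (hΛ : ∀ i j, lam i ≤ Λ * lam j) (hη : ∀ l, 0 < η (l + 1))
    (hx : ∀ k, ∃ t, (G.dualAveraging d η δ h ρ₁).IsFresh (fun u => X u ω) (k + 1) t) (hb : 0 ≤ b)
    (hbias : ∀ l i p, |(G.dualAveraging d η δ h ρ₁).rewardMean μ X (fun u => X u ω) (l + 1) i p -
      (G.gain i ((G.dualAveraging d η δ h ρ₁).occ (fun u => X u ω) (l + 1)) p - 0)| ≤ b)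
    (hΛb : Λ * (∑ j, min 2 ((Fintype.card (A j) : ℝ) * Fintype.card (S j))) * b ≤ ε / 3)
    {z₀ : ∀ i, OccVec (S i) (A i)} (hz₀ : ∀ i, z₀ i ∈ G.shrunkPolytope i (δ i))
    (hz₀' : ∀ i, ∀ y ∈ G.shrunkPolytope i (δ i), h i (z₀ i) ≤ h i y) {k : ℕ} (hk : 1 ≤ k)
    (hθ : ∀ i, ∀ y ∈ G.polytope i, ∃ θ : ∀ j, OccVec (S j) (A j),
      (∀ j, θ j ∈ G.shrunkPolytope j (δ j)) ∧ ∑ j, (h j (θ j) - h j (z₀ j)) ≤ H ∧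
      ∑ j, lam j * (√((Fintype.card (A j) : ℝ) * Fintype.card (S j)) *
        ‖Function.update ((G.dualAveraging d η δ h ρ₁).avgOcc (fun u => X u ω) k) i y j - θ j‖) ≤
        lam i * (ε / 2 + ε₁))
    (hw : Λ * (H + 2 * n + (1 + 1 / (2 * K)) *
        Scheme.energy ((G.dualAveraging d η δ h ρ₁).noiseTerm μ X)
          ((G.dualAveraging d η δ h ρ₁).rewardEnergy X) k ω) ≤
      (∑ l ∈ Finset.range k, η (l + 1)) * ε₂) (hε : ε₁ + ε₂ ≤ ε / 6) :
    G.IsEpsNash ε ((G.dualAveraging d η δ h ρ₁).avgOcc (fun u => X u ω) k) := by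
  set L := G.dualAveraging d η δ h ρ₁ with hLdef
  set x : ℕ → (∀ i, S i) × (∀ i, A i) := fun u => X u ω with hxdef
  have hL : L.Positive := dualAveraging_positive hδ hρ₁ hmax
  set w := ∑ l ∈ Finset.range k, η (l + 1) with hwdef
  have hw0 : 0 < w := Finset.sum_pos (fun l _ => hη l) (Finset.nonempty_range_iff.2 (by omega))
  have havg : ∀ j, L.avgOcc x k j ∈ G.polytope j := fun j =>
    Scheme.avgOcc_mem (s := G.polytope) G.convex_polytope hη hk (fun l j => hL.occ_mem x (l + 1) j) j
  refine isEpsNash_of_gapSum_le hG.1 havg fun i y hy => ?_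
  obtain ⟨θ, hθs, hθH, hθd⟩ := hθ i y hy
  refine (gapSum_le_add (fun j => (hG.1 j).le) (θ' := θ)
    fun j => G.polytope_subset_occSimplex j (havg j)).trans ?_
  have hJ := Scheme.sum_mul_gapSum_avgOcc_le (L := L) (x := x) hG (fun j => (hθs j).1) hη hk
    fun l j => hL.occ_mem x (l + 1) j
  set M : Fin n → ℝ := fun j => min 2 ((Fintype.card (A j) : ℝ) * Fintype.card (S j)) with hM
  have hM0 : ∀ j, 0 ≤ M j := fun j => le_min two_pos.le (by positivity)
  -- The `2` collects the `1` from the exchanged first iterate and the `1` from the noise bound.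
  set Q : Fin n → ℝ := fun j => (h j (θ j) - h j (z₀ j)) + 2 +
    (1 + 1 / (2 * K)) * L.playerEnergy μ X k j ω + M j * b * w with hQ
  have hE0 : ∀ j, 0 ≤ L.playerEnergy μ X k j ω := fun j => by
    unfold Scheme.playerEnergy; positivity
  have hQ0 : ∀ j, 0 ≤ Q j := fun j => by
    have h1 := hz₀' j (θ j) (hθs j)
    have h2 : 0 ≤ (1 + 1 / (2 * K)) * L.playerEnergy μ X k j ω := mul_nonneg (by positivity) (hE0 j)
    have h3 := mul_nonneg (mul_nonneg (hM0 j) hb) hw0.le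
    simp only [hQ]
    linarith
  have hreg : ∀ j, ∑ l ∈ Finset.range k, η (l + 1) *
      ∑ p, G.gain j (L.occ x (l + 1)) p * (θ j p - L.occ x (l + 1) j p) ≤ Q j := by
    intro j
    have hθj := G.polytope_subset_occSimplex j (hθs j).1
    have h1 := Scheme.sum_gain_le (L := L) (μ := μ) hL hη hb (fun l p => hbias l j p) hθj k
    have h2 := Scheme.neg_sum_noise_le L μ X k ω hθj
    have h3 := dualAveraging_regret hρ₁ hmax hK (hh j) hx hk (hz₀ j) (hz₀' j) (hθs j)
    refine h1.trans ?_
    have h5 : (1 + 1 / (2 * K)) * L.playerEnergy μ X k j ω ≥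
        (∑ p, (∑ l ∈ Finset.range k, L.noiseTerm μ X (.inl ⟨j, p⟩) l ω) ^ 2 +
          (∑ l ∈ Finset.range k, L.noiseTerm μ X (.inr j) l ω) ^ 2) / 2 +
        (1 + 1 / (2 * K)) * ∑ l ∈ Finset.range k, ‖η (l + 1) • L.reward x (l + 1) j‖ ^ 2 := by
      have h6 : 0 ≤ ∑ p, (∑ l ∈ Finset.range k, L.noiseTerm μ X (.inl ⟨j, p⟩) l ω) ^ 2 +
          (∑ l ∈ Finset.range k, L.noiseTerm μ X (.inr j) l ω) ^ 2 := by positivity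
      have h7 : 0 ≤ 1 / (2 * K) := by positivity
      unfold Scheme.playerEnergy
      rw [mul_add]
      refine add_le_add ?_ le_rfl
      nlinarith [mul_nonneg h7 h6]
    simp only [hQ]
    have h8 : (∑ l ∈ Finset.range k, inner ℝ (L.η (l + 1) • L.reward x (l + 1) j)
        (θ j - L.occ x (l + 1) j)) ≤ _ := h3
    have h9 : min 2 ((Fintype.card (A j) : ℝ) * Fintype.card (S j)) * b *
        ∑ l ∈ Finset.range k, L.η (l + 1) = M j * b * w := rfl
    rw [h9]
    linarith
  have hsum : w * G.gapSum lam θ (L.avgOcc x k) ≤ w * (lam i * (ε₂ + ε / 3)) := by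
    refine hJ.trans ?_
    calc _ ≤ ∑ j, lam j * Q j :=
          Finset.sum_le_sum fun j _ => mul_le_mul_of_nonneg_left (hreg j) (hG.1 j).le
      -- The bounds `Q j` are nonnegative, because `z₀ j` minimizes `h j`; only therefore may the
      -- weight of `j` be replaced by the larger `Λ * lam i`.
      _ ≤ ∑ j, Λ * lam i * Q j :=
          Finset.sum_le_sum fun j _ => mul_le_mul_of_nonneg_right (hΛ j i) (hQ0 j)
      _ = lam i * (Λ * (∑ j, (h j (θ j) - h j (z₀ j)) + 2 * n + (1 + 1 / (2 * K)) *
            Scheme.energy (L.noiseTerm μ X) (L.rewardEnergy X) k ω) + Λ * (∑ j, M j) * b * w) := by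
          rw [← Finset.mul_sum, ← Scheme.sum_playerEnergy]
          simp only [hQ, Finset.sum_add_distrib, Finset.sum_const, Finset.card_univ,
            Fintype.card_fin, nsmul_eq_mul, ← Finset.mul_sum, ← Finset.sum_mul]
          ring
      _ ≤ lam i * (w * ε₂ + ε / 3 * w) := by
          refine mul_le_mul_of_nonneg_left (add_le_add (le_trans ?_ hw)
            (mul_le_mul_of_nonneg_right hΛb hw0.le)) (hG.1 i).le
          have hΛ0 : 0 ≤ Λ := by
            by_contra hneg
            have := hΛ i i
            nlinarith [hG.1 i, mul_pos (neg_pos.2 (not_le.1 hneg)) (hG.1 i)]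
          exact mul_le_mul_of_nonneg_left (by linarith) hΛ0
      _ = w * (lam i * (ε₂ + ε / 3)) := by ring
  -- The budget is `ε / 2 + ε₁` for moving the comparator, `ε / 3` for the bias and `ε₂` for the
  -- regret.
  have hfin := le_of_mul_le_mul_left hsum hw0
  have h1 : lam i * (ε₁ + ε₂) ≤ lam i * (ε / 6) := mul_le_mul_of_nonneg_left hε (hG.1 i).le
  linarith

end DualAveraging

end ChainGame

open MeasureTheory Filter Topology

/-! ### Step sizes -/

lemma sq_rpow_neg_half_sub (β : ℝ) (l : ℕ) :
    (((l + 1 : ℕ) : ℝ) ^ (-(1 / 2) - β)) ^ 2 = 1 / ((l + 1 : ℕ) : ℝ) ^ (1 + 2 * β) := by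
  rw [← Real.rpow_natCast, ← Real.rpow_mul (Nat.cast_nonneg _),
    one_div (((l + 1 : ℕ) : ℝ) ^ (1 + 2 * β)),
    ← Real.rpow_neg (Nat.cast_nonneg _)]
  congr 1
  push_cast
  ring

lemma exists_sum_sq_step_le {β : ℝ} (hβ : 0 < β) : ∃ W : ℝ, 0 < W ∧ ∀ k : ℕ,
    ∑ l ∈ Finset.range k, (((l + 1 : ℕ) : ℝ) ^ (-(1 / 2) - β)) ^ 2 ≤ W := by
  have h1 : Summable fun l : ℕ => 1 / ((l + 1 : ℕ) : ℝ) ^ (1 + 2 * β) :=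
    (summable_nat_add_iff 1).2 (Real.summable_one_div_nat_rpow.2 (by linarith))
  have h2 : ∀ l : ℕ, 0 ≤ 1 / ((l + 1 : ℕ) : ℝ) ^ (1 + 2 * β) := fun l => by positivity
  refine ⟨1 + ∑' l : ℕ, 1 / ((l + 1 : ℕ) : ℝ) ^ (1 + 2 * β), ?_, fun k => ?_⟩
  · have := tsum_nonneg (L := SummationFilter.unconditional ℕ) h2
    linarith
  · simp_rw [sq_rpow_neg_half_sub]
    have := h1.sum_le_tsum (Finset.range k) fun l _ => h2 l
    linarith

lemma rpow_le_sum_step {β : ℝ} (hβ : 0 < β) {k : ℕ} (hk : 1 ≤ k) :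
    (k : ℝ) ^ (1 / 2 - β) ≤
      ∑ l ∈ Finset.range k, ((l + 1 : ℕ) : ℝ) ^ (-(1 / 2) - β) := by
  have hk' : (0 : ℝ) < k := Nat.cast_pos.2 hk
  calc (k : ℝ) ^ (1 / 2 - β) = ∑ _l ∈ Finset.range k, (k : ℝ) ^ (-(1 / 2) - β) := by
        rw [Finset.sum_const, Finset.card_range, nsmul_eq_mul]
        nth_rw 2 [← Real.rpow_one (k : ℝ)]
        rw [← Real.rpow_add hk']
        congr 1
        ring
    _ ≤ _ := Finset.sum_le_sum fun l hl => Real.rpow_le_rpow_of_nonpos (by positivity)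
        (Nat.cast_le.2 (Finset.mem_range.1 hl)) (by linarith)

/-- Comparison with the harmonic series. It includes `β = 1 / 2`, where the power bound for the sum
is void; this is why the rates need `β < 1 / 2`. -/
lemma tendsto_sum_step {β : ℝ} (hβ' : β ≤ 1 / 2) : Tendsto (fun k : ℕ =>
    ∑ l ∈ Finset.range k, ((l + 1 : ℕ) : ℝ) ^ (-(1 / 2) - β)) atTop atTop := by
  refine tendsto_atTop_mono (fun k => Finset.sum_le_sum fun l _ => ?_)
    Real.tendsto_sum_range_one_div_nat_succ_atTop
  have h1 : (1 : ℝ) ≤ ((l + 1 : ℕ) : ℝ) := by exact_mod_cast Nat.le_add_left 1 l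
  calc (1 : ℝ) / ((l : ℝ) + 1) = ((l + 1 : ℕ) : ℝ) ^ (-1 : ℝ) := by
        rw [Real.rpow_neg_one, one_div]; push_cast; rfl
    _ ≤ _ := Real.rpow_le_rpow_of_exponent_le h1 (by linarith)

/-- The sum of the steps is at least `k ^ (1 / 2 - β)`, and `2 / (1 - 2 * β)` is the reciprocal of
that exponent. -/
lemma mul_le_sum_step {β c T : ℝ} (hβ : 0 < β) (hβ' : β < 1 / 2) (hc : 0 ≤ c) (hT : 0 ≤ T) {k : ℕ}
    (hk : 1 ≤ k) (h : c ^ (2 / (1 - 2 * β)) * T ^ (2 / (1 - 2 * β)) ≤ k) :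
    c * T ≤ ∑ l ∈ Finset.range k, ((l + 1 : ℕ) : ℝ) ^ (-(1 / 2) - β) := by
  have h0 : 0 < 1 - 2 * β := by linarith
  refine le_trans ?_ (rpow_le_sum_step hβ hk)
  rw [← Real.mul_rpow hc hT] at h
  have h2 := Real.rpow_le_rpow (Real.rpow_nonneg (mul_nonneg hc hT) _) h
    (by linarith : 0 ≤ 1 / 2 - β)
  rw [← Real.rpow_mul (mul_nonneg hc hT)] at h2
  have h3 : 2 / (1 - 2 * β) * (1 / 2 - β) = 1 := by field_simp
  rwa [h3, Real.rpow_one] at h2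

namespace ChainGame

variable {n : ℕ} {S A : Fin n → Type*} [∀ i, Fintype (S i)] [∀ i, Fintype (A i)]
variable {G : ChainGame n S A}

lemma isEpsNash_of_eq_zero (hn : n = 0) (ε : ℝ) (ρ : ∀ j, OccVec (S j) (A j)) : G.IsEpsNash ε ρ :=
  ⟨fun i => absurd i.2 (by omega), fun i => absurd i.2 (by omega)⟩

lemma one_le_ratio {lam : Fin n → ℝ} {Λ : ℝ} (hlam : ∀ i, 0 < lam i)
    (hΛ : ∀ i j, lam i ≤ Λ * lam j) (hn : 0 < n) : 1 ≤ Λ := by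
  have h1 := hΛ ⟨0, hn⟩ ⟨0, hn⟩
  have h2 := hlam ⟨0, hn⟩
  by_contra h
  nlinarith [mul_pos (sub_pos.2 (not_le.1 h)) h2]

lemma Scheme.ratio_mul_bias_le [∀ i, Nonempty (S i)] [∀ i, Nonempty (A i)] {L : G.Scheme}
    {τ ε Λ : ℝ} (h0 : 0 < τ) (hε : 0 < ε) (hn : 0 < n) (hΛ : 0 < Λ)
    (hd : τ * Real.log (6 * n * Λ / ε *
      ∑ i, min 2 ((Fintype.card (A i) : ℝ) * Fintype.card (S i))) ≤ L.d) :
    Λ * (∑ i, min 2 ((Fintype.card (A i) : ℝ) * Fintype.card (S i))) * L.bias τ ≤ ε / 3 := by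
  refine mul_bias_le h0 hε hn (mul_pos hΛ (Finset.sum_pos (fun i _ => lt_min two_pos ?_)
    ⟨⟨0, hn⟩, Finset.mem_univ _⟩)) ?_
  · have := Fintype.card_pos (α := A i)
    have := Fintype.card_pos (α := S i)
    positivity
  · refine le_trans (le_of_eq ?_) hd
    congr 2
    ring

/-- A state marginal is at most one, so a conditional probability is at least the joint one. -/
lemma one_div_policyOf_le [∀ i, Nonempty (S i)] [∀ i, Nonempty (A i)] {i : Fin n} {δ : ℝ}
    (hδ : 0 < δ) {ρ : OccVec (S i) (A i)} (hρ : ρ ∈ G.shrunkPolytope i δ) (s : S i) (a : A i) :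
    1 / policyOf ρ s a ≤ 1 / δ := by
  have hpos : ∀ p, 0 < ρ p := fun p => hδ.trans_le (hρ.2 p)
  refine one_div_le_one_div_of_le hδ ((hρ.2 (s, a)).trans ?_)
  have h1 : ∑ a', ρ (s, a') ≤ 1 := by
    have h2 := stateLaw_mem_stdSimplex hρ.1
    rw [← h2.2]
    exact Finset.single_le_sum (f := stateLaw ρ) (fun s _ => h2.1 s) (Finset.mem_univ s)
  exact (le_div_iff₀ (Finset.sum_pos (fun a' _ => hpos (s, a')) Finset.univ_nonempty)).2
    (mul_le_of_le_one_right (hpos _).le h1)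

/-! ### Dual averaging: almost sure convergence and high-probability rates. -/

section DualAveraging

variable {d : ℕ} {η : ℕ → ℝ} {δ : Fin n → ℝ} {h : ∀ i, OccVec (S i) (A i) → ℝ}
  {ρ₁ : ∀ i, OccVec (S i) (A i)} {K τ W : ℝ} {s₀ : ∀ i, S i}
  {Ω : Type*} [mΩ : MeasurableSpace Ω] {μ : Measure Ω} [IsProbabilityMeasure μ]
  {X : ℕ → Ω → (∀ i, S i) × (∀ i, A i)} [∀ i, Nonempty (S i)] [∀ i, Nonempty (A i)]

lemma dualAveraging_measure_le (hδ : ∀ i, 0 < δ i) (hρ₁ : ∀ i, ρ₁ i ∈ G.shrunkPolytope i (δ i))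
    (hmax : ∀ i Y, ∃ x ∈ G.shrunkPolytope i (δ i),
      IsMaxOn (fun x => inner ℝ x Y - h i x) (G.shrunkPolytope i (δ i)) x)
    (hX : (G.dualAveraging d η δ h ρ₁).IsRun s₀ μ X) (h0 : 0 < τ) (hτ : G.MixesWithin τ) (hn : 0 < n)
    (hW : ∀ k, ∑ l ∈ Finset.range k, η (l + 1) ^ 2 ≤ W) {E : ℝ} (hE : 0 < E) :
    μ {ω | ∃ k, E ≤ Scheme.energy ((G.dualAveraging d η δ h ρ₁).noiseTerm μ X)
      ((G.dualAveraging d η δ h ρ₁).rewardEnergy X) k ω} ≤ ENNReal.ofReal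
      (3 * (∑ i, (Fintype.card (S i) * Fintype.card (A i) : ℝ) / δ i) * W / E) := by
  refine hX.measure_exists_le_energy (dualAveraging_positive hδ hρ₁ hmax) h0 hτ hn le_rfl
    zero_le_one (fun x t => Finset.sum_le_sum fun i _ => ?_)
    (Finset.sum_nonneg fun i _ => div_nonneg (by positivity) (hδ i).le) hW hE
  calc _ ≤ ∑ _p : S i × A i, 1 / δ i := Finset.sum_le_sum fun p _ =>
        one_div_policyOf_le (hδ i) (dualAveraging_memory_mem hρ₁ hmax x t i) p.1 p.2
    _ = _ := by
        rw [Finset.sum_const, Finset.card_univ, Fintype.card_prod, nsmul_eq_mul]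
        push_cast
        ring

/-- An unbounded energy exceeds every level `m + 1`, and the maximal inequality makes the
probability of that of order `1 / (m + 1)`. -/
lemma dualAveraging_ae_energy_lt (hδ : ∀ i, 0 < δ i) (hρ₁ : ∀ i, ρ₁ i ∈ G.shrunkPolytope i (δ i))
    (hmax : ∀ i Y, ∃ x ∈ G.shrunkPolytope i (δ i),
      IsMaxOn (fun x => inner ℝ x Y - h i x) (G.shrunkPolytope i (δ i)) x)
    (hX : (G.dualAveraging d η δ h ρ₁).IsRun s₀ μ X) (h0 : 0 < τ) (hτ : G.MixesWithin τ) (hn : 0 < n)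
    (hW : ∀ k, ∑ l ∈ Finset.range k, η (l + 1) ^ 2 ≤ W) :
    ∀ᵐ ω ∂μ, ∃ E : ℝ, ∀ k, Scheme.energy ((G.dualAveraging d η δ h ρ₁).noiseTerm μ X)
      ((G.dualAveraging d η δ h ρ₁).rewardEnergy X) k ω < E := by
  rw [ae_iff]
  set c := 3 * (∑ i, (Fintype.card (S i) * Fintype.card (A i) : ℝ) / δ i) * W
  have h1 : Tendsto (fun m : ℕ => ENNReal.ofReal (c / (m + 1 : ℕ))) atTop (𝓝 0) := by
    rw [← ENNReal.ofReal_zero]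
    exact ENNReal.tendsto_ofReal ((tendsto_add_atTop_iff_nat 1).2
      (tendsto_const_div_atTop_nhds_zero_nat c))
  refine le_antisymm (ge_of_tendsto' h1 fun m => ?_) zero_le
  refine le_trans (measure_mono fun ω hω => ?_) (dualAveraging_measure_le hδ hρ₁ hmax hX h0 hτ hn hW
    (E := ((m + 1 : ℕ) : ℝ)) (by positivity))
  rw [Set.mem_ofPred_eq] at hω ⊢
  push Not at hω
  exact hω _

variable {ε Λ B : ℝ} {lam : Fin n → ℝ}

/-- Dual averaging almost surely reaches the set of approximate equilibria. -/
lemma dualAveraging_ae_eventually_isEpsNash (hδ : ∀ i, 0 < δ i)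
    (hρ₁ : ∀ i, ρ₁ i ∈ G.shrunkPolytope i (δ i))
    (hmax : ∀ i Y, ∃ x ∈ G.shrunkPolytope i (δ i),
      IsMaxOn (fun x => inner ℝ x Y - h i x) (G.shrunkPolytope i (δ i)) x)
    (hK : 0 < K) (hh : ∀ i, StrongConvexOn (G.shrunkPolytope i (δ i)) K (h i))
    (hG : G.SociallyConcave lam) (hΛ : ∀ i j, lam i ≤ Λ * lam j) (hε : 0 < ε)
    (hd : τ * Real.log (6 * n * Λ / ε *
      ∑ i, min 2 ((Fintype.card (A i) : ℝ) * Fintype.card (S i))) ≤ d)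
    (hshrink : ∀ i, ∀ x ∈ G.polytope i, ∃ y ∈ G.shrunkPolytope i (δ i),
      ‖x - y‖ ≤ ε / (2 * √((Fintype.card (A i) : ℝ) * Fintype.card (S i))))
    (hX : (G.dualAveraging d η δ h ρ₁).IsRun s₀ μ X) (h0 : 0 < τ) (hτ : G.MixesWithin τ) (hn : 0 < n)
    (hη : ∀ l, 0 < η (l + 1)) (hW : ∀ k, ∑ l ∈ Finset.range k, η (l + 1) ^ 2 ≤ W)
    (hηtop : Tendsto (fun k => ∑ l ∈ Finset.range k, η (l + 1)) atTop atTop) :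
    ∀ᵐ ω ∂μ, ∀ᶠ k in atTop,
      G.IsEpsNash ε ((G.dualAveraging d η δ h ρ₁).avgOcc (fun t => X t ω) k) := by
  set L := G.dualAveraging d η δ h ρ₁ with hLdef
  have hL : L.Positive := dualAveraging_positive hδ hρ₁ hmax
  have hΛ1 := one_le_ratio hG.1 hΛ hn
  have hb0 : 0 ≤ L.bias τ := by unfold Scheme.bias; positivity
  set N : Fin n → ℝ := fun j => √((Fintype.card (A j) : ℝ) * Fintype.card (S j)) with hN
  have hN1 : ∀ j, 1 ≤ N j := fun j => by
    rw [hN, Real.one_le_sqrt]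
    exact_mod_cast Nat.mul_pos (Fintype.card_pos (α := A j)) (Fintype.card_pos (α := S j))
  choose z₀ hz₀ hz₀' using fun i => hmax i 0
  have hz₀'' : ∀ i, ∀ y ∈ G.shrunkPolytope i (δ i), h i (z₀ i) ≤ h i y := fun i y hy => by
    simpa using hz₀' i hy
  have hNs : 0 < ∑ j, N j := Finset.sum_pos (fun j _ => one_pos.trans_le (hN1 j))
    ⟨⟨0, hn⟩, Finset.mem_univ _⟩
  -- With this radius, rounding the comparators of all players costs at most `lam i * (ε / 12)` in
  -- total, even after all weights are replaced by `Λ * lam i`.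
  set r : ℝ := ε / 12 / (Λ * ∑ j, N j) with hr
  have hr0 : 0 < r := by positivity
  -- No bound on `h` is assumed here and the comparators vary with `k`; they are rounded to a finite
  -- net, on which `h` is bounded.
  choose T hTs hTfin hTcov using fun j =>
    (G.isCompact_shrunkPolytope j (δ j)).finite_cover_balls hr0
  choose H hH using fun j => ((hTfin j).image (h j)).bddAbove
  filter_upwards [hX.ae_exists_isFresh hL h0 hτ hn,
    dualAveraging_ae_energy_lt hδ hρ₁ hmax hX h0 hτ hn hW] with ω hx ⟨E, hE⟩
  filter_upwards [eventually_ge_atTop 1, hηtop.eventually_ge_atTop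
    (Λ * (∑ j, (H j - h j (z₀ j)) + 2 * n + (1 + 1 / (2 * K)) * E) / (ε / 12))] with k hk hwk
  rw [div_le_iff₀ (by positivity)] at hwk
  refine dualAveraging_isEpsNash (μ := μ) hδ hρ₁ hmax hK hh hG hΛ hη hx hb0
    (fun l i p => ?_) (Scheme.ratio_mul_bias_le h0 hε hn (one_pos.trans_le hΛ1) hd) hz₀ hz₀'' hk
    (H := ∑ j, (H j - h j (z₀ j))) (ε₁ := ε / 12) (ε₂ := ε / 12) ?_ ?_ (by linarith)
  · obtain ⟨t, ht⟩ := hx l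
    exact hX.abs_rewardMean_sub_le hL h0 hτ hn ht p
  · intro i y hy
    obtain ⟨y', hy', hyy'⟩ := hshrink i y hy
    have havg : ∀ j, L.avgOcc (fun t => X t ω) k j ∈ G.shrunkPolytope j (δ j) := fun j =>
      Scheme.avgOcc_mem (s := fun j => G.shrunkPolytope j (δ j))
        (fun j => G.convex_shrunkPolytope j (δ j)) hη hk
        (fun l j => dualAveraging_occ_mem hρ₁ hmax _ (l + 1) j) j
    set v := Function.update (L.avgOcc (fun t => X t ω) k) i y' with hv
    have hvs : ∀ j, v j ∈ G.shrunkPolytope j (δ j) := fun j => by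
      by_cases hj : j = i
      · subst hj; rw [hv, Function.update_self]; exact hy'
      · rw [hv, Function.update_of_ne hj]; exact havg j
    have hnet : ∀ j, ∃ f ∈ T j, ‖v j - f‖ ≤ r := fun j => by
      obtain ⟨f, hf, hfv⟩ := Set.mem_iUnion₂.1 (hTcov j (hvs j))
      exact ⟨f, hf, by rw [← dist_eq_norm]; exact (Metric.mem_ball.1 hfv).le⟩
    choose θ hθT hθr using hnet
    refine ⟨θ, fun j => hTs j (hθT j), Finset.sum_le_sum fun j _ =>
      sub_le_sub_right (hH j ⟨θ j, hθT j, rfl⟩) _, ?_⟩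
    -- Only player `i` pays `ε / 2` for entering the shrunk polytope. The averages of the others
    -- already lie in it, and they pay for the rounding alone.
    have hle : ∀ j, lam j * (N j *
        ‖Function.update (L.avgOcc (fun t => X t ω) k) i y j - θ j‖) ≤
        (if j = i then lam i * (ε / 2) else 0) + Λ * lam i * (N j * r) := by
      intro j
      have hlast : lam j * (N j * r) ≤ Λ * lam i * (N j * r) :=
        mul_le_mul_of_nonneg_right (hΛ j i) (by have := hN1 j; positivity)
      refine le_trans ?_ (add_le_add_right hlast _)
      by_cases hj : j = i
      · subst hj
        rw [if_pos rfl, ← mul_add, Function.update_self]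
        refine mul_le_mul_of_nonneg_left ?_ (hG.1 j).le
        have h1 : ‖y - θ j‖ ≤ ε / (2 * N j) + r := by
          refine (norm_sub_le_norm_sub_add_norm_sub y y' (θ j)).trans (add_le_add hyy' ?_)
          have := hθr j
          rwa [hv, Function.update_self] at this
        refine (mul_le_mul_of_nonneg_left h1 (one_pos.trans_le (hN1 j)).le).trans (le_of_eq ?_)
        have := (one_pos.trans_le (hN1 j)).ne'
        rw [mul_add]
        congr 1
        field_simp
      · rw [if_neg hj, zero_add, Function.update_of_ne hj]
        refine mul_le_mul_of_nonneg_left (mul_le_mul_of_nonneg_left ?_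
          (one_pos.trans_le (hN1 j)).le) (hG.1 j).le
        have := hθr j
        rwa [hv, Function.update_of_ne hj] at this
    refine (Finset.sum_le_sum fun j _ => hle j).trans (le_of_eq ?_)
    rw [Finset.sum_add_distrib, Finset.sum_ite_eq' Finset.univ i, if_pos (Finset.mem_univ _),
      ← Finset.mul_sum, ← Finset.sum_mul, hr]
    field_simp
  · refine le_trans (mul_le_mul_of_nonneg_left ?_ (one_pos.trans_le hΛ1).le) hwk
    have : (1 + 1 / (2 * K)) * Scheme.energy (L.noiseTerm μ X) (L.rewardEnergy X) k ω ≤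
        (1 + 1 / (2 * K)) * E := mul_le_mul_of_nonneg_left (hE k).le (by positivity)
    linarith

/-- With high probability, dual averaging is at an approximate equilibrium as soon as the sum of the
step sizes is large enough. -/
lemma dualAveraging_le_measure_isEpsNash (hδ : ∀ i, 0 < δ i)
    (hρ₁ : ∀ i, ρ₁ i ∈ G.shrunkPolytope i (δ i))
    (hmax : ∀ i Y, ∃ x ∈ G.shrunkPolytope i (δ i),
      IsMaxOn (fun x => inner ℝ x Y - h i x) (G.shrunkPolytope i (δ i)) x)
    (hK : 0 < K) (hh : ∀ i, StrongConvexOn (G.shrunkPolytope i (δ i)) K (h i))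
    (hG : G.SociallyConcave lam) (hΛ : ∀ i j, lam i ≤ Λ * lam j) (hε : 0 < ε)
    (hd : τ * Real.log (6 * n * Λ / ε *
      ∑ i, min 2 ((Fintype.card (A i) : ℝ) * Fintype.card (S i))) ≤ d)
    (hshrink : ∀ i, ∀ x ∈ G.polytope i, ∃ y ∈ G.shrunkPolytope i (δ i),
      ‖x - y‖ ≤ ε / (2 * √((Fintype.card (A i) : ℝ) * Fintype.card (S i))))
    (hX : (G.dualAveraging d η δ h ρ₁).IsRun s₀ μ X) (h0 : 0 < τ) (hτ : G.MixesWithin τ) (hn : 0 < n)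
    (hη : ∀ l, 0 < η (l + 1)) (hW : ∀ k, ∑ l ∈ Finset.range k, η (l + 1) ^ 2 ≤ W) (hW0 : 0 < W)
    (hB : ∀ i, ∀ x ∈ G.shrunkPolytope i (δ i), ∀ y ∈ G.shrunkPolytope i (δ i),
      h i x - h i y ≤ B * (Fintype.card (S i) * Fintype.card (A i))) {α : ℝ} (hα : 0 < α)
    (hα1 : α < 1) :
    ENNReal.ofReal (1 - α) ≤ μ {ω | ∀ k : ℕ, 1 ≤ k →
      6 * Λ * (|B| + 2 + (1 + 1 / (2 * K)) * (3 * W)) *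
        (∑ i, (n * Fintype.card (S i) * Fintype.card (A i) : ℝ) / (α * ε * δ i)) ≤
        ∑ l ∈ Finset.range k, η (l + 1) →
      G.IsEpsNash ε ((G.dualAveraging d η δ h ρ₁).avgOcc (fun t => X t ω) k)} := by
  set L := G.dualAveraging d η δ h ρ₁ with hLdef
  have hL : L.Positive := dualAveraging_positive hδ hρ₁ hmax
  have hΛ1 := one_le_ratio hG.1 hΛ hn
  have hΛ0 : 0 < Λ := one_pos.trans_le hΛ1
  have hb0 : 0 ≤ L.bias τ := by unfold Scheme.bias; positivity
  have hn1 : (1 : ℝ) ≤ n := by exact_mod_cast hn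
  choose z₀ hz₀ hz₀' using fun i => hmax i 0
  have hz₀'' : ∀ i, ∀ y ∈ G.shrunkPolytope i (δ i), h i (z₀ i) ≤ h i y := fun i y hy => by
    simpa using hz₀' i hy
  have hN1 : ∀ i, (1 : ℝ) ≤ Fintype.card (S i) * Fintype.card (A i) := fun i => by
    exact_mod_cast Nat.mul_pos (Fintype.card_pos (α := S i)) (Fintype.card_pos (α := A i))
  set V := ∑ i, (Fintype.card (S i) * Fintype.card (A i) : ℝ) / δ i with hV
  have hV0 : 0 < V := Finset.sum_pos (fun i _ => div_pos (one_pos.trans_le (hN1 i)) (hδ i))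
    ⟨⟨0, hn⟩, Finset.mem_univ _⟩
  -- Since `δ i ≤ 1` and `α < 1`, the quantity `V / α` dominates all the terms that are free of `δ`
  -- and `α`.
  have hNV : ∑ i, (Fintype.card (S i) * Fintype.card (A i) : ℝ) ≤ V / α := by
    have h1 : ∑ i, (Fintype.card (S i) * Fintype.card (A i) : ℝ) ≤ V :=
      Finset.sum_le_sum fun i _ => by
        have hδ1 : δ i ≤ 1 := by
          obtain ⟨p⟩ : Nonempty (S i × A i) := inferInstance
          exact ((hρ₁ i).2 p).trans
            (le_one_of_mem_occSimplex (G.polytope_subset_occSimplex i (hρ₁ i).1) p)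
        rw [le_div_iff₀ (hδ i)]
        exact mul_le_of_le_one_right (zero_le_one.trans (hN1 i)) hδ1
    refine h1.trans ?_
    rw [le_div_iff₀ hα]
    exact mul_le_of_le_one_right hV0.le hα1.le
  have hnN : (n : ℝ) ≤ ∑ i, (Fintype.card (S i) * Fintype.card (A i) : ℝ) := by
    have := Finset.sum_le_sum fun i (_ : i ∈ Finset.univ) => hN1 i
    simpa using this
  -- This level makes the bound of the maximal inequality equal to `α`.
  set E : ℝ := 3 * V * W / α with hEdef
  have hE : 0 < E := by positivity
  have hmeas := dualAveraging_measure_le hδ hρ₁ hmax hX h0 hτ hn hW hE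
  rw [← hV, hEdef, div_div_cancel₀ (by positivity)] at hmeas
  set bad := {ω | ∃ k, E ≤ Scheme.energy (L.noiseTerm μ X) (L.rewardEnergy X) k ω} with hbad
  -- Subadditivity is enough, so measurability of `bad` plays no role.
  have h1 : ENNReal.ofReal (1 - α) ≤ μ badᶜ := by
    have h2 : (1 : ENNReal) ≤ μ bad + μ badᶜ := by
      rw [← measure_univ (μ := μ), ← Set.union_compl_self bad]
      exact measure_union_le _ _
    rw [ENNReal.ofReal_sub _ hα.le, ENNReal.ofReal_one]
    exact tsub_le_iff_left.2 (h2.trans (add_le_add hmeas le_rfl))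
  refine h1.trans (measure_mono_ae ?_)
  filter_upwards [hX.ae_exists_isFresh hL h0 hτ hn] with ω hx hω k hk hwk
  have hω' : ∀ k, Scheme.energy (L.noiseTerm μ X) (L.rewardEnergy X) k ω < E := fun k => by
    by_contra hcon
    exact hω ⟨k, not_lt.1 hcon⟩
  refine dualAveraging_isEpsNash (μ := μ) hδ hρ₁ hmax hK hh hG hΛ hη hx hb0
    (fun l i p => ?_) (Scheme.ratio_mul_bias_le h0 hε hn hΛ0 hd) hz₀ hz₀'' hk
    (H := |B| * ∑ i, (Fintype.card (S i) * Fintype.card (A i) : ℝ)) (ε₁ := 0) (ε₂ := ε / 6) ?_ ?_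
    (by linarith)
  · obtain ⟨t, ht⟩ := hx l
    exact hX.abs_rewardMean_sub_le hL h0 hτ hn ht p
  · intro i y hy
    obtain ⟨y', hy', hyy'⟩ := hshrink i y hy
    have havg : ∀ j, L.avgOcc (fun t => X t ω) k j ∈ G.shrunkPolytope j (δ j) := fun j =>
      Scheme.avgOcc_mem (s := fun j => G.shrunkPolytope j (δ j))
        (fun j => G.convex_shrunkPolytope j (δ j)) hη hk
        (fun l j => dualAveraging_occ_mem hρ₁ hmax _ (l + 1) j) j
    have hvs : ∀ j, Function.update (L.avgOcc (fun t => X t ω) k) i y' j ∈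
        G.shrunkPolytope j (δ j) := fun j => by
      by_cases hj : j = i
      · subst hj; rw [Function.update_self]; exact hy'
      · rw [Function.update_of_ne hj]; exact havg j
    -- The regularizer is now bounded on the whole shrunk polytope, so no rounding is needed and `ε₁
    -- = 0`.
    refine ⟨Function.update (L.avgOcc (fun t => X t ω) k) i y', hvs, ?_, ?_⟩
    · rw [Finset.mul_sum]
      refine Finset.sum_le_sum fun j _ => (hB j _ (hvs j) _ (hz₀ j)).trans ?_
      exact mul_le_mul_of_nonneg_right (le_abs_self B) (by positivity)
    · rw [Finset.sum_eq_single i]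
      · rw [Function.update_self, Function.update_self, add_zero]
        refine mul_le_mul_of_nonneg_left ?_ (hG.1 i).le
        have hs : 0 < √((Fintype.card (A i) : ℝ) * Fintype.card (S i)) :=
          Real.sqrt_pos.2 (by rw [mul_comm]; exact one_pos.trans_le (hN1 i))
        refine (mul_le_mul_of_nonneg_left hyy' hs.le).trans (le_of_eq ?_)
        field_simp
      · intro j _ hj
        rw [Function.update_of_ne hj, Function.update_of_ne hj, sub_self, norm_zero, mul_zero,
          mul_zero]
      · exact fun hi => absurd (Finset.mem_univ i) hi
  · have h3 : ∑ i, (n * Fintype.card (S i) * Fintype.card (A i) : ℝ) / (α * ε * δ i) =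
        n * (V / α) / ε := by
      rw [hV, Finset.sum_div, Finset.mul_sum, Finset.sum_div]
      refine Finset.sum_congr rfl fun i _ => ?_
      have := (hδ i).ne'
      field_simp
    rw [h3] at hwk
    have hT0 : 0 < V / α := by positivity
    have h4 : |B| * ∑ i, (Fintype.card (S i) * Fintype.card (A i) : ℝ) + 2 * n +
        (1 + 1 / (2 * K)) * Scheme.energy (L.noiseTerm μ X) (L.rewardEnergy X) k ω ≤
        (|B| + 2 + (1 + 1 / (2 * K)) * (3 * W)) * (V / α) := by
      have h5 := mul_le_mul_of_nonneg_left hNV (abs_nonneg B)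
      have h6 : (1 + 1 / (2 * K)) * Scheme.energy (L.noiseTerm μ X) (L.rewardEnergy X) k ω ≤
        (1 + 1 / (2 * K)) * E := mul_le_mul_of_nonneg_left (hω' k).le (by positivity)
      have h7 : E = 3 * W * (V / α) := by rw [hEdef]; ring
      rw [h7] at h6
      have h8 := hnN.trans hNV
      linarith
    have hC0 : 0 ≤ |B| + 2 + (1 + 1 / (2 * K)) * (3 * W) := by positivity
    refine (mul_le_mul_of_nonneg_left h4 hΛ0.le).trans ?_
    refine le_trans ?_ (mul_le_mul_of_nonneg_right hwk (by positivity : 0 ≤ ε / 6))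
    -- The regret bound needs no factor `n`; the one in the hypothesis is discarded by `1 ≤ n`.
    have h9 : 6 * Λ * (|B| + 2 + (1 + 1 / (2 * K)) * (3 * W)) * (n * (V / α) / ε) * (ε / 6) =
        n * (Λ * ((|B| + 2 + (1 + 1 / (2 * K)) * (3 * W)) * (V / α))) := by field_simp
    rw [h9]
    exact le_mul_of_one_le_left (mul_nonneg hΛ0.le (mul_nonneg hC0 hT0.le)) hn1

end DualAveraging

end ChainGame

open MeasureTheory Filter Topology

namespace ChainGame

variable {n : ℕ} {S A : Fin n → Type*} [∀ i, Fintype (S i)] [∀ i, Fintype (A i)]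
variable {G : ChainGame n S A}

namespace Scheme

variable {L : G.Scheme} {s₀ : ∀ i, S i} {Ω : Type*} [mΩ : MeasurableSpace Ω] {μ : Measure Ω}
  {X : ℕ → Ω → (∀ i, S i) × (∀ i, A i)} {x : ℕ → (∀ i, S i) × (∀ i, A i)} {τ : ℝ} {i : Fin n}

/-! ### Expectations along a run -/

lemma reward_nonpos [∀ i, Nonempty (A i)] (hL : L.Positive) (hs : 1 ≤ L.shift)
    (x : ℕ → (∀ i, S i) × (∀ i, A i)) (k : ℕ) (p : S i × A i) : L.reward x k i p ≤ 0 := by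
  simp only [reward, sampled]
  rcases sampledUpTo_eq (L := L) (L.weightedReward i (L.occ x k i) p) x k i p.1
    (L.freshTime x (k + 1)) with ⟨u, -, -, h⟩ | ⟨-, h⟩
  · rw [h]
    unfold weightedReward
    split_ifs
    · exact div_nonpos_of_nonpos_of_nonneg (by linarith [G.r_le_one i (x u).1 (x u).2])
        (policyOf_pos (hL.occ_pos x k i) _ _).le
    · exact le_rfl
  · rw [h]

variable [IsProbabilityMeasure μ]

lemma integrable_noiseTerm (hX : ∀ t z, MeasurableSet {ω | X t ω = z}) (hL : L.Positive)
    (q : (Σ i, S i × A i) ⊕ Fin n) (l : ℕ) : Integrable (L.noiseTerm μ X q l) μ :=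
  integrable_of_measurable_of_bound (measurable_noiseTerm hX q l) (exists_abs_noiseTerm_le hL q l)

lemma integrable_occ (hX : ∀ t z, MeasurableSet {ω | X t ω = z}) (hL : L.Positive) (l : ℕ)
    (i : Fin n) (p : S i × A i) :
    Integrable (fun ω => L.occ (fun u => X u ω) (l + 1) i p) μ :=
  integrable_of_measurable_of_bound (measurable_occ hX l i p) ⟨1, fun ω => by
    rw [abs_of_pos (hL.occ_pos _ _ _ _)]
    exact le_one_of_mem_occSimplex (hL.occ_mem_occSimplex _ _ _) p⟩

lemma integrable_occ_mul_reward_sq (hX : ∀ t z, MeasurableSet {ω | X t ω = z}) (hL : L.Positive)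
    (l : ℕ) (i : Fin n) (p : S i × A i) : Integrable (fun ω =>
      L.occ (fun u => X u ω) (l + 1) i p * L.reward (fun u => X u ω) (l + 1) i p ^ 2) μ := by
  refine (integrable_reward_sq hX l i p).bdd_mul (c := 1)
    (integrable_occ hX hL l i p).aestronglyMeasurable (Eventually.of_forall fun ω => ?_)
  rw [Real.norm_eq_abs, abs_of_pos (hL.occ_pos _ _ _ _)]
  exact le_one_of_mem_occSimplex (hL.occ_mem_occSimplex _ _ _) p

lemma integrable_avgOcc (hX : ∀ t z, MeasurableSet {ω | X t ω = z}) (hL : L.Positive) (k : ℕ)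
    (i : Fin n) : Integrable (fun ω => L.avgOcc (fun u => X u ω) k i) μ := by
  simp only [avgOcc_eq, Finset.sum_apply, Pi.smul_apply]
  refine integrable_finsetSum _ fun l _ => ?_
  have h : Integrable (fun ω => L.occ (fun u => X u ω) (l + 1) i) μ :=
    Integrable.of_eval_piLp fun p => integrable_occ hX hL l i p
  exact h.smul (L.η (l + 1) / ∑ j ∈ Finset.range k, L.η (j + 1))

variable [∀ i, Nonempty (S i)] [∀ i, Nonempty (A i)]

lemma IsRun.integral_noiseTerm (hX : L.IsRun s₀ μ X) (hL : L.Positive) (h0 : 0 < τ)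
    (hτ : G.MixesWithin τ) (hn : 0 < n) (q : (Σ i, S i × A i) ⊕ Fin n) (l : ℕ) :
    ∫ ω, L.noiseTerm μ X q l ω ∂μ = 0 := by
  have hae : ∀ᵐ ω ∂μ, ∃ t, L.IsFresh (fun v => X v ω) (l + 1) t :=
    (hX.ae_exists_isFresh hL h0 hτ hn).mono fun ω h => h l
  have hi := integrable_noiseTerm (μ := μ) hX.measurable hL q l
  have h1 := integral_le_of_isFresh hX.measurable hae hi (integrable_zero Ω ℝ μ)
    fun x t hf => by rw [setIntegral_noiseTerm hX.measurable hL hf]; simp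
  have h2 := integral_le_of_isFresh hX.measurable hae (integrable_zero Ω ℝ μ) hi
    fun x t hf => by rw [setIntegral_noiseTerm hX.measurable hL hf]; simp
  simp only [Pi.zero_apply, integral_zero] at h1 h2
  exact le_antisymm h1 h2

/-- The local second moment of the importance-weighted rewards. -/
lemma IsRun.integral_occ_mul_reward_sq_le (hX : L.IsRun s₀ μ X) (hL : L.Positive) (h0 : 0 < τ)
    (hτ : G.MixesWithin τ) (hn : 0 < n) (hs0 : 0 ≤ L.shift) (hs1 : L.shift ≤ 1) (l : ℕ)
    (i : Fin n) :
    ∫ ω, ∑ p, L.occ (fun u => X u ω) (l + 1) i p * L.reward (fun u => X u ω) (l + 1) i p ^ 2 ∂μ ≤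
      Fintype.card (A i) := by
  have hm := hX.measurable
  have hae : ∀ᵐ ω ∂μ, ∃ t, L.IsFresh (fun v => X v ω) (l + 1) t :=
    (hX.ae_exists_isFresh hL h0 hτ hn).mono fun ω h => h l
  have h1 := integral_le_of_isFresh hm hae
    (f := fun ω => ∑ p, L.occ (fun u => X u ω) (l + 1) i p *
      L.reward (fun u => X u ω) (l + 1) i p ^ 2)
    (integrable_finsetSum _ fun p _ => integrable_occ_mul_reward_sq hm hL l i p)
    (integrable_const (Fintype.card (A i) : ℝ)) fun x t hf => ?_
  · simpa using h1
  · rw [setIntegral_congr_fun (g := fun ω => ∑ p, (L.memory x t).ρ i p *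
      L.reward (fun u => X u ω) (l + 1) i p ^ 2) (measurableSet_cylinder hm x t) fun ω hω => by
        have := determined_occ (l + 1) x _ t hf fun u hu => (hω u hu).symm
        simp only at this ⊢
        rw [← this, hf.occ_eq],
      integral_finsetSum _ fun p _ => ((integrable_reward_sq hm l i p).const_mul _).integrableOn,
      setIntegral_const, smul_eq_mul]
    have hρ := (hL x t i).2
    -- Dividing an occupation measure by its policy leaves the state marginal; summed over the
    -- actions too, this is the number of actions, free of any lower bound on the measure.
    have hsum : ∑ p : S i × A i, (L.memory x t).ρ i p *
        (1 / policyOf ((L.memory x t).ρ i) p.1 p.2) = Fintype.card (A i) := by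
      have h2 : ∀ p : S i × A i, (L.memory x t).ρ i p *
          (1 / policyOf ((L.memory x t).ρ i) p.1 p.2) = stateLaw ((L.memory x t).ρ i) p.1 :=
        fun p => by
          have h3 := stateLaw_mul_policyOf hρ p.1 p.2
          rw [mul_one_div, div_eq_iff (policyOf_pos hρ _ _).ne']
          exact h3.symm
      simp_rw [h2]
      rw [Fintype.sum_prod_type]
      simp only [Finset.sum_const, Finset.card_univ, nsmul_eq_mul]
      rw [← Finset.mul_sum, (stateLaw_mem_stdSimplex (hL x t i).1).2, mul_one]
    rw [← hsum, Finset.mul_sum]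
    refine Finset.sum_le_sum fun p _ => ?_
    rw [integral_const_mul]
    have h4 := mul_le_mul_of_nonneg_left
      (hX.setIntegral_reward_sq_le hL h0 hτ hn hf hs0 hs1 p) (hρ p).le
    linarith

end Scheme

/-! ### Mirror descent in expectation. -/

section MirrorDescent

variable {d : ℕ} {η : ℕ → ℝ} {ρ₁ : ∀ i, OccVec (S i) (A i)}
  {x : ℕ → (∀ i, S i) × (∀ i, A i)} {i : Fin n}
  [∀ i, Nonempty (S i)] [∀ i, Nonempty (A i)]

lemma klMirrorDescent_positive (hρ₁ : ∀ i, ρ₁ i ∈ G.polytope i) (hpos : ∀ i p, 0 < ρ₁ i p) :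
    (G.klMirrorDescent d η ρ₁).Positive := by
  intro x t i
  induction t with
  | zero => exact ⟨hρ₁ i, hpos i⟩
  | succ t ih =>
    by_cases he : ∀ i, ((G.klMirrorDescent d η ρ₁).sampledMemory x t).todo i = ∅
    · rw [Scheme.memory_succ_of_end he]
      have h1 : ((G.klMirrorDescent d η ρ₁).sampledMemory x t).ρ i =
          ((G.klMirrorDescent d η ρ₁).memory x t).ρ i := by
        rw [Scheme.sampledMemory, Scheme.sample_ρ]
      have h2 := fun y => mirrorStep_spec (G.convex_polytope i) (G.isCompact_polytope i)
        (G.polytope_subset_occSimplex i) ih.1 ih.2 y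
      simp only [klMirrorDescent]
      exact ⟨(h2 _).1, (h2 _).2.1⟩
    · rw [Scheme.memory_succ_of_not_end he, Scheme.sampledMemory, Scheme.sample_ρ]
      exact ih

/-- The regret of mirror descent along a fixed path. -/
lemma klMirrorDescent_regret (hρ₁ : ∀ i, ρ₁ i ∈ G.polytope i) (hpos : ∀ i p, 0 < ρ₁ i p)
    (hη : ∀ l, 0 < η (l + 1))
    (hx : ∀ k, ∃ t, (G.klMirrorDescent d η ρ₁).IsFresh x (k + 1) t) (k : ℕ)
    {θ : OccVec (S i) (A i)} (hθ : θ ∈ G.polytope i) :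
    ∑ l ∈ Finset.range k, inner ℝ (η (l + 1) • (G.klMirrorDescent d η ρ₁).reward x (l + 1) i)
      (θ - (G.klMirrorDescent d η ρ₁).occ x (l + 1) i) ≤
    klDivergence θ (ρ₁ i) + ∑ l ∈ Finset.range k, η (l + 1) ^ 2 / 2 *
      ∑ p, (G.klMirrorDescent d η ρ₁).occ x (l + 1) i p *
        (G.klMirrorDescent d η ρ₁).reward x (l + 1) i p ^ 2 := by
  set L := G.klMirrorDescent d η ρ₁ with hLdef
  have hL : L.Positive := klMirrorDescent_positive hρ₁ hpos
  -- The divergence from the next iterate is retained so that the one-step inequalities telescope;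
  -- it is nonnegative and dropped at the end.
  have key : ∑ l ∈ Finset.range k, inner ℝ (η (l + 1) • L.reward x (l + 1) i)
      (θ - L.occ x (l + 1) i) ≤ klDivergence θ (ρ₁ i) - klDivergence θ (L.occ x (k + 1) i) +
      ∑ l ∈ Finset.range k, η (l + 1) ^ 2 / 2 *
        ∑ p, L.occ x (l + 1) i p * L.reward x (l + 1) i p ^ 2 := by
    induction k with
    | zero =>
      rw [Finset.sum_range_zero, Finset.sum_range_zero, Scheme.occ_one]
      exact (add_zero (klDivergence θ (ρ₁ i) - klDivergence θ (ρ₁ i))).symm ▸ (sub_self _).ge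
    | succ k ih =>
      rw [Finset.sum_range_succ, Finset.sum_range_succ]
      obtain ⟨t, ht⟩ := hx (k + 1)
      have h1 := Scheme.occ_succ ht i
      have h2 := (mirrorStep_spec (G.convex_polytope i) (G.isCompact_polytope i)
        (G.polytope_subset_occSimplex i) (hL.occ_mem x (k + 1) i) (hL.occ_pos x (k + 1) i)
        (η (k + 1) • L.reward x (k + 1) i)).2.2 (fun p => by
          rw [PiLp.smul_apply, smul_eq_mul]
          exact mul_nonpos_of_nonneg_of_nonpos (hη k).le
            (Scheme.reward_nonpos hL le_rfl x (k + 1) p)) θ hθ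
      have h3 : L.occ x (k + 2) i = argmaxOn (G.polytope i) (fun x' => - klDivergence x'
          (argmaxOn (occSimplex (S i) (A i)) (fun x' => inner ℝ (η (k + 1) • L.reward x (k + 1) i) x' -
            klDivergence x' (L.occ x (k + 1) i)))) := h1
      rw [← h3] at h2
      have h4 : (∑ p, L.occ x (k + 1) i p * (η (k + 1) • L.reward x (k + 1) i) p ^ 2) / 2 =
          η (k + 1) ^ 2 / 2 * ∑ p, L.occ x (k + 1) i p * L.reward x (k + 1) i p ^ 2 := by
        rw [Finset.mul_sum, Finset.sum_div]
        refine Finset.sum_congr rfl fun p _ => ?_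
        rw [PiLp.smul_apply, smul_eq_mul]
        ring
      rw [h4] at h2
      rw [inner_eq_sum]
      simp only [PiLp.sub_apply]
      linarith
  have hnn := klDivergence_nonneg (G.polytope_subset_occSimplex i hθ)
    (hL.occ_mem_occSimplex x (k + 1) i) (hL.occ_pos x (k + 1) i)
  linarith

variable {Ω : Type*} [mΩ : MeasurableSpace Ω] {μ : Measure Ω} [IsProbabilityMeasure μ]
  {X : ℕ → Ω → (∀ i, S i) × (∀ i, A i)} {s₀ : ∀ i, S i} {τ ε Λ B W : ℝ} {lam : Fin n → ℝ}

/-- The expected averages of mirror descent are an approximate equilibrium as soon as the sum of the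
step sizes is large enough. -/
lemma klMirrorDescent_isEpsNash (hρ₁ : ∀ i, ρ₁ i ∈ G.polytope i) (hpos : ∀ i p, 0 < ρ₁ i p)
    (hG : G.SociallyConcave lam) (hΛ : ∀ i j, lam i ≤ Λ * lam j) (hε : 0 < ε)
    (hd : τ * Real.log (6 * n * Λ / ε *
      ∑ i, min 2 ((Fintype.card (A i) : ℝ) * Fintype.card (S i))) ≤ d)
    (hX : (G.klMirrorDescent d η ρ₁).IsRun s₀ μ X) (h0 : 0 < τ) (hτ : G.MixesWithin τ) (hn : 0 < n)
    (hη : ∀ l, 0 < η (l + 1)) (hW : ∀ k, ∑ l ∈ Finset.range k, η (l + 1) ^ 2 ≤ W) (hW0 : 0 < W)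
    (hB : ∀ i, ∀ θ ∈ G.polytope i, klDivergence θ (ρ₁ i) ≤
      B * Real.log (Fintype.card (S i) * Fintype.card (A i))) {k : ℕ} (hk : 1 ≤ k)
    (hw : 2 * Λ * (|B| + W) * (∑ i, (Real.log (Fintype.card (S i) * Fintype.card (A i))
      + Fintype.card (A i)) / ε) ≤ ∑ l ∈ Finset.range k, η (l + 1)) :
    G.IsEpsNash ε (fun i => ∫ ω, (G.klMirrorDescent d η ρ₁).avgOcc (fun t => X t ω) k i ∂μ) := by
  set L := G.klMirrorDescent d η ρ₁ with hLdef
  have hL : L.Positive := klMirrorDescent_positive hρ₁ hpos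
  have hm := hX.measurable
  have hΛ1 := one_le_ratio hG.1 hΛ hn
  have hΛ0 : 0 < Λ := one_pos.trans_le hΛ1
  have hb0 : 0 ≤ L.bias τ := by unfold Scheme.bias; positivity
  set w := ∑ l ∈ Finset.range k, η (l + 1) with hwdef
  have hw0 : 0 < w := Finset.sum_pos (fun l _ => hη l) (Finset.nonempty_range_iff.2 (by omega))
  have havg : ∀ ω j, L.avgOcc (fun t => X t ω) k j ∈ G.polytope j := fun ω j =>
    Scheme.avgOcc_mem (s := G.polytope) G.convex_polytope hη hk (fun l j => hL.occ_mem _ (l + 1) j) j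
  have hiavg : ∀ j, Integrable (fun ω => L.avgOcc (fun t => X t ω) k j) μ := fun j =>
    Scheme.integrable_avgOcc hm hL k j
  set ρ : ∀ j, OccVec (S j) (A j) := fun j => ∫ ω, L.avgOcc (fun t => X t ω) k j ∂μ with hρdef
  have hρ : ∀ j, ρ j ∈ G.polytope j := fun j => (G.convex_polytope j).integral_mem
    (G.isClosed_polytope j) (Eventually.of_forall fun ω => havg ω j) (hiavg j)
  have hlog : ∀ j, 0 ≤ Real.log (Fintype.card (S j) * Fintype.card (A j)) := fun j =>
    Real.log_nonneg (by
      exact_mod_cast Nat.mul_pos (Fintype.card_pos (α := S j)) (Fintype.card_pos (α := A j)))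
  refine isEpsNash_of_gapSum_le hG.1 hρ fun i y hy => ?_
  -- The comparator is built from the expected average, hence deterministic. No uniform control of
  -- the noise is required.
  set θ := Function.update ρ i y with hθdef
  have hθ : ∀ j, θ j ∈ G.polytope j := fun j => by
    by_cases hj : j = i
    · subst hj; rw [hθdef, Function.update_self]; exact hy
    · rw [hθdef, Function.update_of_ne hj]; exact hρ j
  set M : Fin n → ℝ := fun j => min 2 ((Fintype.card (A j) : ℝ) * Fintype.card (S j)) with hM
  set q : Fin n → ℕ → Ω → ℝ := fun j l ω => ∑ p, L.occ (fun u => X u ω) (l + 1) j p *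
    L.reward (fun u => X u ω) (l + 1) j p ^ 2 with hq
  set ν : Fin n → Ω → ℝ := fun j ω =>
    ∑ p, θ j p * (∑ l ∈ Finset.range k, L.noiseTerm μ X (.inl ⟨j, p⟩) l ω) -
      ∑ l ∈ Finset.range k, L.noiseTerm μ X (.inr j) l ω with hν
  set F : Ω → ℝ := fun ω => ∑ j, lam j * (klDivergence (θ j) (ρ₁ j) +
    ∑ l ∈ Finset.range k, η (l + 1) ^ 2 / 2 * q j l ω - ν j ω + M j * L.bias τ * w) with hF
  have hqi : ∀ j l, Integrable (q j l) μ := fun j l =>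
    integrable_finsetSum _ fun p _ => Scheme.integrable_occ_mul_reward_sq hm hL l j p
  have hνi1 : ∀ j, Integrable (fun ω =>
      ∑ p, θ j p * (∑ l ∈ Finset.range k, L.noiseTerm μ X (.inl ⟨j, p⟩) l ω)) μ := fun j =>
    integrable_finsetSum _ fun p _ => (integrable_finsetSum _ fun l _ =>
      Scheme.integrable_noiseTerm hm hL _ l).const_mul _
  have hνi2 : ∀ j, Integrable (fun ω =>
      ∑ l ∈ Finset.range k, L.noiseTerm μ X (.inr j) l ω) μ := fun j =>
    integrable_finsetSum _ fun l _ => Scheme.integrable_noiseTerm hm hL _ l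
  have hνi : ∀ j, Integrable (ν j) μ := fun j => (hνi1 j).sub (hνi2 j)
  -- With constant coefficients the noise has mean zero.
  have hν0 : ∀ j, ∫ ω, ν j ω ∂μ = 0 := fun j => by
    have h1 : ∀ q, ∫ ω, ∑ l ∈ Finset.range k, L.noiseTerm μ X q l ω ∂μ = 0 := fun q => by
      rw [integral_finsetSum _ fun l _ => Scheme.integrable_noiseTerm hm hL _ l]
      exact Finset.sum_eq_zero fun l _ => hX.integral_noiseTerm hL h0 hτ hn _ l
    simp only [hν]
    rw [integral_sub (hνi1 j) (hνi2 j), h1, sub_zero,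
      integral_finsetSum _ fun p _ => (integrable_finsetSum _ fun l _ =>
        Scheme.integrable_noiseTerm hm hL _ l).const_mul _]
    exact Finset.sum_eq_zero fun p _ => by rw [integral_const_mul, h1, mul_zero]
  have hqsum : ∀ j, Integrable (fun ω => ∑ l ∈ Finset.range k, η (l + 1) ^ 2 / 2 * q j l ω) μ :=
    fun j => integrable_finsetSum _ fun l _ => (hqi j l).const_mul _
  have hterm : ∀ j, Integrable (fun ω => klDivergence (θ j) (ρ₁ j) +
    ∑ l ∈ Finset.range k, η (l + 1) ^ 2 / 2 * q j l ω - ν j ω + M j * L.bias τ * w) μ := fun j =>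
    (((integrable_const _).add (hqsum j)).sub (hνi j)).add (integrable_const _)
  have hFi : Integrable F μ := integrable_finsetSum _ fun j _ => (hterm j).const_mul _
  have hFint : ∫ ω, F ω ∂μ ≤ ∑ j, lam j * (|B| * Real.log (Fintype.card (S j) * Fintype.card (A j)) +
      W * Fintype.card (A j) + M j * L.bias τ * w) := by
    simp only [hF]
    rw [integral_finsetSum _ fun j _ => (hterm j).const_mul _]
    refine Finset.sum_le_sum fun j _ => ?_
    rw [integral_const_mul]
    refine mul_le_mul_of_nonneg_left ?_ (hG.1 j).le
    have hi1 : Integrable (fun ω => klDivergence (θ j) (ρ₁ j) +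
      ∑ l ∈ Finset.range k, η (l + 1) ^ 2 / 2 * q j l ω) μ := (integrable_const _).add (hqsum j)
    have hi2 : Integrable (fun ω => klDivergence (θ j) (ρ₁ j) +
      ∑ l ∈ Finset.range k, η (l + 1) ^ 2 / 2 * q j l ω - ν j ω) μ := hi1.sub (hνi j)
    rw [integral_add hi2 (integrable_const _), integral_sub hi1 (hνi j), hν0, sub_zero,
      integral_add (integrable_const _) (hqsum j), integral_const, integral_const, probReal_univ,
      one_smul, one_smul, integral_finsetSum _ fun l _ => (hqi j l).const_mul _]
    have h1 := (hB j (θ j) (hθ j)).trans (mul_le_mul_of_nonneg_right (le_abs_self B) (hlog j))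
    have h2 : ∑ l ∈ Finset.range k, ∫ ω, η (l + 1) ^ 2 / 2 * q j l ω ∂μ ≤ W * Fintype.card (A j) := by
      refine le_trans ?_ (mul_le_mul_of_nonneg_right (hW k) (Nat.cast_nonneg _))
      rw [Finset.sum_mul]
      refine Finset.sum_le_sum fun l _ => ?_
      rw [integral_const_mul]
      have h3 := hX.integral_occ_mul_reward_sq_le hL h0 hτ hn zero_le_one le_rfl l j
      refine (mul_le_mul_of_nonneg_left h3 (by positivity)).trans ?_
      refine mul_le_mul_of_nonneg_right ?_ (Nat.cast_nonneg _)
      nlinarith [sq_nonneg (η (l + 1))]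
    linarith
  have hpath : ∀ᵐ ω ∂μ, w * G.gapSum lam θ (L.avgOcc (fun t => X t ω) k) ≤ F ω := by
    filter_upwards [hX.ae_exists_isFresh hL h0 hτ hn] with ω hx
    refine (Scheme.sum_mul_gapSum_avgOcc_le (L := L) hG hθ hη hk
      fun l j => hL.occ_mem _ (l + 1) j).trans ?_
    refine Finset.sum_le_sum fun j _ => mul_le_mul_of_nonneg_left ?_ (hG.1 j).le
    refine (Scheme.sum_gain_le (L := L) (μ := μ) hL hη hb0 (fun l p => ?_)
      (G.polytope_subset_occSimplex j (hθ j)) k).trans ?_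
    · obtain ⟨t, ht⟩ := hx l
      exact hX.abs_rewardMean_sub_le hL h0 hτ hn ht p
    · rw [Scheme.sum_noise_mul_eq]
      exact add_le_add (sub_le_sub_right
        (klMirrorDescent_regret hρ₁ hpos hη hx k (hθ j)) _) le_rfl
  have hcont := G.continuous_gapSum lam θ
  have hpi : Integrable (fun ω => L.avgOcc (fun t => X t ω) k) μ := Integrable.of_eval hiavg
  have hclosed : IsClosed (Set.univ.pi G.polytope) :=
    isClosed_set_pi fun j _ => G.isClosed_polytope j
  have hcompact : IsCompact (Set.univ.pi G.polytope) :=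
    isCompact_univ_pi fun j => G.isCompact_polytope j
  have hgi : Integrable (G.gapSum lam θ ∘ fun ω => L.avgOcc (fun t => X t ω) k) μ := by
    obtain ⟨C, hC⟩ := hcompact.exists_bound_of_continuousOn hcont.continuousOn
    exact Integrable.of_bound (hcont.comp_aestronglyMeasurable hpi.aestronglyMeasurable) C
      (Eventually.of_forall fun ω => hC _ fun j _ => havg ω j)
  -- A second use of convexity: the gap at the expected average is at most the expected gap at the
  -- average.
  have hJ := (hG.convexOn_gapSum hθ).map_integral_le hcont.continuousOn hclosed
    (Eventually.of_forall fun ω j _ => havg ω j) hpi hgi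
  have hρeq : ∫ ω, L.avgOcc (fun t => X t ω) k ∂μ = ρ := funext fun j => eval_integral hiavg j
  rw [hρeq] at hJ
  have hmain : w * G.gapSum lam θ ρ ≤ w * (lam i * ε) := by
    calc w * G.gapSum lam θ ρ ≤ w * ∫ ω, G.gapSum lam θ (L.avgOcc (fun t => X t ω) k) ∂μ :=
          mul_le_mul_of_nonneg_left hJ hw0.le
      _ = ∫ ω, w * G.gapSum lam θ (L.avgOcc (fun t => X t ω) k) ∂μ := (integral_const_mul _ _).symm
      _ ≤ ∫ ω, F ω ∂μ := integral_mono_ae (hgi.const_mul w) hFi hpath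
      _ ≤ _ := hFint
      _ ≤ ∑ j, Λ * lam i * (|B| * Real.log (Fintype.card (S j) * Fintype.card (A j)) +
          W * Fintype.card (A j) + M j * L.bias τ * w) := by
          refine Finset.sum_le_sum fun j _ => mul_le_mul_of_nonneg_right (hΛ j i) ?_
          have := hlog j
          have : 0 ≤ M j := le_min two_pos.le (by positivity)
          positivity
      _ ≤ lam i * (Λ * ((|B| + W) * ∑ j, (Real.log (Fintype.card (S j) * Fintype.card (A j)) +
          Fintype.card (A j))) + Λ * (∑ j, M j) * L.bias τ * w) := by
          rw [← Finset.mul_sum, Finset.sum_add_distrib, ← Finset.sum_mul, ← Finset.sum_mul,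
            mul_comm Λ (lam i), mul_assoc (lam i)]
          refine mul_le_mul_of_nonneg_left ?_ (hG.1 i).le
          rw [mul_add]
          refine add_le_add (mul_le_mul_of_nonneg_left ?_ hΛ0.le) (le_of_eq (by ring))
          rw [Finset.mul_sum]
          refine Finset.sum_le_sum fun j _ => ?_
          have hA : (0 : ℝ) ≤ Fintype.card (A j) := Nat.cast_nonneg _
          nlinarith [mul_nonneg hW0.le (hlog j), mul_nonneg (abs_nonneg B) hA]
      -- The regret uses `ε / 2` and the bias `ε / 3`, together less than `ε`.
      _ ≤ lam i * (w * (ε / 2) + ε / 3 * w) := by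
          refine mul_le_mul_of_nonneg_left (add_le_add ?_ (mul_le_mul_of_nonneg_right
            (Scheme.ratio_mul_bias_le h0 hε hn hΛ0 hd) hw0.le)) (hG.1 i).le
          rw [← Finset.sum_div] at hw
          have h1 := mul_le_mul_of_nonneg_right hw (by positivity : 0 ≤ ε / 2)
          refine le_trans (le_of_eq ?_) h1
          field_simp
      _ ≤ w * (lam i * ε) := by
          have := mul_pos (mul_pos (hG.1 i) hw0) hε
          linarith
  exact le_of_mul_le_mul_left hmain hw0

end MirrorDescent

end ChainGame

/-! ### The choice of the constants. -/

theorem mainTheorem2 (β : ℝ) (hβ : 0 < β) (hβ' : β ≤ 1 / 2) (lamRatio : ℝ) :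
    -- (a) dual averaging with `K`-strongly convex regularizers
    (∀ K : ℝ, 0 < K → ∀ B : ℝ, ∃ C : ℝ, 0 < C ∧
      ∀ (n : ℕ) (S A : Fin n → Type*)
        [∀ i, Fintype (S i)] [∀ i, Nonempty (S i)] [∀ i, Fintype (A i)] [∀ i, Nonempty (A i)]
        (G : ChainGame n S A) (τ : ℝ) (lam : Fin n → ℝ) (ε : ℝ) (d : ℕ) (δ : Fin n → ℝ)
        (h : ∀ i, OccVec (S i) (A i) → ℝ) (ρ₁ : ∀ i, OccVec (S i) (A i)) (s₀ : ∀ i, S i),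
        0 < τ → G.MixesWithin τ →
        G.SociallyConcave lam → (∀ i j, lam i ≤ lamRatio * lam j) →
        0 < ε →
        τ * Real.log (6 * n / ε * ∑ i, (Fintype.card (A i) : ℝ) * Fintype.card (S i)) ≤ d →
        τ * Real.log (6 * n * lamRatio / ε *
          ∑ i, min 2 ((Fintype.card (A i) : ℝ) * Fintype.card (S i))) ≤ d →
        (∀ i, 0 < δ i) →
        (∀ i, ∀ x ∈ G.polytope i, ∃ y ∈ G.shrunkPolytope i (δ i),
          ‖x - y‖ ≤ ε / (2 * √((Fintype.card (A i) : ℝ) * Fintype.card (S i)))) →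
        (∀ i, ρ₁ i ∈ G.shrunkPolytope i (δ i)) →
        (∀ i, StrongConvexOn (G.shrunkPolytope i (δ i)) K (h i)) →
        (∀ i Y, ∃ x ∈ G.shrunkPolytope i (δ i),
          IsMaxOn (fun x => inner ℝ x Y - h i x) (G.shrunkPolytope i (δ i)) x) →
        ∀ (Ω : Type*) [MeasurableSpace Ω] (μ : MeasureTheory.Measure Ω)
          [MeasureTheory.IsProbabilityMeasure μ] (X : ℕ → Ω → (∀ i, S i) × (∀ i, A i)),
          let L := G.dualAveraging d (fun l => (l : ℝ) ^ (-(1 / 2) - β)) δ h ρ₁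
          L.IsRun s₀ μ X →
          (∀ᵐ ω ∂μ, ∀ᶠ k in Filter.atTop, G.IsEpsNash ε (L.avgOcc (fun t => X t ω) k)) ∧
          (β < 1 / 2 →
            (∀ i, ∀ x ∈ G.shrunkPolytope i (δ i), ∀ y ∈ G.shrunkPolytope i (δ i),
              h i x - h i y ≤ B * (Fintype.card (S i) * Fintype.card (A i))) →
            ∀ α : ℝ, 0 < α → α < 1 →
              ENNReal.ofReal (1 - α) ≤ μ {ω | ∀ k : ℕ, 1 ≤ k →
                C * (∑ i, (n * Fintype.card (S i) * Fintype.card (A i) : ℝ) / (α * ε * δ i))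
                  ^ (2 / (1 - 2 * β)) ≤ k →
                G.IsEpsNash ε (L.avgOcc (fun t => X t ω) k)})) ∧
    -- (b) mirror descent with the Kullback-Leibler divergence
    (β < 1 / 2 → ∀ B : ℝ, ∃ C : ℝ, 0 < C ∧
      ∀ (n : ℕ) (S A : Fin n → Type*)
        [∀ i, Fintype (S i)] [∀ i, Nonempty (S i)] [∀ i, Fintype (A i)] [∀ i, Nonempty (A i)]
        (G : ChainGame n S A) (τ : ℝ) (lam : Fin n → ℝ) (ε : ℝ) (d : ℕ) (δ : Fin n → ℝ)
        (ρ₁ : ∀ i, OccVec (S i) (A i)) (s₀ : ∀ i, S i),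
        0 < τ → G.MixesWithin τ →
        G.SociallyConcave lam → (∀ i j, lam i ≤ lamRatio * lam j) →
        0 < ε →
        τ * Real.log (6 * n / ε * ∑ i, (Fintype.card (A i) : ℝ) * Fintype.card (S i)) ≤ d →
        τ * Real.log (6 * n * lamRatio / ε *
          ∑ i, min 2 ((Fintype.card (A i) : ℝ) * Fintype.card (S i))) ≤ d →
        (∀ i, 0 < δ i) →
        (∀ i, ρ₁ i ∈ G.shrunkPolytope i (δ i)) →
        (∀ i, ∀ θ ∈ G.polytope i, klDivergence θ (ρ₁ i) ≤
          B * Real.log (Fintype.card (S i) * Fintype.card (A i))) →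
        ∀ (Ω : Type*) [MeasurableSpace Ω] (μ : MeasureTheory.Measure Ω)
          [MeasureTheory.IsProbabilityMeasure μ] (X : ℕ → Ω → (∀ i, S i) × (∀ i, A i)),
          let L := G.klMirrorDescent d (fun l => (l : ℝ) ^ (-(1 / 2) - β)) ρ₁
          L.IsRun s₀ μ X →
          ∀ k : ℕ, 1 ≤ k →
            C * (∑ i, (Real.log (Fintype.card (S i) * Fintype.card (A i))
              + Fintype.card (A i)) / ε) ^ (2 / (1 - 2 * β)) ≤ k →
            G.IsEpsNash ε (fun i => ∫ ω, L.avgOcc (fun t => X t ω) k i ∂μ)) := by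
  have hη : ∀ l : ℕ, (0 : ℝ) < ((l + 1 : ℕ) : ℝ) ^ (-(1 / 2) - β) := fun l => by positivity
  obtain ⟨W, hW0, hW⟩ := exists_sum_sq_step_le hβ
  refine ⟨fun K hK B => ?_, fun hβ1 B => ?_⟩
  -- `W` depends on `β` only. The absolute values and the summand `1` make the constant positive
  -- whatever the signs of `B` and `lamRatio`, as it is fixed before the game.
  · set c := 6 * |lamRatio| * (|B| + 2 + (1 + 1 / (2 * K)) * (3 * W)) + 1 with hc
    have hc0 : 0 < c := by positivity
    refine ⟨c ^ (2 / (1 - 2 * β)), Real.rpow_pos_of_pos hc0 _, ?_⟩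
    intro n S A _ _ _ _ G τ lam ε d δ h ρ₁ s₀ h0 hτ hG hΛ hε _ hd hδ hshrink hρ₁ hh hmax Ω _ μ _ X L hX
    -- Without players every profile is an equilibrium; with at least one player the ratio bound
    -- forces `1 ≤ lamRatio`.
    rcases n.eq_zero_or_pos with hn | hn
    · have hnash := fun ρ => ChainGame.isEpsNash_of_eq_zero (G := G) hn ε ρ
      refine ⟨Filter.Eventually.of_forall fun ω => Filter.Eventually.of_forall fun k => hnash _,
        fun _ _ α hα _ => ?_⟩
      simp only [hnash, implies_true, Set.ofPred_true, MeasureTheory.measure_univ]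
      exact ENNReal.ofReal_le_one.2 (by linarith)
    refine ⟨ChainGame.dualAveraging_ae_eventually_isEpsNash hδ hρ₁ hmax hK hh hG hΛ hε hd hshrink hX h0
      hτ hn hη hW (tendsto_sum_step hβ'), fun hβ1 hB α hα hα1 => ?_⟩
    refine (ChainGame.dualAveraging_le_measure_isEpsNash hδ hρ₁ hmax hK hh hG hΛ hε hd hshrink hX h0
      hτ hn hη hW hW0 hB hα hα1).trans (MeasureTheory.measure_mono fun ω hω k hk hCk => ?_)
    have hT : 0 ≤ ∑ i, (n * Fintype.card (S i) * Fintype.card (A i) : ℝ) / (α * ε * δ i) :=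
      Finset.sum_nonneg fun i _ => div_nonneg (by positivity)
        (mul_pos (mul_pos hα hε) (hδ i)).le
    refine hω k hk (le_trans (mul_le_mul_of_nonneg_right ?_ hT)
      (mul_le_sum_step hβ hβ1 hc0.le hT hk hCk))
    have h1 : 6 * lamRatio * (|B| + 2 + (1 + 1 / (2 * K)) * (3 * W)) ≤
        6 * |lamRatio| * (|B| + 2 + (1 + 1 / (2 * K)) * (3 * W)) :=
      mul_le_mul_of_nonneg_right (by linarith [le_abs_self lamRatio]) (by positivity)
    linarith
  · set c := 2 * |lamRatio| * (|B| + W) + 1 with hc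
    have hc0 : 0 < c := by positivity
    refine ⟨c ^ (2 / (1 - 2 * β)), Real.rpow_pos_of_pos hc0 _, ?_⟩
    intro n S A _ _ _ _ G τ lam ε d δ ρ₁ s₀ h0 hτ hG hΛ hε _ hd hδ hρ₁ hB Ω _ μ _ X L hX k hk hCk
    rcases n.eq_zero_or_pos with hn | hn
    · exact ChainGame.isEpsNash_of_eq_zero hn ε _
    have hT : 0 ≤ ∑ i, (Real.log (Fintype.card (S i) * Fintype.card (A i))
        + Fintype.card (A i)) / ε :=
      Finset.sum_nonneg fun i _ => div_nonneg (add_nonneg (Real.log_nonneg (by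
        exact_mod_cast Nat.mul_pos (Fintype.card_pos (α := S i)) (Fintype.card_pos (α := A i))))
        (Nat.cast_nonneg _)) hε.le
    refine ChainGame.klMirrorDescent_isEpsNash (fun i => (hρ₁ i).1)
      (fun i p => (hδ i).trans_le ((hρ₁ i).2 p)) hG hΛ hε hd hX h0 hτ hn hη hW hW0 hB hk ?_
    refine le_trans (mul_le_mul_of_nonneg_right ?_ hT) (mul_le_sum_step hβ hβ1 hc0.le hT hk hCk)
    have h1 : 2 * lamRatio * (|B| + W) ≤ 2 * |lamRatio| * (|B| + W) :=
      mul_le_mul_of_nonneg_right (by linarith [le_abs_self lamRatio]) (by positivity)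
    linarith
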